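/- Let $K$ be a field of characteristic $0$; all vector spaces are over $K$. A *braiding* on a vector space $V$ is an invertible linear map $\sigma\in\mathrm{End}(V\otimes V)$ with $\sigma_1\sigma_2\sigma_1=\sigma_2\sigma_1\sigma_2$ on $V^{\otimes3}$, where $\sigma_i$ denotes $\sigma$ acting on the $i$-th and $(i+1)$-st tensor factors. A *YB algebra* $(V,m,\sigma)$ is a unital associative algebra with a braiding such that $\sigma(m\otimes\mathrm{id})=(\mathrm{id}\otimes m)\sigma_1\sigma_2$, $\sigma(\mathrm{id}\otimes m)=(m\otimes\mathrm{id})\sigma_2\sigma_1$, $\sigma(1\otimes a)=a\otimes1$ and $\sigma(a\otimes1)=1\otimes a$. A *unital 2-YB algebra* $(V,\ast,\cdot,\sigma)$ is a space with two associative products with a common unit such that $(V,\ast,\sigma)$ and $(V,\cdot,\sigma)$ are YB algebras. For a braided vector space $(V,\sigma)$ let $T(V)=\bigoplus_{n\ge0}V^{\otimes n}$, let $\underline\otimes$ denote the outer tensor product, and let $\beta$ be the map on $T(V)\underline\otimes T(V)$ with components $\beta_{ij}=T^\sigma_{\chi_{ij}}:V^{\otimes i}\underline\otimes V^{\otimes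 j}\to V^{\otimes j}\underline\otimes V^{\otimes i}$, where $\chi_{ij}\in\mathfrak S_{i+j}$ is the permutation $a\mapsto a+j$ $(a\le i)$, $i+b\mapsto b$ $(b\le j)$, and $T^\sigma_w=\sigma_{i_1}\cdots\sigma_{i_l}$ for a reduced expression $w=s_{i_1}\cdots s_{i_l}$ (so $\beta_{0i},\beta_{i0}$ are flips). Let $\delta$ be the deconcatenation coproduct of $T(V)$, $\Delta_\beta=(\mathrm{id}\otimes\beta\otimes\mathrm{id})(\delta\otimes\delta)$, and let $\overline{\Delta_\beta}(x)=\Delta_\beta(x)-x\otimes(1\underline\otimes1)-(1\underline\otimes1)\otimes x$, with iterates $\overline{\Delta_\beta}^{(0)}=\mathrm{id}$, $\overline{\Delta_\beta}^{(n)}=(\overline{\Delta_\beta}\otimes\mathrm{id}^{\otimes(n-1)})\overline{\Delta_\beta}^{(n-1)}$. For linear maps $M_{pq}:V^{\otimes p}\underline\otimes V^{\otimes q}\to V$ $(p,q\ge0)$ write $M=\bigoplus M_{pq}:T(V)\underline\otimes T(V)\to V$. A *quantum $\mathbf B_\infty$-algebra* $(V,M,\sigma)$ is a braided vector space with such maps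 satisfying: 1. $M_{00}=0$, $M_{10}=\mathrm{id}_V=M_{01}$, $M_{n0}=0=M_{0n}$ for $n\ge2$; 2. for all $i,j,k\ge1$: $\beta_{1k}(M_{ij}\otimes\mathrm{id}_V^{\otimes k})=(\mathrm{id}_V^{\otimes k}\otimes M_{ij})\beta_{i+j,k}$ and $\beta_{i1}(\mathrm{id}_V^{\otimes i}\otimes M_{jk})=(M_{jk}\otimes\mathrm{id}_V^{\otimes i})\beta_{i,j+k}$; 3. for all $i,j,k\ge1$, on $V^{\otimes i}\underline\otimes V^{\otimes j}\underline\otimes V^{\otimes k}$: $$\sum_{r=1}^{i+j}M_{rk}\circ\big((M^{\otimes r}\overline{\Delta_\beta}^{(r-1)})\otimes\mathrm{id}_V^{\otimes k}\big)=\sum_{l=1}^{j+k}M_{il}\circ\big(\mathrm{id}_V^{\otimes i}\otimes(M^{\otimes l}\overline{\Delta_\beta}^{(l-1)})\big).$$ Let $(V,\ast,\cdot,\sigma)$ be a unital 2-YB algebra, and let $\cdot^{k}:V^{\otimes(k+1)}\to V$ be the iterated product. Define $M_{pq}$ by the equations in 1. and, for $p,q\ge1$, inductively on $p+q$ by $$M_{pq}=\ast\circ(\cdot^{p-1}\otimes\cdot^{q-1})-\sum_{k=2}^{p+q}\cdot^{k-1}\circ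 M^{\otimes k}\circ\overline{\Delta_\beta}^{(k-1)}\big|_{V^{\otimes p}\underline\otimes V^{\otimes q}},$$ where only the $M_{ij}$ with $i+j<p+q$ contribute to the sum. **Proposition 5.2.** For every unital 2-YB algebra $(V,\ast,\cdot,\sigma)$, the triple $(V,M,\sigma)$ so defined is a quantum $\mathbf B_\infty$-algebra. Moreover, if $f:V\to V'$ is a morphism of 2-YB algebras, i.e. a linear map that is multiplicative for both products and satisfies $(f\otimes f)\sigma=\sigma'(f\otimes f)$, then $f\circ M_{pq}=M'_{pq}\circ(f^{\otimes p}\otimes f^{\otimes q})$ for all $p,q\ge0$; hence $(V,\ast,\cdot,\sigma)\mapsto(V,M,\sigma)$, $f\mapsto f$ is a functor from the category of unital 2-YB algebras to that of quantum $\mathbf B_\infty$-algebras, whose morphisms are the linear maps commuting with the braidings and with all operations $M_{pq}$. -/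

import Mathlib

open scoped TensorProduct DirectSum
open CategoryTheory

universe u v

noncomputable section

namespace QuantumBInfty

section Braidings

variable {K : Type u} [Field K] {V : Type v} [AddCommGroup V] [Module K V]

/-- `σ₁ = σ ⊗ id` on `V ⊗ V ⊗ V`. -/
def sigmaOne (σ : V ⊗[K] V →ₗ[K] V ⊗[K] V) :
    (V ⊗[K] V) ⊗[K] V →ₗ[K] (V ⊗[K] V) ⊗[K] V :=
  LinearMap.rTensor V σ

/-- `σ₂ = id ⊗ σ` on `V ⊗ V ⊗ V`. -/
def sigmaTwo (σ : V ⊗[K] V →ₗ[K] V ⊗[K] V) :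
    (V ⊗[K] V) ⊗[K] V →ₗ[K] (V ⊗[K] V) ⊗[K] V :=
  (TensorProduct.assoc K V V V).symm.toLinearMap ∘ₗ LinearMap.lTensor V σ ∘ₗ
    (TensorProduct.assoc K V V V).toLinearMap

/-- `(V, σ)` is a braided vector space: `σ` is invertible and satisfies the quantum Yang-Baxter
equation `σ₁ σ₂ σ₁ = σ₂ σ₁ σ₂`. -/
structure IsBraiding (σ : V ⊗[K] V →ₗ[K] V ⊗[K] V) : Prop where
  bijective : Function.Bijective σ
  yang_baxter : sigmaOne σ ∘ₗ sigmaTwo σ ∘ₗ sigmaOne σ = sigmaTwo σ ∘ₗ sigmaOne σ ∘ₗ sigmaTwo σ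

/-- `(V, m, one, σ)` is a (unital, associative) Yang-Baxter algebra. -/
structure IsYBAlgebra (σ : V ⊗[K] V →ₗ[K] V ⊗[K] V) (m : V ⊗[K] V →ₗ[K] V) (one : V) :
    Prop where
  isBraiding : IsBraiding σ
  assoc : ∀ a b c : V, m (m (a ⊗ₜ b) ⊗ₜ c) = m (a ⊗ₜ m (b ⊗ₜ c))
  one_mul : ∀ a : V, m (one ⊗ₜ a) = a
  mul_one : ∀ a : V, m (a ⊗ₜ one) = a
  /-- `σ (m ⊗ id) = (id ⊗ m) σ₁ σ₂` -/
  braid_mul_left : σ ∘ₗ LinearMap.rTensor V m =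
    LinearMap.lTensor V m ∘ₗ (TensorProduct.assoc K V V V).toLinearMap ∘ₗ
      sigmaOne σ ∘ₗ sigmaTwo σ
  /-- `σ (id ⊗ m) = (m ⊗ id) σ₂ σ₁` -/
  braid_mul_right : σ ∘ₗ LinearMap.lTensor V m ∘ₗ (TensorProduct.assoc K V V V).toLinearMap =
    LinearMap.rTensor V m ∘ₗ sigmaTwo σ ∘ₗ sigmaOne σ
  braid_one_left : ∀ a : V, σ (one ⊗ₜ a) = a ⊗ₜ one
  braid_one_right : ∀ a : V, σ (a ⊗ₜ one) = one ⊗ₜ a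

/-- `(V, ∗, ·, σ)` is a unital 2-YB algebra: two associative products `star` and `dot` with a
common unit, each forming a Yang-Baxter algebra with `σ`. -/
structure IsTwoYBAlgebra (σ : V ⊗[K] V →ₗ[K] V ⊗[K] V) (star dot : V ⊗[K] V →ₗ[K] V)
    (one : V) : Prop where
  star_isYB : IsYBAlgebra σ star one
  dot_isYB : IsYBAlgebra σ dot one

end Braidings

section TensorPowers

variable (K : Type u) [Field K]

/-- The identification `V^{⊗1} ≃ V`. -/
def oneEquiv (V : Type*) [AddCommMonoid V] [Module K V] : (⨂[K]^1 V) ≃ₗ[K] V :=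
  PiTensorProduct.subsingletonEquiv (0 : Fin 1)

variable (V : Type v) [AddCommGroup V] [Module K V]

/-- The identification `V ⊗ V ≃ V^{⊗2}`. -/
def pairEquiv : V ⊗[K] V ≃ₗ[K] (⨂[K]^2 V) :=
  (TensorProduct.congr (oneEquiv K V).symm (oneEquiv K V).symm).trans TensorPower.mulEquiv

/-- The identification `(V^{⊗k} ⊗ V^{⊗2}) ⊗ V^{⊗r} ≃ V^{⊗n}` for `k + 2 + r = n`. -/
def threeBlocks {n k r : ℕ} (h : k + 2 + r = n) :
    ((⨂[K]^k V) ⊗[K] (⨂[K]^2 V)) ⊗[K] (⨂[K]^r V) ≃ₗ[K] (⨂[K]^n V) :=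
  ((TensorProduct.congr TensorPower.mulEquiv (LinearEquiv.refl K _)).trans
    TensorPower.mulEquiv).trans (TensorPower.cast K V h)

/-- The tensor space `T(V) = ⨁ₙ V^{⊗n}`. -/
def TSpace : Type (max u v) := ⨁ n : ℕ, ⨂[K]^n V

instance : AddCommGroup (TSpace K V) := inferInstanceAs (AddCommGroup (⨁ n : ℕ, ⨂[K]^n V))

instance : Module K (TSpace K V) := inferInstanceAs (Module K (⨁ n : ℕ, ⨂[K]^n V))

/-- The inclusion `V^{⊗n} → T(V)`. -/
def tIncl (n : ℕ) : (⨂[K]^n V) →ₗ[K] TSpace K V :=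
  DirectSum.lof K ℕ (fun n => ⨂[K]^n V) n

/-- The unit `1 ∈ K = V^{⊗0} ⊆ T(V)`. -/
def tOne : TSpace K V := tIncl K V 0 (PiTensorProduct.tprod K Fin.elim0)

/-- The inclusion `V^{⊗p} ⊗ V^{⊗q} → T(V) ⊗ T(V)`. -/
def incl (p q : ℕ) : (⨂[K]^p V) ⊗[K] (⨂[K]^q V) →ₗ[K] TSpace K V ⊗[K] TSpace K V :=
  TensorProduct.map (tIncl K V p) (tIncl K V q)

variable {K V}

/-- The linear map on `T(V)` with given components on the summands `V^{⊗n}`. -/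
def tLift {W : Type*} [AddCommMonoid W] [Module K W] (f : ∀ n : ℕ, (⨂[K]^n V) →ₗ[K] W) :
    TSpace K V →ₗ[K] W :=
  DirectSum.toModule K ℕ W f

theorem tLift_tIncl {W : Type*} [AddCommMonoid W] [Module K W]
    (f : ∀ n : ℕ, (⨂[K]^n V) →ₗ[K] W) (n : ℕ) (x : ⨂[K]^n V) :
    tLift f (tIncl K V n x) = f n x :=
  DirectSum.toModule_lof (M := fun n : ℕ => ⨂[K]^n V) (φ := f) K n x

/-- The linear map on `T(V) ⊗ T(V)` with given components on the summands
`V^{⊗p} ⊗ V^{⊗q}`. -/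
def ofComponents {W : Type*} [AddCommMonoid W] [Module K W]
    (f : ∀ p q : ℕ, (⨂[K]^p V) ⊗[K] (⨂[K]^q V) →ₗ[K] W) :
    TSpace K V ⊗[K] TSpace K V →ₗ[K] W :=
  TensorProduct.lift (tLift fun p => (tLift fun q => (TensorProduct.curry (f p q)).flip).flip)

theorem ofComponents_comp_incl {W : Type*} [AddCommMonoid W] [Module K W]
    (f : ∀ p q : ℕ, (⨂[K]^p V) ⊗[K] (⨂[K]^q V) →ₗ[K] W) (p q : ℕ) :
    ofComponents f ∘ₗ incl K V p q = f p q := by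
  ext x y
  simp [ofComponents, incl, tLift_tIncl]

/-- The operator `σ` on `V^{⊗n}` in the tensor slots `k` and `k + 1`, where slots are counted
from `0`: this is `id^{⊗k} ⊗ σ ⊗ id^{⊗(n-k-2)}`. (Convention: the identity if there are no
such slots.) -/
def sigmaAt (σ : V ⊗[K] V →ₗ[K] V ⊗[K] V) (n k : ℕ) : Module.End K (⨂[K]^n V) :=
  if h : k + 2 ≤ n then
    (threeBlocks K V (Nat.add_sub_of_le h)).toLinearMap ∘ₗ
      TensorProduct.map (TensorProduct.map LinearMap.id
        ((pairEquiv K V).toLinearMap ∘ₗ σ ∘ₗ (pairEquiv K V).symm.toLinearMap)) LinearMap.id ∘ₗ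
      (threeBlocks K V (Nat.add_sub_of_le h)).symm.toLinearMap
  else LinearMap.id

/-- A reduced expression of the block permutation `χ_{ij}`, of length `i * j`: with adjacent
transpositions numbered from `0`, the word
`(s_{j-1} ⋯ s_1 s_0) (s_j ⋯ s_2 s_1) ⋯ (s_{i+j-2} ⋯ s_i s_{i-1})`. As operators, the rightmost
letter acts first: the last slot of the first block is moved to the right past the second
block, then the slot before it, and so on. -/
def chiWord (i j : ℕ) : List ℕ :=
  (List.range i).flatMap fun a => (List.range j).reverse.map fun b => a + b

/-- The lift to `V^{⊗n}` of a word in the adjacent transpositions. -/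
def wordLift (σ : V ⊗[K] V →ₗ[K] V ⊗[K] V) (n : ℕ) (w : List ℕ) : Module.End K (⨂[K]^n V) :=
  (w.map (sigmaAt σ n)).prod

/-- The braiding `β_{ij} = T^σ_{χ_{ij}} : V^{⊗i} ⊗ V^{⊗j} → V^{⊗j} ⊗ V^{⊗i}`
(the flip if `i = 0` or `j = 0`, because the word is then empty). -/
def betaComp (σ : V ⊗[K] V →ₗ[K] V ⊗[K] V) (i j : ℕ) :
    (⨂[K]^i V) ⊗[K] (⨂[K]^j V) →ₗ[K] (⨂[K]^j V) ⊗[K] (⨂[K]^i V) :=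
  TensorPower.mulEquiv.symm.toLinearMap ∘ₗ
    (TensorPower.cast K V (Nat.add_comm i j)).toLinearMap ∘ₗ
    wordLift σ (i + j) (chiWord i j) ∘ₗ TensorPower.mulEquiv.toLinearMap

/-- The braiding `β` on `T(V)`. -/
def beta (σ : V ⊗[K] V →ₗ[K] V ⊗[K] V) :
    TSpace K V ⊗[K] TSpace K V →ₗ[K] TSpace K V ⊗[K] TSpace K V :=
  ofComponents fun i j => incl K V j i ∘ₗ betaComp σ i j

variable (K V) in
/-- The deconcatenation coproduct
`δ (v₁ ⊗ ⋯ ⊗ vₙ) = ∑_{p + q = n} (v₁ ⊗ ⋯ ⊗ v_p) ⊗ (v_{p+1} ⊗ ⋯ ⊗ vₙ)`. -/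
def deconc : TSpace K V →ₗ[K] TSpace K V ⊗[K] TSpace K V :=
  tLift fun n =>
    ∑ x ∈ (Finset.HasAntidiagonal.antidiagonal n).attach,
      incl K V x.1.1 x.1.2 ∘ₗ TensorPower.mulEquiv.symm.toLinearMap ∘ₗ
        (TensorPower.cast K V (Finset.HasAntidiagonal.mem_antidiagonal.mp x.2).symm).toLinearMap

/-- `id ⊗ b ⊗ id` on `C ⊗ C ⊗ C ⊗ C`, written as `(C ⊗ C) ⊗ (C ⊗ C)`. -/
def midMap {C : Type*} [AddCommMonoid C] [Module K C] (b : C ⊗[K] C →ₗ[K] C ⊗[K] C) :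
    (C ⊗[K] C) ⊗[K] (C ⊗[K] C) →ₗ[K] (C ⊗[K] C) ⊗[K] (C ⊗[K] C) :=
  (TensorProduct.assoc K C C (C ⊗[K] C)).symm.toLinearMap ∘ₗ
    LinearMap.lTensor C ((TensorProduct.assoc K C C C).toLinearMap ∘ₗ LinearMap.rTensor C b ∘ₗ
      (TensorProduct.assoc K C C C).symm.toLinearMap) ∘ₗ
    (TensorProduct.assoc K C C (C ⊗[K] C)).toLinearMap

/-- The braided coproduct `Δ_β = (id ⊗ β ⊗ id) (δ ⊗ δ)` on `T(V) ⊗ T(V)`. -/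
def coprodBeta (σ : V ⊗[K] V →ₗ[K] V ⊗[K] V) :
    TSpace K V ⊗[K] TSpace K V →ₗ[K]
      (TSpace K V ⊗[K] TSpace K V) ⊗[K] (TSpace K V ⊗[K] TSpace K V) :=
  midMap (beta σ) ∘ₗ TensorProduct.map (deconc K V) (deconc K V)

/-- The reduced coproduct `x ↦ Δ_β x - x ⊗ g - g ⊗ x` of `T(V) ⊗ T(V)`, with respect to the
group-like element `g = 1 ⊗ 1`. -/
def reducedCoprod (σ : V ⊗[K] V →ₗ[K] V ⊗[K] V) :
    TSpace K V ⊗[K] TSpace K V →ₗ[K]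
      (TSpace K V ⊗[K] TSpace K V) ⊗[K] (TSpace K V ⊗[K] TSpace K V) :=
  coprodBeta σ -
    (TensorProduct.mk K (TSpace K V ⊗[K] TSpace K V) (TSpace K V ⊗[K] TSpace K V)).flip
      (tOne K V ⊗ₜ[K] tOne K V) -
    TensorProduct.mk K (TSpace K V ⊗[K] TSpace K V) (TSpace K V ⊗[K] TSpace K V)
      (tOne K V ⊗ₜ[K] tOne K V)

/-- The iterates `D^{(n)} : C → C^{⊗(n+1)}` of a map `D : C → C ⊗ C`, with `D^{(0)} = id` and
`D^{(n+1)} = (D^{(n)} ⊗ id) D`, that is `(D ⊗ id^{⊗n}) ⋯ (D ⊗ id) D`. -/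
def iter {C : Type*} [AddCommMonoid C] [Module K C] (D : C →ₗ[K] C ⊗[K] C) :
    ∀ n : ℕ, C →ₗ[K] (⨂[K]^(n + 1) C)
  | 0 => (oneEquiv K C).symm.toLinearMap
  | n + 1 => TensorPower.mulEquiv.toLinearMap ∘ₗ
      TensorProduct.map (iter D n) (oneEquiv K C).symm.toLinearMap ∘ₗ D

variable (K V) in
/-- Families of operations `M_{pq} : V^{⊗p} ⊗ V^{⊗q} → V`. -/
abbrev Ops : Type (max u v) := ∀ p q : ℕ, (⨂[K]^p V) ⊗[K] (⨂[K]^q V) →ₗ[K] V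

/-- `M^{⊗(n+1)} ∘ (reduced Δ_β)^{(n)} : T(V) ⊗ T(V) → V^{⊗(n+1)}`, where
`M = ⨁ M_{pq} : T(V) ⊗ T(V) → V`. -/
def opsPow (σ : V ⊗[K] V →ₗ[K] V ⊗[K] V) (M : Ops K V) (n : ℕ) :
    TSpace K V ⊗[K] TSpace K V →ₗ[K] (⨂[K]^(n + 1) V) :=
  PiTensorProduct.map (fun _ => ofComponents M) ∘ₗ iter (reducedCoprod σ) n

/-- `(V, M, σ)` is a quantum `B_∞`-algebra. -/
structure IsQuantumBInfty (σ : V ⊗[K] V →ₗ[K] V ⊗[K] V) (M : Ops K V) : Prop where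
  isBraiding : IsBraiding σ
  zero_zero : M 0 0 = 0
  one_zero : ∀ (v : Fin 1 → V) (w : Fin 0 → V),
    M 1 0 (PiTensorProduct.tprod K v ⊗ₜ PiTensorProduct.tprod K w) = v 0
  zero_one : ∀ (v : Fin 0 → V) (w : Fin 1 → V),
    M 0 1 (PiTensorProduct.tprod K v ⊗ₜ PiTensorProduct.tprod K w) = w 0
  right_zero : ∀ n, 2 ≤ n → M n 0 = 0
  left_zero : ∀ n, 2 ≤ n → M 0 n = 0
  /-- `β_{1k} (M_{ij} ⊗ id^{⊗k}) = (id^{⊗k} ⊗ M_{ij}) β_{i+j,k}` -/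
  braid_left : ∀ i j k : ℕ, 1 ≤ i → 1 ≤ j → 1 ≤ k →
    betaComp σ 1 k ∘ₗ
        TensorProduct.map ((oneEquiv K V).symm.toLinearMap ∘ₗ M i j) LinearMap.id =
      TensorProduct.map LinearMap.id ((oneEquiv K V).symm.toLinearMap ∘ₗ M i j ∘ₗ
          TensorPower.mulEquiv.symm.toLinearMap) ∘ₗ
        betaComp σ (i + j) k ∘ₗ
        TensorProduct.map TensorPower.mulEquiv.toLinearMap LinearMap.id
  /-- `β_{i1} (id^{⊗i} ⊗ M_{jk}) = (M_{jk} ⊗ id^{⊗i}) β_{i,j+k}` -/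
  braid_right : ∀ i j k : ℕ, 1 ≤ i → 1 ≤ j → 1 ≤ k →
    betaComp σ i 1 ∘ₗ
        TensorProduct.map LinearMap.id ((oneEquiv K V).symm.toLinearMap ∘ₗ M j k) =
      TensorProduct.map ((oneEquiv K V).symm.toLinearMap ∘ₗ M j k ∘ₗ
          TensorPower.mulEquiv.symm.toLinearMap) LinearMap.id ∘ₗ
        betaComp σ i (j + k) ∘ₗ
        TensorProduct.map LinearMap.id TensorPower.mulEquiv.toLinearMap
  /-- The associativity condition on `V^{⊗i} ⊗ V^{⊗j} ⊗ V^{⊗k}`; the summation index is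
  `r - 1`, respectively `l - 1`, for `1 ≤ r ≤ i + j` and `1 ≤ l ≤ j + k`. -/
  assoc : ∀ i j k : ℕ, 1 ≤ i → 1 ≤ j → 1 ≤ k →
    ∑ s ∈ Finset.range (i + j),
        M (s + 1) k ∘ₗ TensorProduct.map (opsPow σ M s ∘ₗ incl K V i j) LinearMap.id =
      (∑ s ∈ Finset.range (j + k),
        M i (s + 1) ∘ₗ TensorProduct.map LinearMap.id (opsPow σ M s ∘ₗ incl K V j k)) ∘ₗ
        (TensorProduct.assoc K (⨂[K]^i V) (⨂[K]^j V) (⨂[K]^k V)).toLinearMap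

/-- The iterated product `m^k : V^{⊗(k+1)} → V`,
`v₁ ⊗ ⋯ ⊗ v_{k+1} ↦ (⋯ (v₁ v₂) ⋯) v_{k+1}`. -/
def iterMul (m : V ⊗[K] V →ₗ[K] V) : ∀ k : ℕ, (⨂[K]^(k + 1) V) →ₗ[K] V
  | 0 => (oneEquiv K V).toLinearMap
  | k + 1 => m ∘ₗ TensorProduct.map (iterMul m k) (oneEquiv K V).toLinearMap ∘ₗ
      TensorPower.mulEquiv.symm.toLinearMap

/-- The operations `M_{pq}` of a 2-YB algebra, by recursion on `p + q`. One has `M_{00} = 0`,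
`M_{10} = id = M_{01}`, `M_{n0} = 0 = M_{0n}` for `n ≥ 2`, and, for `p, q ≥ 1`,
`M_{pq} = ∗ (·^{p-1} ⊗ ·^{q-1}) - ∑_{k=2}^{p+q} ·^{k-1} M^{⊗k} (reduced Δ_β)^{(k-1)}`.
The component of `M^{⊗k} (reduced Δ_β)^{(k-1)}` belonging to `(i₁, j₁, …, i_k, j_k)` is
`M_{(i₁,j₁,…,i_k,j_k)} (reduced Δ_β)^{(k-1)}_{(i₁,j₁,…,i_k,j_k)}`; it vanishes if some
`(i_s, j_s) = (0, 0)`, so that only the `M_{ij}` with `i + j < p + q` contribute to the sum.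
In the code the summation index is `k - 1`. -/
def twoYBOps (σ : V ⊗[K] V →ₗ[K] V ⊗[K] V) (star dot : V ⊗[K] V →ₗ[K] V) : Ops K V
  | 0, 0 => 0
  | 1, 0 => (TensorProduct.rid K V).toLinearMap ∘ₗ
      TensorProduct.map (oneEquiv K V).toLinearMap
        (TensorPower.algebraMap₀ (R := K) (M := V)).symm.toLinearMap
  | 0, 1 => (TensorProduct.lid K V).toLinearMap ∘ₗ
      TensorProduct.map (TensorPower.algebraMap₀ (R := K) (M := V)).symm.toLinearMap
        (oneEquiv K V).toLinearMap
  | _ + 2, 0 => 0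
  | 0, _ + 2 => 0
  | p + 1, q + 1 =>
      star ∘ₗ TensorProduct.map (iterMul dot p) (iterMul dot q) -
        ∑ s ∈ Finset.Ico 1 ((p + 1) + (q + 1)),
          iterMul dot s ∘ₗ
            opsPow σ (fun i j => if _h : i + j < (p + 1) + (q + 1) then
              twoYBOps σ star dot i j else 0) s ∘ₗ
            incl K V (p + 1) (q + 1)
  termination_by p q => p + q

end TensorPowers

section Categories

variable (K : Type u) [Field K]

/-- Unital 2-YB algebras over `K`. -/
structure TwoYBAlg where
  carrier : Type v
  [addCommGroup : AddCommGroup carrier]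
  [module : Module K carrier]
  σ : carrier ⊗[K] carrier →ₗ[K] carrier ⊗[K] carrier
  star : carrier ⊗[K] carrier →ₗ[K] carrier
  dot : carrier ⊗[K] carrier →ₗ[K] carrier
  one : carrier
  isTwoYBAlgebra : IsTwoYBAlgebra σ star dot one

attribute [instance] TwoYBAlg.addCommGroup TwoYBAlg.module

/-- Quantum `B_∞`-algebras over `K`. -/
structure QBInftyAlg where
  carrier : Type v
  [addCommGroup : AddCommGroup carrier]
  [module : Module K carrier]
  σ : carrier ⊗[K] carrier →ₗ[K] carrier ⊗[K] carrier
  M : Ops K carrier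
  isQuantumBInfty : IsQuantumBInfty σ M

attribute [instance] QBInftyAlg.addCommGroup QBInftyAlg.module

variable {K}

/-- Morphisms of 2-YB algebras: linear maps that are multiplicative for both products and
commute with the braidings. -/
@[ext]
structure TwoYBAlg.Hom (A B : TwoYBAlg.{u, v} K) where
  lin : A.carrier →ₗ[K] B.carrier
  map_star : ∀ a b : A.carrier, lin (A.star (a ⊗ₜ b)) = B.star (lin a ⊗ₜ lin b)
  map_dot : ∀ a b : A.carrier, lin (A.dot (a ⊗ₜ b)) = B.dot (lin a ⊗ₜ lin b)
  map_braiding : TensorProduct.map lin lin ∘ₗ A.σ = B.σ ∘ₗ TensorProduct.map lin lin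

/-- `f` commutes with the braidings and `f ∘ M_{pq} = M'_{pq} ∘ (f^{⊗p} ⊗ f^{⊗q})` for all
`p, q ≥ 0`. -/
structure IsQBInftyHom {V W : Type v} [AddCommGroup V] [Module K V] [AddCommGroup W]
    [Module K W] (σ : V ⊗[K] V →ₗ[K] V ⊗[K] V) (M : Ops K V)
    (σ' : W ⊗[K] W →ₗ[K] W ⊗[K] W) (M' : Ops K W) (f : V →ₗ[K] W) : Prop where
  map_braiding : TensorProduct.map f f ∘ₗ σ = σ' ∘ₗ TensorProduct.map f f
  map_ops : ∀ p q : ℕ, f ∘ₗ M p q =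
    M' p q ∘ₗ TensorProduct.map (PiTensorProduct.map fun _ => f) (PiTensorProduct.map fun _ => f)

/-- Morphisms of quantum `B_∞`-algebras. -/
@[ext]
structure QBInftyAlg.Hom (A B : QBInftyAlg.{u, v} K) where
  lin : A.carrier →ₗ[K] B.carrier
  isHom : IsQBInftyHom A.σ A.M B.σ B.M lin

instance : Category (TwoYBAlg.{u, v} K) where
  Hom A B := TwoYBAlg.Hom A B
  id A :=
    { lin := LinearMap.id
      map_star := fun _ _ => rfl
      map_dot := fun _ _ => rfl
      map_braiding := by simp }
  comp f g :=
    { lin := g.lin ∘ₗ f.lin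
      map_star := fun a b => by simp [f.map_star, g.map_star]
      map_dot := fun a b => by simp [f.map_dot, g.map_dot]
      map_braiding := by
        rw [TensorProduct.map_comp, LinearMap.comp_assoc, f.map_braiding,
          ← LinearMap.comp_assoc, g.map_braiding, LinearMap.comp_assoc] }

instance : Category (QBInftyAlg.{u, v} K) where
  Hom A B := QBInftyAlg.Hom A B
  id A :=
    { lin := LinearMap.id
      isHom := ⟨by simp, fun p q => by simp [PiTensorProduct.map_id]⟩ }
  comp f g :=
    { lin := g.lin ∘ₗ f.lin
      isHom := ⟨by
          rw [TensorProduct.map_comp, LinearMap.comp_assoc, f.isHom.map_braiding,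
            ← LinearMap.comp_assoc, g.isHom.map_braiding, LinearMap.comp_assoc],
        fun p q => by
          rw [PiTensorProduct.map_comp, PiTensorProduct.map_comp, TensorProduct.map_comp,
            LinearMap.comp_assoc, f.isHom.map_ops, ← LinearMap.comp_assoc, g.isHom.map_ops,
            LinearMap.comp_assoc]⟩ }

end Categories

end QuantumBInfty

end

/-!
Let `T = T(V)`, let `⋆ : T ⊗ T → T` be the map with components `M^{⊗n} ∘ (reduced Δ_β)^{(n-1)}`
(together with the counit for `n = 0`), and let `φ : T → V` be the map given by the iterated products
of `·` on the summands `V^{⊗n}`, with the unit of `V` for `n = 0`. The recursion defining `M` says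
precisely that `φ (x ⋆ y) = φ x ∗ φ y`. As `∗` is associative, `φ ∘ ⋆ ∘ (⋆ ⊗ id)` and
`φ ∘ ⋆ ∘ (id ⊗ ⋆)` are the same map `Ψ`. On the other hand, `⋆` is the coalgebra map cogenerated by
`M`. Hence `φ ∘ ⋆` is the geometric series of `M` in the convolution algebra of maps from `T ⊗ T` to
`(V, ·)`, and `Ψ` is in the same way the geometric series of `M ∘ (⋆ ⊗ id)` as well as of
`M ∘ (id ⊗ ⋆)` in the convolution algebra of maps from `T ⊗ T ⊗ T` to `(V, ·)`. A geometric series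
`1 + N + N² + ⋯` determines `N` (solve `Ψ = 1 + Ψ N` by induction on the degree), so that
`M ∘ (⋆ ⊗ id) = M ∘ (id ⊗ ⋆)`. This is the associativity condition of a quantum `B_∞`-algebra; see
`IsOperationsOf.liftLeft_eq_liftRight`.

That `⋆ ⊗ id` and `id ⊗ ⋆` are compatible with the braided coproducts rests on three facts: the
hexagon identities `braid_add_left` and `braid_add_right` of the block braidings, the coassociativity
of the braided coproducts (`shuffle_cocycle`, `shuffle₃_eq`), and the naturality of the block braidings
with respect to the `M_{pq}`. The last one is also the content of the braid conditions of a quantum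
`B_∞`-algebra. It follows from the recursion for `M`, since the natural operators contain the braiding
and both products, and are closed under composition and tensor products (`IsNatural`).

To avoid transporting everything along the isomorphisms `V^{⊗p} ⊗ V^{⊗q} ≅ V^{⊗(p+q)}`, an operator
`V^{⊗n} → V^{⊗m}` is extended by zero to an endomorphism of `T`. Composition and tensor product of
operators become composition and convolution (`conv`, written `⊛`), both strictly associative, and
related by the interchange law. A linear map between iterated tensor products of tensor powers of `V`
is compared with such an operator after concatenation of all factors (`Realizes`); all identifications
of tensor spaces are then realized by the identity. Finally, `T(f)` intertwines all these operators if
`f` is a morphism, which gives functoriality.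
-/

noncomputable section

namespace QuantumBInfty

/-! ### Concatenation and convolution on the tensor space -/

section Concatenation

variable {K : Type u} [Field K] {V : Type v} [AddCommGroup V] [Module K V]

variable (K V) in
/-- The concatenation product of `T(V)`, as a linear map on `T(V) ⊗ T(V)`. -/
def concat : TSpace K V ⊗[K] TSpace K V →ₗ[K] TSpace K V :=
  ofComponents fun p q => tIncl K V (p + q) ∘ₗ TensorPower.mulEquiv.toLinearMap

/-- The concatenation of two tensors. -/
def tMul (x y : TSpace K V) : TSpace K V := concat K V (x ⊗ₜ y)

theorem concat_tmul (x y : TSpace K V) : concat K V (x ⊗ₜ y) = tMul x y := rfl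

theorem tMul_tIncl (p q : ℕ) (x : ⨂[K]^p V) (y : ⨂[K]^q V) :
    tMul (tIncl K V p x) (tIncl K V q y) = tIncl K V (p + q) (TensorPower.mulEquiv (x ⊗ₜ y)) :=
  LinearMap.congr_fun (ofComponents_comp_incl (fun p q => tIncl K V (p + q) ∘ₗ
    TensorPower.mulEquiv.toLinearMap) p q) (x ⊗ₜ y)

theorem tMul_add (x y z : TSpace K V) : tMul x (y + z) = tMul x y + tMul x z := by
  simp [tMul, TensorProduct.tmul_add]

theorem add_tMul (x y z : TSpace K V) : tMul (x + y) z = tMul x z + tMul y z := by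
  simp [tMul, TensorProduct.add_tmul]

theorem tMul_smul (c : K) (x y : TSpace K V) : tMul x (c • y) = c • tMul x y := by
  simp [tMul]

@[simp]
theorem tMul_zero (x : TSpace K V) : tMul x 0 = 0 := by simp [tMul]

@[simp]
theorem zero_tMul (x : TSpace K V) : tMul 0 x = 0 := by simp [tMul]

theorem tIncl_cast {m n : ℕ} (h : m = n) (x : ⨂[K]^m V) :
    tIncl K V n (TensorPower.cast K V h x) = tIncl K V m x := by
  subst h; simp

@[elab_as_elim]
theorem TSpace.induction {P : TSpace K V → Prop} (x : TSpace K V) (hzero : P 0)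
    (hadd : ∀ x y, P x → P y → P (x + y)) (hincl : ∀ n (y : ⨂[K]^n V), P (tIncl K V n y)) : P x :=
  DirectSum.induction_on (β := fun n => ⨂[K]^n V) x hzero hincl hadd

theorem TSpace.hom_ext {W : Type*} [AddCommMonoid W] [Module K W] {f g : TSpace K V →ₗ[K] W}
    (h : ∀ n (y : ⨂[K]^n V), f (tIncl K V n y) = g (tIncl K V n y)) : f = g := by
  ext x
  induction x using TSpace.induction with
  | hzero => simp
  | hadd x y hx hy => simp [hx, hy]
  | hincl n y => exact h n y

theorem tMul_assoc (x y z : TSpace K V) : tMul (tMul x y) z = tMul x (tMul y z) := by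
  induction x using TSpace.induction with
  | hzero => simp
  | hadd x x' hx hy => simp [add_tMul, hx, hy]
  | hincl n x =>
  induction y using TSpace.induction with
  | hzero => simp
  | hadd x x' hx hy => simp [add_tMul, tMul_add, hx, hy]
  | hincl m y =>
  induction z using TSpace.induction with
  | hzero => simp
  | hadd x x' hx hy => simp [tMul_add, hx, hy]
  | hincl k z =>
    simp only [tMul_tIncl]
    rw [← tIncl_cast (add_assoc n m k)]
    exact congrArg _ (TensorPower.mul_assoc x y z)

@[simp]
theorem tOne_tMul (x : TSpace K V) : tMul (tOne K V) x = x := by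
  induction x using TSpace.induction with
  | hzero => simp
  | hadd x x' hx hy => simp [tMul_add, hx, hy]
  | hincl n x =>
    rw [tOne, tMul_tIncl, ← tIncl_cast (zero_add n)]
    exact congrArg _ (TensorPower.one_mul x)

@[simp]
theorem tMul_tOne (x : TSpace K V) : tMul x (tOne K V) = x := by
  induction x using TSpace.induction with
  | hzero => simp
  | hadd x x' hx hy => simp [add_tMul, hx, hy]
  | hincl n x =>
    rw [tOne, tMul_tIncl, ← tIncl_cast (add_zero n)]
    exact congrArg _ (TensorPower.mul_one x)

variable (K V) in
/-- The inclusion `V → T(V)` of the generators. -/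
def gen : V →ₗ[K] TSpace K V := tIncl K V 1 ∘ₗ (oneEquiv K V).symm.toLinearMap

theorem oneEquiv_tprod (v : Fin 1 → V) : oneEquiv K V (PiTensorProduct.tprod K v) = v 0 :=
  PiTensorProduct.subsingletonEquiv_apply_tprod (0 : Fin 1) v

theorem gen_oneEquiv (x : ⨂[K]^1 V) : gen K V (oneEquiv K V x) = tIncl K V 1 x := by
  simp [gen]

theorem oneEquiv_symm_apply (v : V) :
    (oneEquiv K V).symm v = PiTensorProduct.tprod K fun _ : Fin 1 => v := by
  rw [LinearEquiv.symm_apply_eq, oneEquiv_tprod]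

theorem tIncl_tprod_zero (v : Fin 0 → V) :
    tIncl K V 0 (PiTensorProduct.tprod K v) = tOne K V := by
  rw [tOne]; congr 2; exact Subsingleton.elim _ _

theorem tIncl_tprod_succ (n : ℕ) (v : Fin (n + 1) → V) :
    tIncl K V (n + 1) (PiTensorProduct.tprod K v) =
      tMul (gen K V (v 0)) (tIncl K V n (PiTensorProduct.tprod K (Fin.tail v))) := by
  rw [gen, LinearMap.comp_apply, LinearEquiv.coe_coe, oneEquiv_symm_apply, tMul_tIncl,
    ← TensorPower.gMul_def, TensorPower.tprod_mul_tprod, ← tIncl_cast (Nat.add_comm 1 n),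
    TensorPower.cast_tprod]
  congr 2
  ext i
  refine Fin.cases ?_ (fun j => ?_) i
  · simp [Fin.append, Fin.addCases]
  · simp [Fin.append, Fin.addCases, Fin.tail]

/-- Induction along words: `T(V)` is spanned by what `1` generates under left multiplication by
vectors. -/
theorem TSpace.word_induction {n : ℕ} {P : ∀ n, (⨂[K]^n V) → Prop}
    (hadd : ∀ n x y, P n x → P n y → P n (x + y)) (hsmul : ∀ n (c : K) x, P n x → P n (c • x))
    (hone : P 0 (PiTensorProduct.tprod K Fin.elim0))
    (hcons : ∀ n (v : V) x y, tIncl K V (n + 1) y = tMul (gen K V v) (tIncl K V n x) →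
      P n x → P (n + 1) y) (x : ⨂[K]^n V) : P n x := by
  have key : ∀ (n : ℕ) (v : Fin n → V), P n (PiTensorProduct.tprod K v) := by
    intro n
    induction n with
    | zero => intro v; rwa [Subsingleton.elim v Fin.elim0]
    | succ n ih =>
      intro v
      exact hcons n (v 0) _ _ (tIncl_tprod_succ n v) (ih (Fin.tail v))
  induction x using PiTensorProduct.induction_on with
  | smul_tprod r v => exact hsmul _ _ _ (key n v)
  | add x y hx hy => exact hadd _ _ _ hx hy

theorem tIncl_injective (n : ℕ) : Function.Injective (tIncl K V n) :=
  DirectSum.of_injective (β := fun n => ⨂[K]^n V) n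

end Concatenation

section Deconcatenation

variable {K : Type u} [Field K] {V : Type v} [AddCommGroup V] [Module K V]

variable (K V) in
/-- The component of the deconcatenation coproduct with values in `V^{⊗a} ⊗ V^{⊗b}`. -/
def split {n : ℕ} (a b : ℕ) (h : a + b = n) : (⨂[K]^n V) →ₗ[K] (⨂[K]^a V) ⊗[K] (⨂[K]^b V) :=
  TensorPower.mulEquiv.symm.toLinearMap ∘ₗ (TensorPower.cast K V h.symm).toLinearMap

theorem deconc_tIncl (n : ℕ) (x : ⨂[K]^n V) :
    deconc K V (tIncl K V n x) = ∑ p ∈ (Finset.HasAntidiagonal.antidiagonal n).attach,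
      incl K V p.1.1 p.1.2 (split K V p.1.1 p.1.2 (Finset.HasAntidiagonal.mem_antidiagonal.mp p.2) x) := by
  rw [deconc, tLift_tIncl, LinearMap.sum_apply]
  rfl

theorem concat_incl {a b n : ℕ} (h : a + b = n) (z : (⨂[K]^a V) ⊗[K] (⨂[K]^b V)) :
    concat K V (incl K V a b z) =
      tIncl K V n (TensorPower.cast K V h (TensorPower.mulEquiv z)) := by
  rw [tIncl_cast]
  exact LinearMap.congr_fun (ofComponents_comp_incl (fun p q => tIncl K V (p + q) ∘ₗ
    TensorPower.mulEquiv.toLinearMap) a b) z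

theorem concat_incl_split {a b n : ℕ} (h : a + b = n) (x : ⨂[K]^n V) :
    concat K V (incl K V a b (split K V a b h x)) = tIncl K V n x := by
  rw [concat_incl h]; simp [split]

theorem split_eq_iff {a b n : ℕ} (h : a + b = n) (x : ⨂[K]^n V)
    (z : (⨂[K]^a V) ⊗[K] (⨂[K]^b V)) :
    split K V a b h x = z ↔ tIncl K V n x = concat K V (incl K V a b z) := by
  rw [concat_incl h, (tIncl_injective n).eq_iff]
  constructor
  · rintro rfl; simp [split]
  · rintro rfl; simp [split]

theorem incl_tmul (a b : ℕ) (x : ⨂[K]^a V) (y : ⨂[K]^b V) :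
    incl K V a b (x ⊗ₜ y) = tIncl K V a x ⊗ₜ tIncl K V b y := rfl

variable (K) in
/-- Left multiplication by a vector on `T(V)`. -/
def consMap (v : V) : Module.End K (TSpace K V) where
  toFun x := tMul (gen K V v) x
  map_add' := tMul_add _
  map_smul' c x := tMul_smul c _ x

@[simp]
theorem consMap_apply (v : V) (x : TSpace K V) : consMap K v x = tMul (gen K V v) x := rfl

variable (K) in
/-- Left multiplication by a vector, from `V^{⊗n}` to `V^{⊗(n+1)}`. -/
def consPow (v : V) (n : ℕ) : (⨂[K]^n V) →ₗ[K] (⨂[K]^(n + 1) V) :=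
  (TensorPower.cast K V (Nat.add_comm 1 n)).toLinearMap ∘ₗ
    TensorPower.mulEquiv.toLinearMap ∘ₗ TensorProduct.mk K _ _ ((oneEquiv K V).symm v)

theorem tIncl_consPow (v : V) (n : ℕ) (x : ⨂[K]^n V) :
    tIncl K V (n + 1) (consPow K v n x) = tMul (gen K V v) (tIncl K V n x) := by
  simp [consPow, tIncl_cast, gen, tMul_tIncl]

theorem tMul_concat (v : V) (z : TSpace K V ⊗[K] TSpace K V) :
    tMul (gen K V v) (concat K V z) = concat K V (LinearMap.rTensor _ (consMap K v) z) := by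
  induction z with
  | zero => simp
  | add x y hx hy => simp [tMul_add, hx, hy]
  | tmul x y => simp [concat_tmul, tMul_assoc]

theorem split_consPow {a b n : ℕ} (h : a + b = n) (h' : (a + 1) + b = n + 1) (v : V)
    (x : ⨂[K]^n V) : split K V (a + 1) b h' (consPow K v n x) =
      LinearMap.rTensor _ (consPow K v a) (split K V a b h x) := by
  rw [split_eq_iff, tIncl_consPow, ← concat_incl_split h x, tMul_concat]
  congr 1
  generalize split K V a b h x = z
  induction z with
  | zero => simp
  | add x y hx hy => simp only [map_add, hx, hy]
  | tmul x y => simp [incl_tmul, tIncl_consPow]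

theorem incl_rTensor_consPow {a b : ℕ} (v : V) (z : (⨂[K]^a V) ⊗[K] (⨂[K]^b V)) :
    incl K V (a + 1) b (LinearMap.rTensor _ (consPow K v a) z) =
      LinearMap.rTensor _ (consMap K v) (incl K V a b z) := by
  induction z with
  | zero => simp
  | add x y hx hy => simp only [map_add, hx, hy]
  | tmul x y => simp [incl_tmul, tIncl_consPow]

theorem split_zero_left {n : ℕ} (h : 0 + n = n) (x : ⨂[K]^n V) :
    incl K V 0 n (split K V 0 n h x) = tOne K V ⊗ₜ tIncl K V n x := by
  have : split K V 0 n h x = (PiTensorProduct.tprod K Fin.elim0) ⊗ₜ x := by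
    rw [split_eq_iff, incl_tmul, concat_tmul]
    exact (tOne_tMul _).symm
  rw [this]; rfl

theorem sum_antidiagonal_attach {N : Type*} [AddCommMonoid N] (n : ℕ)
    (F : ∀ a b : ℕ, a + b = n → N) :
    ∑ p ∈ (Finset.HasAntidiagonal.antidiagonal n).attach,
      F p.1.1 p.1.2 (Finset.HasAntidiagonal.mem_antidiagonal.mp p.2) =
    ∑ p ∈ Finset.HasAntidiagonal.antidiagonal n, if h : p.1 + p.2 = n then F p.1 p.2 h else 0 := by
  rw [← Finset.sum_attach (Finset.HasAntidiagonal.antidiagonal n)]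
  refine Finset.sum_congr rfl fun p _ => ?_
  rw [dif_pos (Finset.HasAntidiagonal.mem_antidiagonal.mp p.2)]

theorem deconc_tOne : deconc K V (tOne K V) = tOne K V ⊗ₜ tOne K V := by
  rw [tOne, deconc_tIncl, sum_antidiagonal_attach 0
    (fun a b h => incl K V a b (split K V a b h (PiTensorProduct.tprod K Fin.elim0)))]
  simp [split_zero_left]
  rfl

theorem deconc_gen_tMul (v : V) (x : TSpace K V) :
    deconc K V (tMul (gen K V v) x) = tOne K V ⊗ₜ tMul (gen K V v) x +
      LinearMap.rTensor _ (consMap K v) (deconc K V x) := by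
  induction x using TSpace.induction with
  | hzero => simp
  | hadd x y hx hy => simp only [tMul_add, map_add, hx, hy, TensorProduct.tmul_add]; abel
  | hincl n x =>
    rw [← tIncl_consPow, deconc_tIncl, deconc_tIncl, sum_antidiagonal_attach (n + 1)
      (fun a b h => incl K V a b (split K V a b h (consPow K v n x))), sum_antidiagonal_attach n
      (fun a b h => incl K V a b (split K V a b h x)),
      Finset.Nat.sum_antidiagonal_succ, map_sum]
    congr 1
    · rw [dif_pos (by simp), split_zero_left]
    · refine Finset.sum_congr rfl fun p hp => ?_
      have h := Finset.HasAntidiagonal.mem_antidiagonal.mp hp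
      rw [dif_pos h, dif_pos (by simp; omega), split_consPow h, incl_rTensor_consPow]

/-- Linear maps on `T(V)` are determined by their behaviour along words. -/
theorem TSpace.cons_induction {P : TSpace K V → Prop}
    (hadd : ∀ x y, P x → P y → P (x + y)) (hsmul : ∀ (c : K) x, P x → P (c • x))
    (hone : P (tOne K V)) (hcons : ∀ v x, P x → P (tMul (gen K V v) x)) (x : TSpace K V) : P x := by
  induction x using TSpace.induction with
  | hzero => simpa using hsmul 0 _ hone
  | hadd x y hx hy => exact hadd _ _ hx hy
  | hincl n x =>
    refine TSpace.word_induction (P := fun n x => P (tIncl K V n x)) ?_ ?_ hone ?_ x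
    · intro n x y hx hy; simpa using hadd _ _ hx hy
    · intro n c x hx; simpa using hsmul c _ hx
    · intro n v x y h hx; rw [h]; exact hcons _ _ hx

end Deconcatenation

section Convolution

variable {K : Type u} [Field K] {V : Type v} [AddCommGroup V] [Module K V]

/-- The convolution `f ⊛ g` of endomorphisms of `T(V)`, with respect to deconcatenation and
concatenation. On operators `f : V^{⊗n} → V^{⊗m}` and `g : V^{⊗n'} → V^{⊗m'}`, extended by zero to
`T(V)`, it is the tensor product `f ⊗ g : V^{⊗(n+n')} → V^{⊗(m+m')}`; unlike the latter, it is
strictly associative. -/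
def conv (f g : Module.End K (TSpace K V)) : Module.End K (TSpace K V) :=
  concat K V ∘ₗ TensorProduct.map f g ∘ₗ deconc K V

infixr:75 " ⊛ " => conv

theorem conv_add (f g g' : Module.End K (TSpace K V)) : f ⊛ (g + g') = f ⊛ g + f ⊛ g' := by
  simp [conv, TensorProduct.map_add_right, LinearMap.comp_add, LinearMap.add_comp]

theorem add_conv (f f' g : Module.End K (TSpace K V)) : (f + f') ⊛ g = f ⊛ g + f' ⊛ g := by
  simp [conv, TensorProduct.map_add_left, LinearMap.comp_add, LinearMap.add_comp]

theorem conv_smul (c : K) (f g : Module.End K (TSpace K V)) : f ⊛ (c • g) = c • (f ⊛ g) := by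
  simp [conv, TensorProduct.map_smul_right, LinearMap.comp_smul, LinearMap.smul_comp]

theorem smul_conv (c : K) (f g : Module.End K (TSpace K V)) : (c • f) ⊛ g = c • (f ⊛ g) := by
  simp [conv, TensorProduct.map_smul_left, LinearMap.comp_smul, LinearMap.smul_comp]

/-- Convolution as a bilinear map. -/
def convBilin : Module.End K (TSpace K V) →ₗ[K] Module.End K (TSpace K V) →ₗ[K]
    Module.End K (TSpace K V) :=
  LinearMap.mk₂ K conv add_conv smul_conv conv_add conv_smul

theorem convBilin_apply (f g : Module.End K (TSpace K V)) : convBilin f g = f ⊛ g := rfl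

@[simp]
theorem conv_zero (f : Module.End K (TSpace K V)) : f ⊛ 0 = 0 := by simp [← convBilin_apply]

@[simp]
theorem zero_conv (f : Module.End K (TSpace K V)) : 0 ⊛ f = 0 := by simp [← convBilin_apply]

theorem conv_sum {ι : Type*} (s : Finset ι) (f : Module.End K (TSpace K V))
    (g : ι → Module.End K (TSpace K V)) : f ⊛ (∑ i ∈ s, g i) = ∑ i ∈ s, f ⊛ g i := by
  simp [← convBilin_apply]

theorem sum_conv {ι : Type*} (s : Finset ι) (f : Module.End K (TSpace K V))
    (g : ι → Module.End K (TSpace K V)) : (∑ i ∈ s, g i) ⊛ f = ∑ i ∈ s, g i ⊛ f := by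
  simp [← convBilin_apply]

theorem conv_tOne (f g : Module.End K (TSpace K V)) :
    (f ⊛ g) (tOne K V) = tMul (f (tOne K V)) (g (tOne K V)) := by
  simp [conv, deconc_tOne, concat_tmul]

theorem conv_gen_tMul (f g : Module.End K (TSpace K V)) (v : V) (x : TSpace K V) :
    (f ⊛ g) (tMul (gen K V v) x) =
      tMul (f (tOne K V)) (g (tMul (gen K V v) x)) + ((f * consMap K v) ⊛ g) x := by
  simp only [conv, LinearMap.comp_apply, deconc_gen_tMul, map_add, TensorProduct.map_tmul,
    concat_tmul]
  congr 2
  rw [← LinearMap.comp_apply, LinearMap.rTensor_def, ← TensorProduct.map_comp]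
  rfl

theorem tMul_left_conv (z : TSpace K V) (g h : Module.End K (TSpace K V))
    (g' : Module.End K (TSpace K V)) (hg : ∀ x, g' x = tMul z (g x)) (x : TSpace K V) :
    (g' ⊛ h) x = tMul z ((g ⊛ h) x) := by
  simp only [conv, LinearMap.comp_apply]
  generalize deconc K V x = w
  induction w with
  | zero => simp
  | add x y hx hy => simp only [map_add, hx, hy, tMul_add]
  | tmul x y => simp [concat_tmul, hg, tMul_assoc]

/-- Left multiplication on `T(V)`. -/
def leftMul (z : TSpace K V) : Module.End K (TSpace K V) where
  toFun x := tMul z x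
  map_add' := tMul_add _
  map_smul' c x := tMul_smul c _ x

theorem conv_assoc (f g h : Module.End K (TSpace K V)) : (f ⊛ g) ⊛ h = f ⊛ g ⊛ h := by
  ext x
  induction x using TSpace.cons_induction generalizing f g h with
  | hadd x y hx hy => simp [hx, hy]
  | hsmul c x hx => simp [hx]
  | hone => simp [conv_tOne, tMul_assoc]
  | hcons v x hx =>
    have key : (f ⊛ g) * consMap K v =
        leftMul (f (tOne K V)) * (g * consMap K v) + (f * consMap K v) ⊛ g := by
      ext y
      exact conv_gen_tMul f g v y
    rw [conv_gen_tMul, key, add_conv, LinearMap.add_apply, hx, conv_gen_tMul f, conv_gen_tMul g,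
      tMul_left_conv (f (tOne K V)) (g * consMap K v) h _ (fun _ => rfl), conv_tOne, tMul_add,
      tMul_assoc, add_assoc]

/-! ### Homogeneous operators -/

variable (K V) in
/-- The projection of `T(V)` onto `V^{⊗n}`: the identity operator of `V^{⊗n}`. -/
def proj (n : ℕ) : Module.End K (TSpace K V) :=
  tLift fun k => if k = n then tIncl K V k else 0

local notation "e" => proj K V

@[simp]
theorem proj_tIncl_self (n : ℕ) (x : ⨂[K]^n V) : e n (tIncl K V n x) = tIncl K V n x := by
  simp [proj, tLift_tIncl]

theorem proj_tIncl_ne {n k : ℕ} (h : k ≠ n) (x : ⨂[K]^k V) : e n (tIncl K V k x) = 0 := by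
  simp [proj, tLift_tIncl, h]

theorem exists_proj_eq (n : ℕ) (x : TSpace K V) : ∃ y, e n x = tIncl K V n y := by
  induction x using TSpace.induction with
  | hzero => exact ⟨0, by simp⟩
  | hadd x y hx hy =>
    obtain ⟨a, ha⟩ := hx
    obtain ⟨b, hb⟩ := hy
    exact ⟨a + b, by simp [ha, hb]⟩
  | hincl k y =>
    by_cases h : k = n
    · subst h; exact ⟨y, by simp⟩
    · exact ⟨0, by simp [proj_tIncl_ne h]⟩

/-- `f` is an operator `V^{⊗n} → V^{⊗m}`, extended by zero to `T(V)`. -/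
structure IsHom (n m : ℕ) (f : Module.End K (TSpace K V)) : Prop where
  dom : f * e n = f
  cod : e m * f = f

theorem apply_tIncl_ne {f : Module.End K (TSpace K V)} {n k : ℕ} (hf : f * e n = f) (h : k ≠ n)
    (x : ⨂[K]^k V) : f (tIncl K V k x) = 0 := by
  rw [← hf, Module.End.mul_apply, proj_tIncl_ne h, map_zero]

theorem conv_tIncl (f g : Module.End K (TSpace K V)) (n : ℕ) (x : ⨂[K]^n V) :
    (f ⊛ g) (tIncl K V n x) = ∑ p ∈ Finset.HasAntidiagonal.antidiagonal n,
      if h : p.1 + p.2 = n then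
        concat K V (TensorProduct.map f g (incl K V p.1 p.2 (split K V p.1 p.2 h x))) else 0 := by
  simp only [conv, LinearMap.comp_apply, deconc_tIncl, map_sum]
  rw [sum_antidiagonal_attach n (fun a b h =>
    concat K V (TensorProduct.map f g (incl K V a b (split K V a b h x))))]

theorem map_incl_eq_zero_left {f g : Module.End K (TSpace K V)} {a b : ℕ}
    (hf : ∀ x, f (tIncl K V a x) = 0) (z : (⨂[K]^a V) ⊗[K] (⨂[K]^b V)) :
    TensorProduct.map f g (incl K V a b z) = 0 := by
  induction z with
  | zero => simp
  | add x y hx hy => simp [hx, hy]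
  | tmul x y => simp [incl_tmul, hf]

theorem map_incl_eq_zero_right {f g : Module.End K (TSpace K V)} {a b : ℕ}
    (hg : ∀ x, g (tIncl K V b x) = 0) (z : (⨂[K]^a V) ⊗[K] (⨂[K]^b V)) :
    TensorProduct.map f g (incl K V a b z) = 0 := by
  induction z with
  | zero => simp
  | add x y hx hy => simp [hx, hy]
  | tmul x y => simp [incl_tmul, hg]

/-- If all other terms of the deconcatenation are killed, then the convolution is computed on a
product of homogeneous tensors factor by factor. -/
theorem conv_tIncl_tMul_of_unique {f g : Module.End K (TSpace K V)} {n m : ℕ}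
    (h : ∀ a b, a + b = n + m → (a, b) ≠ (n, m) →
      (∀ x, f (tIncl K V a x) = 0) ∨ (∀ x, g (tIncl K V b x) = 0))
    (x : ⨂[K]^n V) (y : ⨂[K]^m V) :
    (f ⊛ g) (tMul (tIncl K V n x) (tIncl K V m y)) =
      tMul (f (tIncl K V n x)) (g (tIncl K V m y)) := by
  rw [tMul_tIncl, conv_tIncl, Finset.sum_eq_single (n, m)]
  · have : split K V n m rfl (TensorPower.mulEquiv (x ⊗ₜ[K] y)) = x ⊗ₜ y := by simp [split]
    rw [dif_pos rfl, this]
    rfl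
  · rintro ⟨a, b⟩ hab hne
    split_ifs with h'
    · rcases h a b h' hne with h0 | h0
      · rw [map_incl_eq_zero_left h0, map_zero]
      · rw [map_incl_eq_zero_right h0, map_zero]
    · rfl
  · intro h'
    exact (h' (Finset.HasAntidiagonal.mem_antidiagonal.mpr (show n + m = n + m from rfl))).elim

theorem conv_tMul_left {f : Module.End K (TSpace K V)} {n : ℕ} (hf : f * e n = f)
    (g : Module.End K (TSpace K V)) (x : ⨂[K]^n V) (y : TSpace K V) :
    (f ⊛ g) (tMul (tIncl K V n x) y) = tMul (f (tIncl K V n x)) (g y) := by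
  induction y using TSpace.induction with
  | hzero => simp
  | hadd y z hy hz => simp [tMul_add, hy, hz]
  | hincl m y =>
    refine conv_tIncl_tMul_of_unique (fun a b hab hne => Or.inl (apply_tIncl_ne hf ?_)) x y
    rintro rfl
    exact hne (by simp at hab; simp [hab])

theorem conv_tMul_right {g : Module.End K (TSpace K V)} {m : ℕ} (hg : g * e m = g)
    (f : Module.End K (TSpace K V)) (x : TSpace K V) (y : ⨂[K]^m V) :
    (f ⊛ g) (tMul x (tIncl K V m y)) = tMul (f x) (g (tIncl K V m y)) := by
  induction x using TSpace.induction with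
  | hzero => simp
  | hadd y z hy hz => simp [add_tMul, hy, hz]
  | hincl n x =>
    refine conv_tIncl_tMul_of_unique (fun a b hab hne => Or.inr (apply_tIncl_ne hg ?_)) x y
    rintro rfl
    exact hne (by simp at hab; simp [hab])

/-- The interchange law; the middle space of the first factor has to be homogeneous, so that the two
convolutions cut a word at the same place. -/
theorem conv_mul_conv_left {f g : Module.End K (TSpace K V)} (n : ℕ) (hf : f * e n = f)
    (hg : e n * g = g) (f' g' : Module.End K (TSpace K V)) :
    (f ⊛ f') * (g ⊛ g') = (f * g) ⊛ (f' * g') := by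
  ext x
  rw [Module.End.mul_apply]
  simp only [conv, LinearMap.comp_apply (x := x)]
  generalize deconc K V x = w
  induction w with
  | zero => simp
  | add x y hx hy => simp only [map_add, hx, hy]
  | tmul x y =>
    obtain ⟨z, hz⟩ := exists_proj_eq n (g x)
    have hz' : g x = tIncl K V n z := by rw [← hz, ← Module.End.mul_apply, hg]
    simp only [TensorProduct.map_tmul, LinearMap.comp_apply, concat_tmul]
    have := conv_tMul_left hf f' z (g' y)
    rw [conv] at this
    simpa [hz'] using this

theorem conv_mul_conv_right {f' g' : Module.End K (TSpace K V)} (n : ℕ) (hf : f' * e n = f')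
    (hg : e n * g' = g') (f g : Module.End K (TSpace K V)) :
    (f ⊛ f') * (g ⊛ g') = (f * g) ⊛ (f' * g') := by
  ext x
  rw [Module.End.mul_apply]
  simp only [conv, LinearMap.comp_apply (x := x)]
  generalize deconc K V x = w
  induction w with
  | zero => simp
  | add x y hx hy => simp only [map_add, hx, hy]
  | tmul x y =>
    obtain ⟨z, hz⟩ := exists_proj_eq n (g' y)
    have hz' : g' y = tIncl K V n z := by rw [← hz, ← Module.End.mul_apply, hg]
    simp only [TensorProduct.map_tmul, LinearMap.comp_apply, concat_tmul]
    have := conv_tMul_right hf f (g x) z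
    rw [conv] at this
    simpa [hz'] using this

@[simp]
theorem proj_mul_self (n : ℕ) : e n * e n = e n := by
  refine TSpace.hom_ext fun k x => ?_
  by_cases h : k = n
  · subst h; simp
  · simp [proj_tIncl_ne h]

@[simp]
theorem conv_proj_proj (n m : ℕ) : e n ⊛ e m = e (n + m) := by
  refine TSpace.hom_ext fun k x => ?_
  rcases lt_or_ge k n with hk | hk
  · rw [proj_tIncl_ne (by omega), conv_tIncl, Finset.sum_eq_zero]
    intro p hp
    split_ifs with h
    · rw [map_incl_eq_zero_left (fun x => proj_tIncl_ne (by omega) x), map_zero]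
    · rfl
  · obtain ⟨l, rfl⟩ := Nat.exists_eq_add_of_le hk
    obtain ⟨z, rfl⟩ := (TensorPower.mulEquiv (R := K) (M := V) (n := n) (m := l)).surjective x
    induction z with
    | zero => simp
    | add x y hx hy => simp only [map_add, hx, hy]
    | tmul x y =>
      rw [← tMul_tIncl, conv_tMul_left (proj_mul_self n), proj_tIncl_self]
      by_cases h : l = m
      · subst h; rw [proj_tIncl_self, tMul_tIncl, proj_tIncl_self]
      · rw [proj_tIncl_ne h, tMul_tIncl, proj_tIncl_ne (by omega), tMul_zero]

theorem proj_zero_conv (f : Module.End K (TSpace K V)) : e 0 ⊛ f = f := by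
  ext x
  have := conv_tMul_left (proj_mul_self 0) f (PiTensorProduct.tprod K Fin.elim0) x
  rwa [proj_tIncl_self, ← tOne, tOne_tMul, tOne_tMul] at this

theorem conv_proj_zero (f : Module.End K (TSpace K V)) : f ⊛ e 0 = f := by
  ext x
  have := conv_tMul_right (proj_mul_self 0) f x (PiTensorProduct.tprod K Fin.elim0)
  rwa [proj_tIncl_self, ← tOne, tMul_tOne, tMul_tOne] at this

namespace IsHom

variable {f g : Module.End K (TSpace K V)} {n m k l : ℕ}

theorem proj (n : ℕ) : IsHom n n (e n) := ⟨proj_mul_self n, proj_mul_self n⟩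

theorem zero (n m : ℕ) : IsHom n m (0 : Module.End K (TSpace K V)) := ⟨by simp, by simp⟩

theorem mul (hf : IsHom m k f) (hg : IsHom n m g) : IsHom n k (f * g) :=
  ⟨by rw [mul_assoc, hg.dom], by rw [← mul_assoc, hf.cod]⟩

theorem sum {ι : Type*} {s : Finset ι} {f : ι → Module.End K (TSpace K V)}
    (h : ∀ i ∈ s, IsHom n m (f i)) : IsHom n m (∑ i ∈ s, f i) :=
  ⟨by rw [Finset.sum_mul]; exact Finset.sum_congr rfl fun i hi => (h i hi).dom,
    by rw [Finset.mul_sum]; exact Finset.sum_congr rfl fun i hi => (h i hi).cod⟩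

theorem sub (hf : IsHom n m f) (hg : IsHom n m g) : IsHom n m (f - g) :=
  ⟨by rw [sub_mul, hf.dom, hg.dom], by rw [mul_sub, hf.cod, hg.cod]⟩

theorem conv (hf : IsHom n m f) (hg : IsHom k l g) : IsHom (n + k) (m + l) (f ⊛ g) := by
  constructor
  · rw [← conv_proj_proj, conv_mul_conv_left n hf.dom (proj_mul_self n), hf.dom, hg.dom]
  · rw [← conv_proj_proj, conv_mul_conv_left m (proj_mul_self m) hf.cod, hf.cod, hg.cod]

theorem of_eq (hf : IsHom n m f) (h : n = k) (h' : m = l) : IsHom k l f := by subst h h'; exact hf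

/-- The interchange law for homogeneous first factors. -/
theorem interchange {f' g' : Module.End K (TSpace K V)} (hf : IsHom m k f) (hg : IsHom n m g) :
    (f ⊛ f') * (g ⊛ g') = (f * g) ⊛ (f' * g') :=
  conv_mul_conv_left m hf.dom hg.cod f' g'

theorem interchange' {f' g' : Module.End K (TSpace K V)} (hf : IsHom m k f') (hg : IsHom n m g') :
    (f ⊛ f') * (g ⊛ g') = (f * g) ⊛ (f' * g') :=
  conv_mul_conv_right m hf.dom hg.cod f g

end IsHom

end Convolution

/-! ### Block braidings and natural operators -/

section Braids

variable {K : Type u} [Field K] {V : Type v} [AddCommGroup V] [Module K V]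

local notation "e" => proj K V

theorem mul_conv_proj (f g : Module.End K (TSpace K V)) (n : ℕ) :
    (f * g) ⊛ e n = (f ⊛ e n) * (g ⊛ e n) := by
  rw [conv_mul_conv_right n (proj_mul_self n) (proj_mul_self n), proj_mul_self]

theorem proj_conv_mul (f g : Module.End K (TSpace K V)) (n : ℕ) :
    e n ⊛ (f * g) = (e n ⊛ f) * (e n ⊛ g) := by
  rw [conv_mul_conv_left n (proj_mul_self n) (proj_mul_self n), proj_mul_self]

theorem proj_conv_proj_conv (f : Module.End K (TSpace K V)) (n m : ℕ) :
    e n ⊛ e m ⊛ f = e (n + m) ⊛ f := by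
  rw [← conv_assoc, conv_proj_proj]

theorem IsHom.swap {f g : Module.End K (TSpace K V)} {n m k l : ℕ} (hf : IsHom n m f)
    (hg : IsHom k l g) : (f ⊛ e l) * (e n ⊛ g) = (e m ⊛ g) * (f ⊛ e k) := by
  rw [hf.interchange (IsHom.proj n), (IsHom.proj m).interchange hf, hf.dom, hf.cod, hg.dom, hg.cod]

/-- The operator moving one tensor factor to the right past `j` factors. -/
def rowBraid (s : Module.End K (TSpace K V)) : ℕ → Module.End K (TSpace K V)
  | 0 => e 1
  | j + 1 => (e j ⊛ s) * (rowBraid s j ⊛ e 1)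

/-- The block braiding `V^{⊗i} ⊗ V^{⊗j} → V^{⊗j} ⊗ V^{⊗i}`, as an operator on `V^{⊗(i+j)}`. -/
def braid (s : Module.End K (TSpace K V)) : ℕ → ℕ → Module.End K (TSpace K V)
  | 0, j => e j
  | i + 1, j => (braid s i j ⊛ e 1) * (e i ⊛ rowBraid s j)

variable {s : Module.End K (TSpace K V)}

theorem isHom_rowBraid (hs : IsHom 2 2 s) (j : ℕ) : IsHom (j + 1) (j + 1) (rowBraid s j) := by
  induction j with
  | zero => exact IsHom.proj 1
  | succ j ih => exact ((IsHom.proj j).conv hs).mul (ih.conv (IsHom.proj 1))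

theorem isHom_braid (hs : IsHom 2 2 s) (i j : ℕ) : IsHom (i + j) (i + j) (braid s i j) := by
  induction i with
  | zero => exact (IsHom.proj j).of_eq (by omega) (by omega)
  | succ i ih =>
    exact IsHom.mul (m := i + 1 + j) ((ih.conv (IsHom.proj 1)).of_eq (by omega) (by omega))
      (((IsHom.proj i).conv (isHom_rowBraid hs j)).of_eq (by omega) (by omega))

theorem isHom_braid' (hs : IsHom 2 2 s) (i j : ℕ) : IsHom (i + j) (j + i) (braid s i j) :=
  (isHom_braid hs i j).of_eq rfl (Nat.add_comm i j)

@[simp]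
theorem braid_zero_left (j : ℕ) : braid s 0 j = e j := rfl

@[simp]
theorem braid_zero_right (i : ℕ) : braid s i 0 = e i := by
  induction i with
  | zero => rfl
  | succ i ih => rw [braid, ih, rowBraid]; simp

theorem braid_one_left (hs : IsHom 2 2 s) (j : ℕ) : braid s 1 j = rowBraid s j := by
  rw [braid, braid, conv_proj_proj, proj_zero_conv, (isHom_rowBraid hs j).cod]

theorem braid_one_one (hs : IsHom 2 2 s) : braid s 1 1 = s := by
  rw [braid_one_left hs, rowBraid, rowBraid, conv_proj_proj, proj_zero_conv, hs.dom]

theorem braid_add_left (hs : IsHom 2 2 s) (i k j : ℕ) :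
    braid s (i + k) j = (braid s i j ⊛ e k) * (e i ⊛ braid s k j) := by
  induction k with
  | zero => rw [braid_zero_left, conv_proj_zero, conv_proj_proj, add_zero, (isHom_braid hs i j).dom]
  | succ k ih =>
    rw [← add_assoc, braid, ih, braid]
    simp only [mul_conv_proj, proj_conv_mul, conv_assoc, conv_proj_proj, proj_conv_proj_conv,
      mul_assoc]

theorem rowBraid_add (hs : IsHom 2 2 s) (j k : ℕ) :
    rowBraid s (j + k) = (e j ⊛ rowBraid s k) * (rowBraid s j ⊛ e k) := by
  induction k with
  | zero =>
    rw [rowBraid, conv_proj_zero, conv_proj_proj, add_zero, (isHom_rowBraid hs j).cod]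
  | succ k ih =>
    rw [← add_assoc, rowBraid, ih, rowBraid]
    simp only [mul_conv_proj, proj_conv_mul, conv_assoc, conv_proj_proj, proj_conv_proj_conv,
      mul_assoc]

theorem braid_add_right (hs : IsHom 2 2 s) (i j k : ℕ) :
    braid s i (j + k) = (e j ⊛ braid s i k) * (braid s i j ⊛ e k) := by
  induction i with
  | zero => simp
  | succ i ih =>
    rw [braid, ih, rowBraid_add hs, braid, braid]
    simp only [mul_conv_proj, proj_conv_mul, conv_assoc, conv_proj_proj, proj_conv_proj_conv,
      mul_assoc]
    congr 1
    have := (isHom_braid hs i j).swap (isHom_rowBraid hs k)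
    rw [← mul_assoc (braid s i j ⊛ e (k + 1)), this, mul_assoc, Nat.add_comm 1 k, Nat.add_comm j i]

/-- An operator `V^{⊗n} → V^{⊗m}` that can be moved past any other factors along the block
braidings, from either side. -/
structure IsNatural (s : Module.End K (TSpace K V)) (n m : ℕ) (f : Module.End K (TSpace K V)) :
    Prop where
  isHom : IsHom n m f
  left : ∀ k, braid s m k * (f ⊛ e k) = (e k ⊛ f) * braid s n k
  right : ∀ k, braid s k m * (e k ⊛ f) = (f ⊛ e k) * braid s k n

namespace IsNatural

variable {f g : Module.End K (TSpace K V)} {n m k l : ℕ}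

theorem of_eq (hf : IsNatural s n m f) (h : n = k) (h' : m = l) : IsNatural s k l f := by
  subst h h'; exact hf

theorem zero (n m : ℕ) : IsNatural s n m (0 : Module.End K (TSpace K V)) :=
  ⟨IsHom.zero n m, by simp, by simp⟩

theorem proj (hs : IsHom 2 2 s) (n : ℕ) : IsNatural s n n (e n) where
  isHom := IsHom.proj n
  left k := by
    rw [conv_proj_proj, conv_proj_proj, (isHom_braid hs n k).dom, Nat.add_comm,
      (isHom_braid hs n k).cod]
  right k := by
    rw [conv_proj_proj, conv_proj_proj, (isHom_braid hs k n).dom, Nat.add_comm,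
      (isHom_braid hs k n).cod]

theorem mul (hf : IsNatural s m k f) (hg : IsNatural s n m g) : IsNatural s n k (f * g) where
  isHom := hf.isHom.mul hg.isHom
  left j := by rw [mul_conv_proj, ← mul_assoc, hf.left, mul_assoc, hg.left, ← mul_assoc,
    ← proj_conv_mul]
  right j := by rw [proj_conv_mul, ← mul_assoc, hf.right, mul_assoc, hg.right, ← mul_assoc,
    ← mul_conv_proj]

theorem sum {ι : Type*} {t : Finset ι} {f : ι → Module.End K (TSpace K V)}
    (h : ∀ i ∈ t, IsNatural s n m (f i)) : IsNatural s n m (∑ i ∈ t, f i) where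
  isHom := IsHom.sum fun i hi => (h i hi).isHom
  left j := by
    rw [sum_conv, conv_sum, Finset.mul_sum, Finset.sum_mul]
    exact Finset.sum_congr rfl fun i hi => (h i hi).left j
  right j := by
    rw [sum_conv, conv_sum, Finset.mul_sum, Finset.sum_mul]
    exact Finset.sum_congr rfl fun i hi => (h i hi).right j

theorem sub (hf : IsNatural s n m f) (hg : IsNatural s n m g) : IsNatural s n m (f - g) where
  isHom := hf.isHom.sub hg.isHom
  left j := by
    have h₁ := hf.left j
    have h₂ := hg.left j
    simp only [← convBilin_apply, map_sub, LinearMap.sub_apply, mul_sub, sub_mul] at *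
    rw [h₁, h₂]
  right j := by
    have h₁ := hf.right j
    have h₂ := hg.right j
    simp only [← convBilin_apply, map_sub, LinearMap.sub_apply, mul_sub, sub_mul] at *
    rw [h₁, h₂]

theorem conv (hs : IsHom 2 2 s) (hf : IsNatural s n m f) (hg : IsNatural s k l g) :
    IsNatural s (n + k) (m + l) (f ⊛ g) where
  isHom := hf.isHom.conv hg.isHom
  left j := by
    have h₁ : (e m ⊛ braid s l j) * (f ⊛ g ⊛ e j) = (f ⊛ e j ⊛ g) * (e n ⊛ braid s k j) := by
      rw [(IsHom.proj m).interchange hf.isHom, hg.left, hf.isHom.interchange (IsHom.proj n),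
        hf.isHom.cod, hf.isHom.dom]
    have h₂ : (braid s m j ⊛ e l) * ((f ⊛ e j) ⊛ g) = ((e j ⊛ f) ⊛ g) * (braid s n j ⊛ e k) := by
      rw [(IsHom.proj l).interchange' hg.isHom, hf.left, hg.isHom.interchange' (IsHom.proj k),
        hg.isHom.cod, hg.isHom.dom]
    rw [braid_add_left hs, braid_add_left hs, conv_assoc, mul_assoc, h₁, ← mul_assoc,
      ← conv_assoc f, h₂, mul_assoc, conv_assoc]
  right j := by
    have h₁ : (braid s j m ⊛ e l) * ((e j ⊛ f) ⊛ g) = ((f ⊛ e j) ⊛ g) * (braid s j n ⊛ e k) := by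
      rw [(IsHom.proj l).interchange' hg.isHom, hf.right, hg.isHom.interchange' (IsHom.proj k),
        hg.isHom.cod, hg.isHom.dom]
    have h₂ : (e m ⊛ braid s j l) * (f ⊛ e j ⊛ g) = (f ⊛ g ⊛ e j) * (e n ⊛ braid s j k) := by
      rw [(IsHom.proj m).interchange hf.isHom, hg.right, hf.isHom.interchange (IsHom.proj n),
        hf.isHom.cod, hf.isHom.dom]
    rw [braid_add_right hs, braid_add_right hs, ← conv_assoc, mul_assoc, h₁, ← mul_assoc,
      conv_assoc f, h₂, mul_assoc, conv_assoc]

/-- It is enough to move an operator past one factor. -/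
theorem of_one (hs : IsHom 2 2 s) (hf : IsHom n m f)
    (hl : braid s m 1 * (f ⊛ e 1) = (e 1 ⊛ f) * braid s n 1)
    (hr : braid s 1 m * (e 1 ⊛ f) = (f ⊛ e 1) * braid s 1 n) : IsNatural s n m f where
  isHom := hf
  left k := by
    induction k with
    | zero => simp [proj_zero_conv, conv_proj_zero, hf.cod, hf.dom]
    | succ k ih =>
      have h₁ := congrArg (· ⊛ e 1) ih
      have h₂ := congrArg (e k ⊛ ·) hl
      simp only [mul_conv_proj, proj_conv_mul] at h₁ h₂
      rw [braid_add_right hs, braid_add_right hs, ← conv_proj_proj k 1, ← conv_assoc f, mul_assoc,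
        h₁, ← mul_assoc, conv_assoc (e k) f, h₂, mul_assoc, conv_assoc]
  right k := by
    induction k with
    | zero => simp [proj_zero_conv, conv_proj_zero, hf.cod, hf.dom]
    | succ k ih =>
      have h₁ := congrArg (· ⊛ e 1) ih
      have h₂ := congrArg (e k ⊛ ·) hr
      simp only [mul_conv_proj, proj_conv_mul] at h₁ h₂
      rw [braid_add_left hs, braid_add_left hs, ← conv_proj_proj k 1, conv_assoc (e k), mul_assoc,
        h₂, ← mul_assoc, ← conv_assoc (e k) f, h₁, mul_assoc, conv_assoc]

/-- An operator is natural with respect to itself as soon as it satisfies the braid relation. -/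
theorem of_yang_baxter (hs : IsHom 2 2 s)
    (hyb : (s ⊛ e 1) * (e 1 ⊛ s) * (s ⊛ e 1) = (e 1 ⊛ s) * (s ⊛ e 1) * (e 1 ⊛ s)) :
    IsNatural s 2 2 s := by
  refine of_one hs hs ?_ ?_
  · rw [braid_add_left hs 1 1 1, braid_one_one hs, hyb, mul_assoc]
  · rw [braid_add_right hs 1 1 1, braid_one_one hs, ← hyb, mul_assoc]

theorem braid (hs : IsNatural s 2 2 s) (i j : ℕ) : IsNatural s (i + j) (j + i) (braid s i j) := by
  have row : ∀ j, IsNatural s (j + 1) (j + 1) (rowBraid s j) := by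
    intro j
    induction j with
    | zero => exact proj hs.isHom 1
    | succ j ih =>
      have h₁ := (proj hs.isHom j).conv hs.isHom hs
      have h₂ := ih.conv hs.isHom (proj hs.isHom 1)
      exact h₁.mul h₂
  have : IsNatural s (i + j) (i + j) (QuantumBInfty.braid s i j) := by
    induction i with
    | zero => exact (proj hs.isHom j).of_eq (by omega) (by omega)
    | succ i ih =>
      exact mul (m := i + 1 + j)
        ((ih.conv hs.isHom (proj hs.isHom 1)).of_eq (by omega) (by omega)) (((proj hs.isHom i).conv hs.isHom (row j)).of_eq (by omega) (by omega))
  exact this.of_eq rfl (Nat.add_comm i j)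

end IsNatural

end Braids

/-! ### Convolution along the braided coproduct -/

section BraidedConvolution

variable {K : Type u} [Field K] {V : Type v} [AddCommGroup V] [Module K V]

local notation "e" => proj K V
local notation "ad" => Finset.HasAntidiagonal.antidiagonal

theorem sum_antidiagonal_assoc {N : Type*} [AddCommMonoid N] (n : ℕ) (F : ℕ → ℕ → ℕ → N) :
    ∑ x ∈ ad n, ∑ y ∈ ad x.1, F y.1 y.2 x.2 = ∑ x ∈ ad n, ∑ y ∈ ad x.2, F x.1 y.1 y.2 := by
  rw [Finset.sum_sigma', Finset.sum_sigma']
  refine Finset.sum_bij' (fun t _ => ⟨(t.2.1, t.2.2 + t.1.2), (t.2.2, t.1.2)⟩)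
    (fun t _ => ⟨(t.1.1 + t.2.1, t.2.2), (t.1.1, t.2.1)⟩) ?_ ?_ ?_ ?_ ?_
  all_goals
    rintro ⟨⟨a, b⟩, ⟨c, d⟩⟩ h
    simp only [Finset.mem_sigma, Finset.HasAntidiagonal.mem_antidiagonal] at h
    obtain ⟨h₁, h₂⟩ := h
    first
    | (simp only [Finset.mem_sigma, Finset.HasAntidiagonal.mem_antidiagonal, and_true]; omega)
    | (subst h₂; rfl)

/-- A sum over a square, of terms supported below the diagonal, as a sum over antidiagonals. -/
theorem sum_range_range_eq_sum_antidiagonal {N : Type*} [AddCommMonoid N] (L : ℕ)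
    (F : ℕ → ℕ → N) (hF : ∀ a b, L < a + b → F a b = 0) :
    ∑ a ∈ Finset.range (L + 1), ∑ b ∈ Finset.range (L + 1), F a b =
      ∑ n ∈ Finset.range (L + 1), ∑ x ∈ ad n, F x.1 x.2 := by
  rw [← Finset.sum_product', Finset.sum_sigma']
  symm
  refine Finset.sum_of_injOn (fun t => t.2) ?_ ?_ ?_ ?_
  · rintro ⟨a, b⟩ h ⟨a', b'⟩ h' (rfl : b = b')
    simp only [Finset.coe_sigma, Set.mem_sigma_iff, Finset.mem_coe,
      Finset.HasAntidiagonal.mem_antidiagonal] at h h'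
    obtain rfl := h.2.symm.trans h'.2
    rfl
  · rintro ⟨a, b⟩ h
    simp only [Finset.coe_sigma, Set.mem_sigma_iff, Finset.mem_coe, Finset.mem_range,
      Finset.HasAntidiagonal.mem_antidiagonal] at h
    simp only [Finset.coe_product, Set.mem_prod, Finset.mem_coe, Finset.mem_range]
    omega
  · rintro ⟨a, b⟩ h h'
    refine hF _ _ ?_
    by_contra hc
    have hc : a + b ≤ L := not_lt.mp hc
    refine h' ⟨⟨a + b, (a, b)⟩, ?_, rfl⟩
    simp only [Finset.coe_sigma, Set.mem_sigma_iff, Finset.mem_coe, Finset.mem_range,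
      Finset.HasAntidiagonal.mem_antidiagonal]
    exact ⟨Nat.lt_succ_of_le hc, trivial⟩
  · intro t _
    rfl

/-- The component `V^{⊗(x₁+x₂)} ⊗ V^{⊗(y₁+y₂)} → V^{⊗(x₁+y₁)} ⊗ V^{⊗(x₂+y₂)}` of the braided
coproduct `Δ_β`, as an operator on `V^{⊗(x₁+x₂+y₁+y₂)}`. -/
def shuffle (s : Module.End K (TSpace K V)) (x y : ℕ × ℕ) : Module.End K (TSpace K V) :=
  e x.1 ⊛ braid s x.2 y.1 ⊛ e y.2

/-- The convolution of two families of operators on the spaces `V^{⊗p} ⊗ V^{⊗q}` along the braided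
coproduct `Δ_β`. -/
def conv₂ (s : Module.End K (TSpace K V)) (f g : ℕ → ℕ → Module.End K (TSpace K V)) (p q : ℕ) :
    Module.End K (TSpace K V) :=
  ∑ x ∈ ad p, ∑ y ∈ ad q, (f x.1 y.1 ⊛ g x.2 y.2) * shuffle s x y

variable {s : Module.End K (TSpace K V)}

theorem isNatural_shuffle (hs : IsNatural s 2 2 s) (x y : ℕ × ℕ) :
    IsNatural s (x.1 + x.2 + (y.1 + y.2)) (x.1 + y.1 + (x.2 + y.2)) (shuffle s x y) :=
  ((IsNatural.proj hs.isHom x.1).conv hs.isHom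
    ((hs.braid x.2 y.1).conv hs.isHom (IsNatural.proj hs.isHom y.2))).of_eq (by omega) (by omega)

/-- The cocycle identity behind the coassociativity of the braided coproduct. -/
theorem shuffle_cocycle (hs : IsNatural s 2 2 s) (a₁ a₂ a₃ b₁ b₂ b₃ : ℕ) :
    (shuffle s (a₁, a₂) (b₁, b₂) ⊛ e (a₃ + b₃)) * shuffle s (a₁ + a₂, a₃) (b₁ + b₂, b₃) =
      (e (a₁ + b₁) ⊛ shuffle s (a₂, a₃) (b₂, b₃)) * shuffle s (a₁, a₂ + a₃) (b₁, b₂ + b₃) := by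
  simp only [shuffle]
  rw [braid_add_right hs.isHom, braid_add_left hs.isHom]
  simp only [mul_conv_proj, proj_conv_mul, conv_assoc, conv_proj_proj, proj_conv_proj_conv]
  have h := congrArg (e a₁ ⊛ ·) ((hs.braid a₂ b₁).isHom.swap
    ((hs.braid a₃ b₂).isHom.conv (IsHom.proj b₃)))
  simp only [proj_conv_mul, proj_conv_proj_conv] at h
  rw [← mul_assoc, ← mul_assoc]
  congr 1
  convert h using 3
  · congr 2; omega
  · congr 1; omega
  · congr 1; omega
  · congr 2; omega

/-- Coassociativity of the braided coproduct. -/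
theorem conv₂_assoc (hs : IsNatural s 2 2 s) {f g h : ℕ → ℕ → Module.End K (TSpace K V)}
    (hf : ∀ a b, f a b * e (a + b) = f a b) (hh : ∀ a b, h a b * e (a + b) = h a b) :
    conv₂ s (conv₂ s f g) h = conv₂ s f (conv₂ s g h) := by
  funext p q
  have key : ∀ a₁ a₂ a₃ b₁ b₂ b₃ : ℕ,
      (((f a₁ b₁ ⊛ g a₂ b₂) * shuffle s (a₁, a₂) (b₁, b₂)) ⊛ h a₃ b₃) *
        shuffle s (a₁ + a₂, a₃) (b₁ + b₂, b₃) =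
      (f a₁ b₁ ⊛ ((g a₂ b₂ ⊛ h a₃ b₃) * shuffle s (a₂, a₃) (b₂, b₃))) *
        shuffle s (a₁, a₂ + a₃) (b₁, b₂ + b₃) := by
    intro a₁ a₂ a₃ b₁ b₂ b₃
    have h₁ := conv_mul_conv_right (a₃ + b₃) (hh a₃ b₃) (proj_mul_self _)
      (f a₁ b₁ ⊛ g a₂ b₂) (shuffle s (a₁, a₂) (b₁, b₂))
    have h₂ := conv_mul_conv_left (a₁ + b₁) (hf a₁ b₁) (proj_mul_self _)
      (g a₂ b₂ ⊛ h a₃ b₃) (shuffle s (a₂, a₃) (b₂, b₃))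
    rw [hh] at h₁
    rw [hf] at h₂
    rw [← h₁, ← h₂, mul_assoc, mul_assoc, shuffle_cocycle hs, conv_assoc]
  calc conv₂ s (conv₂ s f g) h p q
    _ = ∑ x ∈ ad p, ∑ x' ∈ ad x.1, ∑ y ∈ ad q, ∑ y' ∈ ad y.1,
          (((f x'.1 y'.1 ⊛ g x'.2 y'.2) * shuffle s (x'.1, x'.2) (y'.1, y'.2)) ⊛ h x.2 y.2) *
            shuffle s (x'.1 + x'.2, x.2) (y'.1 + y'.2, y.2) := by
      refine Finset.sum_congr rfl fun x _ => ?_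
      rw [Finset.sum_comm]
      refine Finset.sum_congr rfl fun y _ => ?_
      rw [conv₂, sum_conv, Finset.sum_mul]
      refine Finset.sum_congr rfl fun x' hx' => ?_
      rw [sum_conv, Finset.sum_mul]
      refine Finset.sum_congr rfl fun y' hy' => ?_
      rw [Finset.HasAntidiagonal.mem_antidiagonal.mp hx',
        Finset.HasAntidiagonal.mem_antidiagonal.mp hy']
    _ = ∑ x ∈ ad p, ∑ x' ∈ ad x.2, ∑ y ∈ ad q, ∑ y' ∈ ad y.2,
          (f x.1 y.1 ⊛ ((g x'.1 y'.1 ⊛ h x'.2 y'.2) * shuffle s (x'.1, x'.2) (y'.1, y'.2))) *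
            shuffle s (x.1, x'.1 + x'.2) (y.1, y'.1 + y'.2) := by
      simp only [key]
      rw [sum_antidiagonal_assoc p fun a b c => ∑ y ∈ ad q, ∑ y' ∈ ad y.1,
        (f a y'.1 ⊛ ((g b y'.2 ⊛ h c y.2) * shuffle s (b, c) (y'.2, y.2))) *
        shuffle s (a, b + c) (y'.1, y'.2 + y.2)]
      refine Finset.sum_congr rfl fun x _ => Finset.sum_congr rfl fun x' _ => ?_
      exact sum_antidiagonal_assoc q fun a b c =>
        (f x.1 a ⊛ ((g x'.1 b ⊛ h x'.2 c) * shuffle s (x'.1, x'.2) (b, c))) *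
        shuffle s (x.1, x'.1 + x'.2) (a, b + c)
    _ = conv₂ s f (conv₂ s g h) p q := by
      refine Finset.sum_congr rfl fun x _ => ?_
      rw [Finset.sum_comm]
      refine Finset.sum_congr rfl fun y _ => ?_
      rw [conv₂, conv_sum, Finset.sum_mul]
      refine Finset.sum_congr rfl fun x' hx' => ?_
      rw [conv_sum, Finset.sum_mul]
      refine Finset.sum_congr rfl fun y' hy' => ?_
      rw [Finset.HasAntidiagonal.mem_antidiagonal.mp hx',
        Finset.HasAntidiagonal.mem_antidiagonal.mp hy']

theorem conv₂_congr {f f' g g' : ℕ → ℕ → Module.End K (TSpace K V)} {p q : ℕ}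
    (h : ∀ a b c d, a + b = p → c + d = q → f a c ⊛ g b d = f' a c ⊛ g' b d) :
    conv₂ s f g p q = conv₂ s f' g' p q := by
  refine Finset.sum_congr rfl fun x hx => Finset.sum_congr rfl fun y hy => ?_
  rw [h _ _ _ _ (Finset.HasAntidiagonal.mem_antidiagonal.mp hx)
    (Finset.HasAntidiagonal.mem_antidiagonal.mp hy)]

/-- The operator `V^{⊗p} ⊗ V^{⊗q} → K = V^{⊗0}` that is the identity for `p = q = 0`, and zero
otherwise: the unit of the convolution. -/
def counit₂ (p q : ℕ) : Module.End K (TSpace K V) := if p = 0 ∧ q = 0 then e 0 else 0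

theorem isNatural_counit₂ (hs : IsHom 2 2 s) (p q : ℕ) :
    IsNatural s (p + q) 0 (counit₂ p q) := by
  unfold counit₂
  split_ifs with h
  · exact (IsNatural.proj hs 0).of_eq (by omega) rfl
  · exact IsNatural.zero _ _

theorem conv₂_counit₂ {f : ℕ → ℕ → Module.End K (TSpace K V)}
    (hf : ∀ a b, f a b * e (a + b) = f a b) : conv₂ s f counit₂ = f := by
  funext p q
  rw [conv₂, Finset.sum_eq_single (p, 0), Finset.sum_eq_single (q, 0)]
  · simp [shuffle, counit₂, conv_proj_zero, hf]
  · rintro ⟨a, b⟩ h hne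
    have h := Finset.HasAntidiagonal.mem_antidiagonal.mp h
    have : b ≠ 0 := by rintro rfl; exact hne (by simpa using h)
    simp [counit₂, this]
  · intro h
    simp at h
  · rintro ⟨a, b⟩ h hne
    have h := Finset.HasAntidiagonal.mem_antidiagonal.mp h
    have : b ≠ 0 := by rintro rfl; exact hne (by simpa using h)
    refine Finset.sum_eq_zero fun y _ => ?_
    simp [counit₂, this]
  · intro h
    simp at h

theorem conv₂_counit₂_left {s : Module.End K (TSpace K V)}
    {f : ℕ → ℕ → Module.End K (TSpace K V)}
    (hf : ∀ a b, f a b * e (a + b) = f a b) : conv₂ s counit₂ f = f := by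
  funext p q
  rw [conv₂, Finset.sum_eq_single (0, p), Finset.sum_eq_single (0, q)]
  · simp [shuffle, counit₂, proj_zero_conv, hf]
  · rintro ⟨a, b⟩ h hne
    have h := Finset.HasAntidiagonal.mem_antidiagonal.mp h
    have : a ≠ 0 := by rintro rfl; exact hne (by simpa using h)
    simp [counit₂, this]
  · intro h
    simp at h
  · rintro ⟨a, b⟩ h hne
    have h := Finset.HasAntidiagonal.mem_antidiagonal.mp h
    have : a ≠ 0 := by rintro rfl; exact hne (by simpa using h)
    refine Finset.sum_eq_zero fun y _ => ?_
    simp [counit₂, this]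
  · intro h
    simp at h

/-- The convolution powers of a family of operations. For operations `M_{pq} : V^{⊗(p+q)} → V`, the
`n`-th power is the component in `V^{⊗n}` of the product on `T(V)` cogenerated by `M`. -/
def convPow (s : Module.End K (TSpace K V)) (M : ℕ → ℕ → Module.End K (TSpace K V)) :
    ℕ → ℕ → ℕ → Module.End K (TSpace K V)
  | 0 => counit₂
  | n + 1 => conv₂ s (convPow s M n) M

theorem isHom_shuffle {s : Module.End K (TSpace K V)} (hs : IsHom 2 2 s) (x y : ℕ × ℕ) :
    IsHom (x.1 + x.2 + (y.1 + y.2)) (x.1 + y.1 + (x.2 + y.2)) (shuffle s x y) :=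
  ((IsHom.proj x.1).conv ((isHom_braid' hs x.2 y.1).conv (IsHom.proj y.2))).of_eq
    (by omega) (by omega)

theorem isHom_conv₂ {s : Module.End K (TSpace K V)} (hs : IsHom 2 2 s)
    {f g : ℕ → ℕ → Module.End K (TSpace K V)} {n m : ℕ}
    (hf : ∀ a b, IsHom (a + b) n (f a b)) (hg : ∀ a b, IsHom (a + b) m (g a b))
    (p q : ℕ) : IsHom (p + q) (n + m) (conv₂ s f g p q) := by
  refine IsHom.sum fun x hx => IsHom.sum fun y hy => ?_
  have hx := Finset.HasAntidiagonal.mem_antidiagonal.mp hx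
  have hy := Finset.HasAntidiagonal.mem_antidiagonal.mp hy
  exact ((hf _ _).conv (hg _ _)).mul ((isHom_shuffle hs x y).of_eq (by omega) rfl)

theorem isNatural_conv₂ (hs : IsNatural s 2 2 s) {f g : ℕ → ℕ → Module.End K (TSpace K V)}
    {n m : ℕ} (hf : ∀ a b, IsNatural s (a + b) n (f a b)) (hg : ∀ a b, IsNatural s (a + b) m (g a b))
    (p q : ℕ) : IsNatural s (p + q) (n + m) (conv₂ s f g p q) := by
  refine IsNatural.sum fun x hx => IsNatural.sum fun y hy => ?_
  have hx := Finset.HasAntidiagonal.mem_antidiagonal.mp hx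
  have hy := Finset.HasAntidiagonal.mem_antidiagonal.mp hy
  exact ((hf _ _).conv hs.isHom (hg _ _)).mul
    ((isNatural_shuffle hs x y).of_eq (by omega) rfl)

theorem isHom_convPow {s : Module.End K (TSpace K V)} (hs : IsHom 2 2 s)
    {M : ℕ → ℕ → Module.End K (TSpace K V)} (hM : ∀ a b, IsHom (a + b) 1 (M a b)) (n p q : ℕ) :
    IsHom (p + q) n (convPow s M n p q) := by
  induction n generalizing p q with
  | zero => exact (isNatural_counit₂ hs p q).isHom
  | succ n ih => exact isHom_conv₂ hs ih hM p q

theorem isNatural_convPow (hs : IsNatural s 2 2 s) {M : ℕ → ℕ → Module.End K (TSpace K V)}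
    (hM : ∀ a b, IsNatural s (a + b) 1 (M a b)) (n p q : ℕ) :
    IsNatural s (p + q) n (convPow s M n p q) := by
  induction n generalizing p q with
  | zero => exact isNatural_counit₂ hs.isHom p q
  | succ n ih => exact isNatural_conv₂ hs ih hM p q

theorem convPow_add (hs : IsNatural s 2 2 s) {M : ℕ → ℕ → Module.End K (TSpace K V)}
    (hM : ∀ a b, IsNatural s (a + b) 1 (M a b)) (m n : ℕ) :
    convPow s M (m + n) = conv₂ s (convPow s M m) (convPow s M n) := by
  induction n with
  | zero => exact (conv₂_counit₂ fun a b => (isNatural_convPow hs hM m a b).isHom.dom).symm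
  | succ n ih =>
    rw [← add_assoc, convPow, ih, convPow, conv₂_assoc hs
      (fun a b => (isNatural_convPow hs hM m a b).isHom.dom) fun a b => (hM a b).isHom.dom]

theorem convPow_eq_zero {M : ℕ → ℕ → Module.End K (TSpace K V)} (hM : M 0 0 = 0) {n p q : ℕ}
    (h : p + q < n) : convPow s M n p q = 0 := by
  induction n generalizing p q with
  | zero => omega
  | succ n ih =>
    rw [convPow, conv₂]
    refine Finset.sum_eq_zero fun x hx => Finset.sum_eq_zero fun y hy => ?_
    have hx := Finset.HasAntidiagonal.mem_antidiagonal.mp hx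
    have hy := Finset.HasAntidiagonal.mem_antidiagonal.mp hy
    by_cases h' : x.1 + y.1 < n
    · rw [ih h', zero_conv, zero_mul]
    · rw [show x.2 = 0 by omega, show y.2 = 0 by omega, hM, conv_zero, zero_mul]

theorem convPow_congr {M M' : ℕ → ℕ → Module.End K (TSpace K V)} {p q : ℕ}
    (h : ∀ a b, a + b ≤ p + q → M a b = M' a b) (n : ℕ) :
    convPow s M n p q = convPow s M' n p q := by
  induction n generalizing p q with
  | zero => rfl
  | succ n ih =>
    refine conv₂_congr fun a b c d h₁ h₂ => ?_
    rw [ih fun i j hij => h i j (by omega), h b d (by omega)]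

/-- From the second power on, only operations of smaller total degree contribute. -/
theorem convPow_congr_of_lt {M M' : ℕ → ℕ → Module.End K (TSpace K V)} {p q : ℕ}
    (h : ∀ a b, a + b < p + q → M a b = M' a b) (hM : M 0 0 = 0) (hM' : M' 0 0 = 0) (n : ℕ) :
    convPow s M (n + 2) p q = convPow s M' (n + 2) p q := by
  refine conv₂_congr fun a b c d h₁ h₂ => ?_
  by_cases hbd : b + d = 0
  · rw [show b = 0 by omega, show d = 0 by omega, hM, hM', conv_zero, conv_zero]
  by_cases hac : a + c = 0
  · rw [convPow_eq_zero hM (by omega), convPow_eq_zero hM' (by omega), zero_conv, zero_conv]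
  · rw [convPow_congr (fun i j hij => h i j (by omega)), h b d (by omega)]

end BraidedConvolution

/-! ### Associativity of the product cogenerated by the operations -/

section Associativity

variable {K : Type u} [Field K] {V : Type v} [AddCommGroup V] [Module K V]

local notation "e" => proj K V
local notation "ad" => Finset.HasAntidiagonal.antidiagonal

/-- The components of the braided coproduct of `T(V)^{⊗3}`, obtained from the braided coproduct of
the first two factors and deconcatenation on the third. -/
def shuffle₃ (s : Module.End K (TSpace K V)) (x y z : ℕ × ℕ) : Module.End K (TSpace K V) :=
  (e (x.1 + y.1) ⊛ braid s (x.2 + y.2) z.1 ⊛ e z.2) * (shuffle s x y ⊛ e (z.1 + z.2))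

/-- The convolution of two families of operators on the spaces `V^{⊗i} ⊗ V^{⊗j} ⊗ V^{⊗k}`. -/
def conv₃ (s : Module.End K (TSpace K V)) (f g : ℕ → ℕ → ℕ → Module.End K (TSpace K V))
    (i j k : ℕ) : Module.End K (TSpace K V) :=
  ∑ x ∈ ad i, ∑ y ∈ ad j, ∑ z ∈ ad k, (f x.1 y.1 z.1 ⊛ g x.2 y.2 z.2) * shuffle₃ s x y z

/-- The family `F ∘ (⋆ ⊗ id)`, where `⋆` is the product on `T(V)` cogenerated by `M`; its components
in `V^{⊗r}` are taken for `r ≤ L` only. -/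
def liftLeft (s : Module.End K (TSpace K V)) (M : ℕ → ℕ → Module.End K (TSpace K V)) (L : ℕ)
    (F : ℕ → ℕ → Module.End K (TSpace K V)) (i j k : ℕ) : Module.End K (TSpace K V) :=
  ∑ r ∈ Finset.range (L + 1), F r k * (convPow s M r i j ⊛ e k)

/-- The family `F ∘ (id ⊗ ⋆)`, where `⋆` is the product on `T(V)` cogenerated by `M`; its components
in `V^{⊗r}` are taken for `r ≤ L` only. -/
def liftRight (s : Module.End K (TSpace K V)) (M : ℕ → ℕ → Module.End K (TSpace K V)) (L : ℕ)
    (F : ℕ → ℕ → Module.End K (TSpace K V)) (i j k : ℕ) : Module.End K (TSpace K V) :=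
  ∑ r ∈ Finset.range (L + 1), F i r * (e i ⊛ convPow s M r j k)

variable {s : Module.End K (TSpace K V)} {M : ℕ → ℕ → Module.End K (TSpace K V)}

/-- The coproduct of `T(V)^{⊗3}` does not depend on the bracketing. -/
theorem shuffle₃_eq (hs : IsNatural s 2 2 s) (x y z : ℕ × ℕ) :
    shuffle₃ s x y z =
      (e x.1 ⊛ braid s x.2 (y.1 + z.1) ⊛ e (y.2 + z.2)) * (e (x.1 + x.2) ⊛ shuffle s y z) := by
  obtain ⟨x₁, x₂⟩ := x
  obtain ⟨y₁, y₂⟩ := y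
  obtain ⟨z₁, z₂⟩ := z
  simp only [shuffle₃, shuffle]
  rw [braid_add_right hs.isHom, braid_add_left hs.isHom]
  simp only [mul_conv_proj, proj_conv_mul, conv_assoc, conv_proj_proj, proj_conv_proj_conv]
  have h := congrArg (e x₁ ⊛ ·) ((hs.braid x₂ y₁).isHom.swap
    ((hs.braid y₂ z₁).isHom.conv (IsHom.proj z₂)))
  simp only [proj_conv_mul, proj_conv_proj_conv] at h
  rw [mul_assoc, mul_assoc]
  congr 1
  convert h.symm using 3
  · congr 1; omega
  · congr 2; omega
  · congr 2; omega
  · congr 1; omega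

theorem liftLeft_term {f g p q : Module.End K (TSpace K V)} {r r' : ℕ}
    {x y z : ℕ × ℕ} (hf : f * e (r + z.1) = f) (hp : IsHom (x.1 + y.1) r p)
    (hq : IsNatural s (x.2 + y.2) r' q) :
    ((f * (p ⊛ e z.1)) ⊛ (g * (q ⊛ e z.2))) * shuffle₃ s x y z =
      (f ⊛ g) * shuffle s (r, r') z * (((p ⊛ q) * shuffle s x y) ⊛ e (z.1 + z.2)) := by
  have h₁ : (p ⊛ e z.1 ⊛ q ⊛ e z.2) * (e (x.1 + y.1) ⊛ braid s (x.2 + y.2) z.1 ⊛ e z.2) =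
      shuffle s (r, r') z * (p ⊛ q ⊛ e (z.1 + z.2)) := by
    rw [hp.interchange (IsHom.proj _), ← conv_assoc (e z.1), ← mul_conv_proj, ← hq.left,
      mul_conv_proj, shuffle, (IsHom.proj r).interchange hp, hp.cod, hp.dom, conv_assoc,
      conv_proj_proj]
  have h₂ := conv_mul_conv_left (r + z.1) hf (hp.conv (IsHom.proj z.1)).cod g (q ⊛ e z.2)
  rw [← h₂, shuffle₃, mul_conv_proj, conv_assoc, conv_assoc]
  simp only [mul_assoc]
  rw [← mul_assoc (p ⊛ _), h₁, mul_assoc]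

theorem liftRight_term (hs : IsNatural s 2 2 s) {f g p q : Module.End K (TSpace K V)} {r r' : ℕ}
    {x y z : ℕ × ℕ} (hf : f * e (x.1 + r) = f) (hp : IsNatural s (y.1 + z.1) r p)
    (hq : IsHom (y.2 + z.2) r' q) :
    ((f * (e x.1 ⊛ p)) ⊛ (g * (e x.2 ⊛ q))) * shuffle₃ s x y z =
      (f ⊛ g) * shuffle s x (r, r') * (e (x.1 + x.2) ⊛ ((p ⊛ q) * shuffle s y z)) := by
  have h₁ : (e x.1 ⊛ p ⊛ e x.2 ⊛ q) * (e x.1 ⊛ braid s x.2 (y.1 + z.1) ⊛ e (y.2 + z.2)) =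
      shuffle s x (r, r') * (e (x.1 + x.2) ⊛ p ⊛ q) := by
    rw [← proj_conv_mul, ← conv_assoc p, hq.interchange' (IsHom.proj _), ← hp.right, shuffle,
      ← conv_proj_proj x.1 x.2, conv_assoc, ← proj_conv_mul, ← conv_assoc (e x.2),
      (IsHom.proj r').interchange' hq, hq.cod, hq.dom]
  have h₂ := conv_mul_conv_left (x.1 + r) hf ((IsHom.proj x.1).conv hp.isHom).cod g (e x.2 ⊛ q)
  rw [← h₂, shuffle₃_eq hs, proj_conv_mul, conv_assoc]
  simp only [mul_assoc]
  rw [← mul_assoc (e x.1 ⊛ _), h₁, mul_assoc]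

theorem sum_comm₅ {N ι ι₁ ι₂ ι₃ ι₄ : Type*} [AddCommMonoid N] (A : Finset ι) (B : Finset ι₁)
    (C : Finset ι₂) (D : Finset ι₃) (E : Finset ι₄) (T : ι → ι₁ → ι₂ → ι₃ → ι₄ → N) :
    ∑ x ∈ A, ∑ y ∈ B, ∑ z ∈ C, ∑ r ∈ D, ∑ r' ∈ E, T x y z r r' =
      ∑ r ∈ D, ∑ r' ∈ E, ∑ z ∈ C, ∑ x ∈ A, ∑ y ∈ B, T x y z r r' := by
  calc _ = ∑ x ∈ A, ∑ y ∈ B, ∑ r ∈ D, ∑ r' ∈ E, ∑ z ∈ C, T x y z r r' :=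
        Finset.sum_congr rfl fun x _ => Finset.sum_congr rfl fun y _ =>
          Finset.sum_comm.trans (Finset.sum_congr rfl fun r _ => Finset.sum_comm)
    _ = ∑ x ∈ A, ∑ r ∈ D, ∑ r' ∈ E, ∑ z ∈ C, ∑ y ∈ B, T x y z r r' :=
        Finset.sum_congr rfl fun x _ => Finset.sum_comm.trans (Finset.sum_congr rfl fun r _ =>
          Finset.sum_comm.trans (Finset.sum_congr rfl fun r' _ => Finset.sum_comm))
    _ = _ := Finset.sum_comm.trans (Finset.sum_congr rfl fun r _ =>
          Finset.sum_comm.trans (Finset.sum_congr rfl fun r' _ => Finset.sum_comm))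

/-- `⋆ ⊗ id` is compatible with the braided coproducts, so that precomposition with it is multiplicative
for convolution. The bound `L` only has to be large enough for all nonzero terms to be included. -/
theorem conv₃_liftLeft (hs : IsNatural s 2 2 s) (hM : ∀ a b, IsNatural s (a + b) 1 (M a b))
    (hM₀ : M 0 0 = 0) {F G : ℕ → ℕ → Module.End K (TSpace K V)}
    (hF : ∀ a b, F a b * e (a + b) = F a b) {L i j k : ℕ} (hL : i + j ≤ L) :
    conv₃ s (liftLeft s M L F) (liftLeft s M L G) i j k =
      liftLeft s M L (conv₂ s F G) i j k := by
  calc conv₃ s (liftLeft s M L F) (liftLeft s M L G) i j k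
    _ = ∑ r ∈ Finset.range (L + 1), ∑ r' ∈ Finset.range (L + 1), ∑ z ∈ ad k,
          (F r z.1 ⊛ G r' z.2) * shuffle s (r, r') z * (convPow s M (r + r') i j ⊛ e k) := by
      have h : ∀ x y z : ℕ × ℕ,
          (liftLeft s M L F x.1 y.1 z.1 ⊛ liftLeft s M L G x.2 y.2 z.2) * shuffle₃ s x y z =
          ∑ r ∈ Finset.range (L + 1), ∑ r' ∈ Finset.range (L + 1),
            (F r z.1 ⊛ G r' z.2) * shuffle s (r, r') z *
              (((convPow s M r x.1 y.1 ⊛ convPow s M r' x.2 y.2) * shuffle s x y) ⊛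
                e (z.1 + z.2)) := by
        intro x y z
        simp only [liftLeft, sum_conv, conv_sum, Finset.sum_mul]
        rw [Finset.sum_comm]
        refine Finset.sum_congr rfl fun r _ => Finset.sum_congr rfl fun r' _ => ?_
        exact liftLeft_term (hF _ _) (isNatural_convPow hs hM _ _ _).isHom
          (isNatural_convPow hs hM _ _ _)
      simp only [conv₃, h, convPow_add hs hM, conv₂, sum_conv, Finset.mul_sum]
      rw [sum_comm₅]
      refine Finset.sum_congr rfl fun r _ => Finset.sum_congr rfl fun r' _ =>
        Finset.sum_congr rfl fun z hz => ?_
      rw [Finset.HasAntidiagonal.mem_antidiagonal.mp hz]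
    _ = ∑ n ∈ Finset.range (L + 1), ∑ x ∈ ad n, ∑ z ∈ ad k,
          (F x.1 z.1 ⊛ G x.2 z.2) * shuffle s x z * (convPow s M (x.1 + x.2) i j ⊛ e k) :=
      sum_range_range_eq_sum_antidiagonal L (fun r r' => ∑ z ∈ ad k,
          (F r z.1 ⊛ G r' z.2) * shuffle s (r, r') z * (convPow s M (r + r') i j ⊛ e k))
        fun a b hab => Finset.sum_eq_zero fun z _ => by
          rw [convPow_eq_zero hM₀ (by omega), zero_conv, mul_zero]
    _ = liftLeft s M L (conv₂ s F G) i j k := by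
      refine Finset.sum_congr rfl fun n _ => ?_
      rw [conv₂, Finset.sum_mul]
      refine Finset.sum_congr rfl fun x hx => ?_
      rw [Finset.sum_mul, Finset.HasAntidiagonal.mem_antidiagonal.mp hx]

/-- `id ⊗ ⋆` is compatible with the braided coproducts. -/
theorem conv₃_liftRight (hs : IsNatural s 2 2 s) (hM : ∀ a b, IsNatural s (a + b) 1 (M a b))
    (hM₀ : M 0 0 = 0) {F G : ℕ → ℕ → Module.End K (TSpace K V)}
    (hF : ∀ a b, F a b * e (a + b) = F a b) {L i j k : ℕ} (hL : j + k ≤ L) :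
    conv₃ s (liftRight s M L F) (liftRight s M L G) i j k =
      liftRight s M L (conv₂ s F G) i j k := by
  calc conv₃ s (liftRight s M L F) (liftRight s M L G) i j k
    _ = ∑ r ∈ Finset.range (L + 1), ∑ r' ∈ Finset.range (L + 1), ∑ x ∈ ad i,
          (F x.1 r ⊛ G x.2 r') * shuffle s x (r, r') * (e i ⊛ convPow s M (r + r') j k) := by
      have h : ∀ x y z : ℕ × ℕ,
          (liftRight s M L F x.1 y.1 z.1 ⊛ liftRight s M L G x.2 y.2 z.2) * shuffle₃ s x y z =
          ∑ r ∈ Finset.range (L + 1), ∑ r' ∈ Finset.range (L + 1),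
            (F x.1 r ⊛ G x.2 r') * shuffle s x (r, r') *
              (e (x.1 + x.2) ⊛
                ((convPow s M r y.1 z.1 ⊛ convPow s M r' y.2 z.2) * shuffle s y z)) := by
        intro x y z
        simp only [liftRight, sum_conv, conv_sum, Finset.sum_mul]
        rw [Finset.sum_comm]
        refine Finset.sum_congr rfl fun r _ => Finset.sum_congr rfl fun r' _ => ?_
        exact liftRight_term hs (hF _ _) (isNatural_convPow hs hM _ _ _)
          (isNatural_convPow hs hM _ _ _).isHom
      simp only [conv₃, h, convPow_add hs hM, conv₂, conv_sum, Finset.mul_sum]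
      have h' : ∀ x : ℕ × ℕ, ∀ T : ℕ × ℕ → ℕ × ℕ → ℕ → ℕ → Module.End K (TSpace K V),
          ∑ y ∈ ad j, ∑ z ∈ ad k, ∑ r ∈ Finset.range (L + 1), ∑ r' ∈ Finset.range (L + 1),
            T y z r r' = ∑ r ∈ Finset.range (L + 1), ∑ r' ∈ Finset.range (L + 1), ∑ y ∈ ad j,
              ∑ z ∈ ad k, T y z r r' := by
        intro x T
        have := sum_comm₅ (ad j) (ad k) {0} (Finset.range (L + 1)) (Finset.range (L + 1))
          fun y z _ r r' => T y z r r'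
        simpa only [Finset.sum_singleton] using this
      rw [Finset.sum_congr rfl fun x _ => h' x _, Finset.sum_comm]
      refine Finset.sum_congr rfl fun r _ => ?_
      rw [Finset.sum_comm]
      refine Finset.sum_congr rfl fun r' _ => Finset.sum_congr rfl fun x hx => ?_
      rw [Finset.HasAntidiagonal.mem_antidiagonal.mp hx]
    _ = ∑ n ∈ Finset.range (L + 1), ∑ y ∈ ad n, ∑ x ∈ ad i,
          (F x.1 y.1 ⊛ G x.2 y.2) * shuffle s x y * (e i ⊛ convPow s M (y.1 + y.2) j k) :=
      sum_range_range_eq_sum_antidiagonal L (fun r r' => ∑ x ∈ ad i,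
          (F x.1 r ⊛ G x.2 r') * shuffle s x (r, r') * (e i ⊛ convPow s M (r + r') j k))
        fun a b hab => Finset.sum_eq_zero fun z _ => by
          rw [convPow_eq_zero hM₀ (by omega), conv_zero, mul_zero]
    _ = liftRight s M L (conv₂ s F G) i j k := by
      refine Finset.sum_congr rfl fun n _ => ?_
      rw [conv₂, Finset.sum_comm, Finset.sum_mul]
      refine Finset.sum_congr rfl fun x hx => ?_
      rw [Finset.sum_mul]
      refine Finset.sum_congr rfl fun y hy => ?_
      rw [Finset.HasAntidiagonal.mem_antidiagonal.mp hy]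

variable {d t w : Module.End K (TSpace K V)}

/-- The iterated products `V^{⊗n} → V` of an algebra with product `d` and unit `w`. -/
def iterProd (d w : Module.End K (TSpace K V)) : ℕ → Module.End K (TSpace K V)
  | 0 => w
  | n + 1 => d * (iterProd d w n ⊛ e 1)

/-- The product of the two iterated products on `V^{⊗p} ⊗ V^{⊗q}`. -/
def iterProd₂ (d t w : Module.End K (TSpace K V)) (p q : ℕ) : Module.End K (TSpace K V) :=
  t * (iterProd d w p ⊛ iterProd d w q)

theorem isHom_iterProd (hd : IsHom 2 1 d) (hw : IsHom 0 1 w) (n : ℕ) :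
    IsHom n 1 (iterProd d w n) := by
  induction n with
  | zero => exact hw
  | succ n ih => exact hd.mul (ih.conv (IsHom.proj 1))

theorem isHom_iterProd₂ (hd : IsHom 2 1 d) (ht : IsHom 2 1 t) (hw : IsHom 0 1 w) (p q : ℕ) :
    IsHom (p + q) 1 (iterProd₂ d t w p q) :=
  ht.mul ((isHom_iterProd hd hw p).conv (isHom_iterProd hd hw q))

variable (s M d t w) in
/-- The data of two products `t`, `d` with common unit `w`, and of the family of operations `M`
determined by them, as operators on `T(V)`. -/
structure IsOperationsOf : Prop where
  braid_natural : IsNatural s 2 2 s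
  ops_natural : ∀ a b, IsNatural s (a + b) 1 (M a b)
  ops_zero : M 0 0 = 0
  isHom_dot : IsHom 2 1 d
  isHom_star : IsHom 2 1 t
  isHom_one : IsHom 0 1 w
  one_dot : d * (w ⊛ e 1) = e 1
  one_star : t * (w ⊛ e 1) = e 1
  star_assoc : t * (t ⊛ e 1) = t * (e 1 ⊛ t)
  /-- The product cogenerated by `M` is transformed by the iterated products into `t`. -/
  iterProd₂_eq : ∀ p q, iterProd₂ d t w p q =
    ∑ n ∈ Finset.range (p + q + 1), iterProd d w n * convPow s M n p q

namespace IsOperationsOf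

variable (h : IsOperationsOf s M d t w)
include h

theorem iterProd₂_eq_of_le {p q L : ℕ} (hL : p + q ≤ L) : iterProd₂ d t w p q =
    ∑ n ∈ Finset.range (L + 1), iterProd d w n * convPow s M n p q := by
  rw [h.iterProd₂_eq]
  refine Finset.sum_subset (Finset.range_mono (by omega)) fun n _ hn => ?_
  rw [convPow_eq_zero h.ops_zero (by simpa using hn), mul_zero]

/-- In the convolution algebra of maps to `(V, d)`, the product of the iterated products is the
geometric series of `M`. -/
theorem iterProd₂_rec (p q : ℕ) : iterProd₂ d t w p q =
    w * counit₂ p q + d * conv₂ s (iterProd₂ d t w) M p q := by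
  rw [h.iterProd₂_eq_of_le (Nat.le_succ (p + q)), Finset.sum_range_succ', add_comm]
  congr 1
  simp only [convPow, conv₂, Finset.mul_sum]
  rw [Finset.sum_comm]
  refine Finset.sum_congr rfl fun x hx => ?_
  rw [Finset.sum_comm]
  refine Finset.sum_congr rfl fun y hy => ?_
  have hx := Finset.HasAntidiagonal.mem_antidiagonal.mp hx
  have hy := Finset.HasAntidiagonal.mem_antidiagonal.mp hy
  rw [h.iterProd₂_eq_of_le (L := p + q) (by omega), sum_conv, Finset.sum_mul, Finset.mul_sum]
  refine Finset.sum_congr rfl fun n _ => ?_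
  rw [iterProd, ← mul_assoc, mul_assoc d, mul_assoc d,
    (isHom_iterProd h.isHom_dot h.isHom_one n).interchange
      (isNatural_convPow h.braid_natural h.ops_natural n x.1 y.1).isHom,
    (h.ops_natural x.2 y.2).isHom.cod]

theorem liftLeft_iterProd₂ {L i j : ℕ} (hL : i + j ≤ L) (k : ℕ) :
    liftLeft s M L (iterProd₂ d t w) i j k = t * (iterProd₂ d t w i j ⊛ iterProd d w k) := by
  rw [h.iterProd₂_eq_of_le hL, sum_conv, Finset.mul_sum]
  refine Finset.sum_congr rfl fun r _ => ?_
  rw [iterProd₂, mul_assoc, (isHom_iterProd h.isHom_dot h.isHom_one r).interchange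
      (isNatural_convPow h.braid_natural h.ops_natural r i j).isHom,
    (isHom_iterProd h.isHom_dot h.isHom_one k).dom]

theorem liftRight_iterProd₂ {L j k : ℕ} (hL : j + k ≤ L) (i : ℕ) :
    liftRight s M L (iterProd₂ d t w) i j k = t * (iterProd d w i ⊛ iterProd₂ d t w j k) := by
  rw [h.iterProd₂_eq_of_le hL, conv_sum, Finset.mul_sum]
  refine Finset.sum_congr rfl fun r _ => ?_
  rw [iterProd₂, mul_assoc, (isHom_iterProd h.isHom_dot h.isHom_one i).interchange (IsHom.proj i),
    (isHom_iterProd h.isHom_dot h.isHom_one i).dom]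

theorem liftLeft_iterProd₂_eq_liftRight {L i j k : ℕ} (hij : i + j ≤ L) (hjk : j + k ≤ L) :
    liftLeft s M L (iterProd₂ d t w) i j k = liftRight s M L (iterProd₂ d t w) i j k := by
  have hi := isHom_iterProd h.isHom_dot h.isHom_one i
  have hj := isHom_iterProd h.isHom_dot h.isHom_one j
  have hk := isHom_iterProd h.isHom_dot h.isHom_one k
  have h₁ := h.isHom_star.interchange (f' := e 1) (g' := iterProd d w k) (hi.conv hj)
  have h₂ := (IsHom.proj 1).interchange (f' := t) (g' := iterProd d w j ⊛ iterProd d w k) hi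
  rw [hk.cod] at h₁
  rw [hi.cod] at h₂
  rw [h.liftLeft_iterProd₂ hij, h.liftRight_iterProd₂ hjk, iterProd₂, iterProd₂, ← h₁, ← h₂,
    ← mul_assoc, ← mul_assoc, h.star_assoc, conv_assoc]

theorem iterProd₂_zero_zero : iterProd₂ d t w 0 0 = w := by
  have h₁ := h.isHom_one.interchange (f' := e 1) (g' := w) (IsHom.proj 0)
  rw [h.isHom_one.dom, h.isHom_one.cod, proj_zero_conv] at h₁
  rw [iterProd₂, iterProd, ← h₁, ← mul_assoc, h.one_star, h.isHom_one.cod]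

theorem liftLeft_counit₂ {L i j k : ℕ} : liftLeft s M L (fun p q => w * counit₂ p q) i j k =
    if i = 0 ∧ j = 0 ∧ k = 0 then w else 0 := by
  rw [liftLeft, Finset.sum_eq_single 0]
  · by_cases hk : k = 0
    · subst hk
      by_cases h' : i = 0 ∧ j = 0 <;> simp [convPow, counit₂, conv_proj_zero, h', h.isHom_one.dom]
    · simp [counit₂, hk]
  · intro b _ hb
    simp [counit₂, hb]
  · simp

theorem liftRight_counit₂ {L i j k : ℕ} : liftRight s M L (fun p q => w * counit₂ p q) i j k =
    if i = 0 ∧ j = 0 ∧ k = 0 then w else 0 := by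
  rw [liftRight, Finset.sum_eq_single 0]
  · by_cases hi : i = 0
    · subst hi
      by_cases h' : j = 0 ∧ k = 0 <;> simp [convPow, counit₂, h', h.isHom_one.dom]
    · simp [counit₂, hi]
  · intro b _ hb
    simp [counit₂, hb]
  · simp

theorem liftLeft_rec {L i j k : ℕ} (hL : i + j ≤ L) : liftLeft s M L (iterProd₂ d t w) i j k =
    (if i = 0 ∧ j = 0 ∧ k = 0 then w else 0) +
      d * conv₃ s (liftLeft s M L (iterProd₂ d t w)) (liftLeft s M L M) i j k := by
  rw [conv₃_liftLeft h.braid_natural h.ops_natural h.ops_zero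
    (fun a b => (isHom_iterProd₂ h.isHom_dot h.isHom_star h.isHom_one a b).dom) hL,
    ← h.liftLeft_counit₂ (L := L), liftLeft, liftLeft, liftLeft, Finset.mul_sum,
    ← Finset.sum_add_distrib]
  refine Finset.sum_congr rfl fun r _ => ?_
  rw [h.iterProd₂_rec, add_mul, mul_assoc d]

theorem liftRight_rec {L i j k : ℕ} (hL : j + k ≤ L) : liftRight s M L (iterProd₂ d t w) i j k =
    (if i = 0 ∧ j = 0 ∧ k = 0 then w else 0) +
      d * conv₃ s (liftRight s M L (iterProd₂ d t w)) (liftRight s M L M) i j k := by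
  rw [conv₃_liftRight h.braid_natural h.ops_natural h.ops_zero
    (fun a b => (isHom_iterProd₂ h.isHom_dot h.isHom_star h.isHom_one a b).dom) hL,
    ← h.liftRight_counit₂ (L := L), liftRight, liftRight, liftRight, Finset.mul_sum,
    ← Finset.sum_add_distrib]
  refine Finset.sum_congr rfl fun r _ => ?_
  rw [h.iterProd₂_rec, add_mul, mul_assoc d]

theorem isHom_liftLeft (L i j k : ℕ) : IsHom (i + j + k) 1 (liftLeft s M L M i j k) :=
  IsHom.sum fun r _ => (h.ops_natural r k).isHom.mul
    ((isNatural_convPow h.braid_natural h.ops_natural r i j).isHom.conv (IsHom.proj k))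

theorem isHom_liftRight (L i j k : ℕ) : IsHom (i + j + k) 1 (liftRight s M L M i j k) :=
  IsHom.sum fun r _ => IsHom.mul (m := i + r) (h.ops_natural i r).isHom (((IsHom.proj i).conv
    (isNatural_convPow h.braid_natural h.ops_natural r j k).isHom).of_eq (by omega) rfl)

/-- The operations satisfy the associativity condition of a quantum `B_∞`-algebra: both sides
solve the same recursion. -/
theorem liftLeft_eq_liftRight {L i j k : ℕ} (hL : i + j + k ≤ L) :
    liftLeft s M L M i j k = liftRight s M L M i j k := by
  induction hn : i + j + k using Nat.strong_induction_on generalizing i j k with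
  | _ n ih =>
  have h₁ := h.liftLeft_iterProd₂_eq_liftRight (L := L) (i := i) (j := j) (k := k)
    (by omega) (by omega)
  rw [h.liftLeft_rec (by omega), h.liftRight_rec (by omega)] at h₁
  have h₂ := add_left_cancel h₁
  -- The summand of `conv₃` in which the first factor has degree zero.
  have key : ∀ F G : ℕ → ℕ → ℕ → Module.End K (TSpace K V), F 0 0 0 = w →
      IsHom (i + j + k) 1 (G i j k) → d * conv₃ s F G i j k = G i j k +
        ∑ x ∈ ad i, ∑ y ∈ ad j, ∑ z ∈ ad k, if x.1 + y.1 + z.1 = 0 then 0 else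
          d * ((F x.1 y.1 z.1 ⊛ G x.2 y.2 z.2) * shuffle₃ s x y z) := by
    intro F G hF hG
    have hterm : ∀ x ∈ ad i, ∀ y ∈ ad j, ∀ z ∈ ad k,
        d * ((F x.1 y.1 z.1 ⊛ G x.2 y.2 z.2) * shuffle₃ s x y z) =
        (if x = (0, i) then if y = (0, j) then if z = (0, k) then G i j k else 0 else 0 else 0) +
        if x.1 + y.1 + z.1 = 0 then 0 else
          d * ((F x.1 y.1 z.1 ⊛ G x.2 y.2 z.2) * shuffle₃ s x y z) := by
      rintro ⟨x₁, x₂⟩ hx ⟨y₁, y₂⟩ hy ⟨z₁, z₂⟩ hz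
      have hx := Finset.HasAntidiagonal.mem_antidiagonal.mp hx
      have hy := Finset.HasAntidiagonal.mem_antidiagonal.mp hy
      have hz := Finset.HasAntidiagonal.mem_antidiagonal.mp hz
      simp only at hx hy hz
      by_cases h0 : x₁ + y₁ + z₁ = 0
      · obtain ⟨⟨rfl, rfl⟩, rfl⟩ : (x₁ = 0 ∧ y₁ = 0) ∧ z₁ = 0 := by omega
        obtain rfl : x₂ = i := by omega
        obtain rfl : y₂ = j := by omega
        obtain rfl : z₂ = k := by omega
        have h₃ := h.isHom_one.interchange (f' := e 1) (g' := G x₂ y₂ z₂) (IsHom.proj 0)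
        rw [h.isHom_one.dom, hG.cod, proj_zero_conv] at h₃
        have h₄ : shuffle₃ s (0, x₂) (0, y₂) (0, z₂) = e (x₂ + y₂ + z₂) := by
          simp [shuffle₃, shuffle]
        simp only [if_true, add_zero]
        rw [hF, h₄, ← h₃, mul_assoc, hG.dom, ← mul_assoc, h.one_dot, hG.cod]
      · rw [if_neg h0]
        split_ifs with hx' hy' hz'
        · simp only [Prod.mk.injEq] at hx' hy' hz'
          omega
        all_goals simp
    rw [conv₃]
    simp only [Finset.mul_sum]
    rw [Finset.sum_congr rfl fun x hx => Finset.sum_congr rfl fun y hy =>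
      Finset.sum_congr rfl fun z hz => hterm x hx y hy z hz]
    simp only [Finset.sum_add_distrib]
    congr 1
    simp [Finset.sum_ite_eq']
  have hz₁ : liftLeft s M L (iterProd₂ d t w) 0 0 0 = w := by
    rw [h.liftLeft_iterProd₂ (by omega), h.iterProd₂_zero_zero]
    exact h.iterProd₂_zero_zero
  have hz₂ : liftRight s M L (iterProd₂ d t w) 0 0 0 = w := by
    rw [h.liftRight_iterProd₂ (by omega), h.iterProd₂_zero_zero]
    exact h.iterProd₂_zero_zero
  rw [key _ _ hz₁ (h.isHom_liftLeft L i j k), key _ _ hz₂ (h.isHom_liftRight L i j k)] at h₂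
  refine add_right_cancel (h₂.trans (congrArg _ (Finset.sum_congr rfl fun x hx =>
    Finset.sum_congr rfl fun y hy => Finset.sum_congr rfl fun z hz => ?_)))
  have hx := Finset.HasAntidiagonal.mem_antidiagonal.mp hx
  have hy := Finset.HasAntidiagonal.mem_antidiagonal.mp hy
  have hz := Finset.HasAntidiagonal.mem_antidiagonal.mp hz
  split_ifs with h0
  · rfl
  · rw [h.liftLeft_iterProd₂_eq_liftRight (by omega) (by omega),
      ih (x.2 + y.2 + z.2) (by omega) (by omega) rfl]

end IsOperationsOf

end Associativity

/-! ### Realizing tensor spaces inside `T(V)` -/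

section Realization

variable {K : Type u} [Field K] {V : Type v} [AddCommGroup V] [Module K V]

local notation "e" => proj K V
local notation "ad" => Finset.HasAntidiagonal.antidiagonal

section

variable {X Y Z X' Y' Z' : Type*} [AddCommGroup X] [Module K X] [AddCommGroup Y] [Module K Y]
  [AddCommGroup Z] [Module K Z] [AddCommGroup X'] [Module K X'] [AddCommGroup Y'] [Module K Y']
  [AddCommGroup Z'] [Module K Z']

/-- `r` identifies the space `X` with the homogeneous component `V^{⊗n}` of `T(V)`. -/
def IsReal (n : ℕ) (r : X →ₗ[K] TSpace K V) : Prop :=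
  ∃ φ : X ≃ₗ[K] (⨂[K]^n V), r = tIncl K V n ∘ₗ φ.toLinearMap

/-- The map `X ⊗ Y → T(V)` obtained from maps `X → T(V)` and `Y → T(V)` by concatenation. -/
def tensorReal (r : X →ₗ[K] TSpace K V) (r' : Y →ₗ[K] TSpace K V) : X ⊗[K] Y →ₗ[K] TSpace K V :=
  concat K V ∘ₗ TensorProduct.map r r'

infixr:75 " ⊠ " => tensorReal

@[simp]
theorem tensorReal_tmul (r : X →ₗ[K] TSpace K V) (r' : Y →ₗ[K] TSpace K V) (x : X) (y : Y) :
    (r ⊠ r') (x ⊗ₜ y) = tMul (r x) (r' y) := rfl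

theorem isReal_tIncl (n : ℕ) : IsReal n (tIncl K V n) := ⟨LinearEquiv.refl K _, rfl⟩

theorem isReal_gen : IsReal 1 (gen K V) := ⟨(oneEquiv K V).symm, rfl⟩

namespace IsReal

variable {n m : ℕ} {r : X →ₗ[K] TSpace K V} {r' : Y →ₗ[K] TSpace K V}

theorem exists_eq (h : IsReal n r) (x : X) : ∃ y, r x = tIncl K V n y := by
  obtain ⟨φ, rfl⟩ := h
  exact ⟨φ x, rfl⟩

theorem proj_apply (h : IsReal n r) (x : X) : e n (r x) = r x := by
  obtain ⟨y, hy⟩ := h.exists_eq x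
  rw [hy, proj_tIncl_self]

theorem exists_apply_eq (h : IsReal n r) (y : ⨂[K]^n V) : ∃ x, r x = tIncl K V n y := by
  obtain ⟨φ, rfl⟩ := h
  exact ⟨φ.symm y, by simp⟩

theorem injective (h : IsReal n r) : Function.Injective r := by
  obtain ⟨φ, rfl⟩ := h
  exact (tIncl_injective n).comp φ.injective

theorem tensor (h : IsReal n r) (h' : IsReal m r') : IsReal (n + m) (r ⊠ r') := by
  obtain ⟨φ, rfl⟩ := h
  obtain ⟨ψ, rfl⟩ := h'
  refine ⟨(TensorProduct.congr φ ψ).trans TensorPower.mulEquiv, ?_⟩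
  ext x y
  simp [tMul_tIncl]

/-- Operators on `V^{⊗n}` are equal if they agree on a realization. -/
theorem op_ext (h : IsReal n r) {F G : Module.End K (TSpace K V)} (hF : F * e n = F)
    (hG : G * e n = G) (hFG : F ∘ₗ r = G ∘ₗ r) : F = G := by
  refine TSpace.hom_ext fun k y => ?_
  by_cases hk : k = n
  · subst hk
    obtain ⟨x, hx⟩ := h.exists_apply_eq y
    rw [← hx]
    exact LinearMap.congr_fun hFG x
  · rw [apply_tIncl_ne hF hk, apply_tIncl_ne hG hk]

end IsReal

/-- The map `f : X → Y` is the restriction of the operator `F` to the realizations of `X` and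
`Y`. -/
def Realizes (r : X →ₗ[K] TSpace K V) (r' : Y →ₗ[K] TSpace K V) (f : X →ₗ[K] Y)
    (F : Module.End K (TSpace K V)) : Prop :=
  r' ∘ₗ f = F ∘ₗ r

namespace Realizes

variable {n m : ℕ} {rX : X →ₗ[K] TSpace K V} {rY : Y →ₗ[K] TSpace K V} {rZ : Z →ₗ[K] TSpace K V}
  {rX' : X' →ₗ[K] TSpace K V} {rY' : Y' →ₗ[K] TSpace K V}
  {f : X →ₗ[K] Y} {g : Y →ₗ[K] Z} {f' : X' →ₗ[K] Y'} {F G F' : Module.End K (TSpace K V)}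

theorem apply (h : Realizes rX rY f F) (x : X) : rY (f x) = F (rX x) := LinearMap.congr_fun h x

theorem comp (hg : Realizes rY rZ g G) (hf : Realizes rX rY f F) :
    Realizes rX rZ (g ∘ₗ f) (G * F) := by
  ext x
  simp [hg.apply, hf.apply]

theorem comp_one (hg : Realizes rY rZ g G) (hf : Realizes rX rY f 1) :
    Realizes rX rZ (g ∘ₗ f) G := by
  simpa using hg.comp hf

theorem one_comp (hg : Realizes rY rZ g 1) (hf : Realizes rX rY f F) :
    Realizes rX rZ (g ∘ₗ f) F := by
  simpa using hg.comp hf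

theorem refl : Realizes rX rX LinearMap.id 1 := rfl

theorem id (h : IsReal n rX) : Realizes rX rX LinearMap.id (e n) := by
  ext x
  simp [h.proj_apply]

theorem mul_proj (hX : IsReal n rX) (h : Realizes rX rY f F) : Realizes rX rY f (F * e n) := by
  ext x
  simp [hX.proj_apply, h.apply]

theorem symm {φ : X ≃ₗ[K] Y} (h : Realizes rX rY φ.toLinearMap 1) :
    Realizes rY rX φ.symm.toLinearMap 1 := by
  ext y
  have := h.apply (φ.symm y)
  simpa using this.symm

theorem sum {ι : Type*} {s : Finset ι} {f : ι → X →ₗ[K] Y} {F : ι → Module.End K (TSpace K V)}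
    (h : ∀ i ∈ s, Realizes rX rY (f i) (F i)) :
    Realizes rX rY (∑ i ∈ s, f i) (∑ i ∈ s, F i) := by
  ext x
  simp only [LinearMap.comp_apply, LinearMap.sum_apply, map_sum]
  exact Finset.sum_congr rfl fun i hi => (h i hi).apply x

theorem sub {f₁ f₂ : X →ₗ[K] Y} (h₁ : Realizes rX rY f₁ F) (h₂ : Realizes rX rY f₂ G) :
    Realizes rX rY (f₁ - f₂) (F - G) := by
  ext x
  simp [h₁.apply, h₂.apply]

theorem tensor (hX : IsReal n rX) (hF : F * e n = F) (h : Realizes rX rY f F)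
    (h' : Realizes rX' rY' f' F') :
    Realizes (rX ⊠ rX') (rY ⊠ rY') (TensorProduct.map f f') (F ⊛ F') := by
  ext x y
  obtain ⟨z, hz⟩ := hX.exists_eq x
  simp [h.apply, h'.apply, hz, conv_tMul_left hF]

theorem tensor_one (h : Realizes rX rY f 1) (h' : Realizes rX' rY' f' 1) :
    Realizes (rX ⊠ rX') (rY ⊠ rY') (TensorProduct.map f f') 1 := by
  ext x y
  simp [h.apply, h'.apply]

theorem assoc : Realizes ((rX ⊠ rY) ⊠ rZ) (rX ⊠ rY ⊠ rZ)
    (TensorProduct.assoc K X Y Z).toLinearMap 1 := by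
  ext x y z
  simp [tMul_assoc]

theorem op_eq (h₁ : Realizes rX rY f F) (h₂ : Realizes rX rY f G) (hX : IsReal n rX)
    (hF : F * e n = F) (hG : G * e n = G) : F = G :=
  hX.op_ext hF hG (Eq.trans (Eq.symm h₁) h₂)

theorem map_eq {f' : X →ₗ[K] Y} (h₁ : Realizes rX rY f F) (h₂ : Realizes rX rY f' F)
    (hY : IsReal n rY) : f = f' := by
  ext x
  exact hY.injective ((h₁.apply x).trans (h₂.apply x).symm)

end Realizes

end

theorem realizes_mulEquiv (n m : ℕ) : Realizes (tIncl K V n ⊠ tIncl K V m) (tIncl K V (n + m))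
    TensorPower.mulEquiv.toLinearMap 1 := by
  refine TensorProduct.ext' fun x y => ?_
  simp [tMul_tIncl]

theorem realizes_cast {n m : ℕ} (h : n = m) : Realizes (tIncl K V n) (tIncl K V m)
    (TensorPower.cast K V h).toLinearMap 1 := by
  refine LinearMap.ext fun x => ?_
  simp [tIncl_cast]

theorem realizes_oneEquiv : Realizes (tIncl K V 1) (gen K V) (oneEquiv K V).toLinearMap 1 := by
  refine LinearMap.ext fun x => ?_
  simp [gen_oneEquiv]

theorem realizes_pairEquiv : Realizes (gen K V ⊠ gen K V) (tIncl K V 2)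
    (pairEquiv K V).toLinearMap 1 := by
  refine TensorProduct.ext' fun x y => ?_
  simp [pairEquiv, gen, tMul_tIncl]

theorem realizes_threeBlocks {n k r : ℕ} (h : k + 2 + r = n) :
    Realizes ((tIncl K V k ⊠ tIncl K V 2) ⊠ tIncl K V r) (tIncl K V n)
      (threeBlocks K V h).toLinearMap 1 :=
  (realizes_cast h).one_comp ((realizes_mulEquiv _ _).one_comp
    ((realizes_mulEquiv _ _).tensor_one Realizes.refl))

theorem realizes_split {a b n : ℕ} (h : a + b = n) :
    Realizes (tIncl K V n) (tIncl K V a ⊠ tIncl K V b) (split K V a b h) 1 :=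
  (realizes_mulEquiv a b).symm.one_comp (realizes_cast h.symm)

/-- The operator on `T(V)` given by `g` on `V^{⊗n}` and by zero on the other components. -/
def extend (n : ℕ) (g : (⨂[K]^n V) →ₗ[K] TSpace K V) : Module.End K (TSpace K V) :=
  tLift fun k => if h : k = n then g ∘ₗ (TensorPower.cast K V h).toLinearMap else 0

theorem extend_tIncl (n : ℕ) (g : (⨂[K]^n V) →ₗ[K] TSpace K V) (x : ⨂[K]^n V) :
    extend n g (tIncl K V n x) = g x := by
  simp [extend, tLift_tIncl]

theorem extend_mul_proj (n : ℕ) (g : (⨂[K]^n V) →ₗ[K] TSpace K V) :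
    extend n g * e n = extend n g := by
  refine TSpace.hom_ext fun k x => ?_
  by_cases h : k = n
  · subst h; simp
  · simp [proj_tIncl_ne h, extend, tLift_tIncl, h]

theorem isHom_extend {n m : ℕ} {g : (⨂[K]^n V) →ₗ[K] TSpace K V} (hg : ∀ x, e m (g x) = g x) :
    IsHom n m (extend n g) := by
  refine ⟨extend_mul_proj n g, TSpace.hom_ext fun k x => ?_⟩
  by_cases h : k = n
  · subst h; simp [extend_tIncl, hg]
  · simp [extend, tLift_tIncl, h]

/-- The operator on `T(V)` of a linear endomorphism of `V ⊗ V`. -/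
def braidOp (σ : V ⊗[K] V →ₗ[K] V ⊗[K] V) : Module.End K (TSpace K V) :=
  extend 2 ((gen K V ⊠ gen K V) ∘ₗ σ ∘ₗ (pairEquiv K V).symm.toLinearMap)

/-- The operator on `T(V)` of a product `V ⊗ V → V`. -/
def mulOp (m : V ⊗[K] V →ₗ[K] V) : Module.End K (TSpace K V) :=
  extend 2 (gen K V ∘ₗ m ∘ₗ (pairEquiv K V).symm.toLinearMap)

variable (K) in
/-- The operator on `T(V)` of a unit `K → V`. -/
def unitOp (one : V) : Module.End K (TSpace K V) :=
  extend 0 (LinearMap.toSpanSingleton K (TSpace K V) (gen K V one) ∘ₗ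
    (TensorPower.algebraMap₀ (R := K) (M := V)).symm.toLinearMap)

/-- The operators on `T(V)` of a family of operations. -/
def opsOp (M : Ops K V) (p q : ℕ) : Module.End K (TSpace K V) :=
  extend (p + q) (gen K V ∘ₗ M p q ∘ₗ TensorPower.mulEquiv.symm.toLinearMap)

variable {σ : V ⊗[K] V →ₗ[K] V ⊗[K] V} {m : V ⊗[K] V →ₗ[K] V} {one : V}

theorem realizes_braidOp (σ : V ⊗[K] V →ₗ[K] V ⊗[K] V) :
    Realizes (gen K V ⊠ gen K V) (gen K V ⊠ gen K V) σ (braidOp σ) := by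
  refine LinearMap.ext fun x => ?_
  have := realizes_pairEquiv.apply x
  rw [Module.End.one_apply] at this
  rw [LinearMap.comp_apply, LinearMap.comp_apply, ← this, braidOp, LinearEquiv.coe_coe,
    extend_tIncl]
  simp

theorem realizes_mulOp (m : V ⊗[K] V →ₗ[K] V) :
    Realizes (gen K V ⊠ gen K V) (gen K V) m (mulOp m) := by
  refine LinearMap.ext fun x => ?_
  have := realizes_pairEquiv.apply x
  rw [Module.End.one_apply] at this
  rw [LinearMap.comp_apply, LinearMap.comp_apply, ← this, mulOp, LinearEquiv.coe_coe,
    extend_tIncl]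
  simp

theorem realizes_opsOp (M : Ops K V) (p q : ℕ) :
    Realizes (tIncl K V p ⊠ tIncl K V q) (gen K V) (M p q) (opsOp M p q) := by
  refine LinearMap.ext fun x => ?_
  have := (realizes_mulEquiv p q).apply x
  rw [Module.End.one_apply] at this
  rw [LinearMap.comp_apply, LinearMap.comp_apply, ← this, opsOp, LinearEquiv.coe_coe,
    extend_tIncl]
  simp

theorem unitOp_tOne (one : V) : unitOp K one (tOne K V) = gen K V one := by
  rw [tOne, unitOp, extend_tIncl]
  have : PiTensorProduct.tprod K (Fin.elim0 : Fin 0 → V) =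
    TensorPower.algebraMap₀ (R := K) (M := V) 1 := TensorPower.algebraMap₀_one.symm
  simp [this]

theorem isHom_braidOp (σ : V ⊗[K] V →ₗ[K] V ⊗[K] V) : IsHom 2 2 (braidOp σ) :=
  isHom_extend fun _ => (isReal_gen.tensor isReal_gen).proj_apply _

theorem isHom_mulOp (m : V ⊗[K] V →ₗ[K] V) : IsHom 2 1 (mulOp m) :=
  isHom_extend fun _ => isReal_gen.proj_apply _

theorem isHom_unitOp (one : V) : IsHom 0 1 (unitOp K one) :=
  isHom_extend fun _ => by simp [isReal_gen.proj_apply]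

theorem isHom_opsOp (M : Ops K V) (p q : ℕ) : IsHom (p + q) 1 (opsOp M p q) :=
  isHom_extend fun _ => isReal_gen.proj_apply _

/-! ### Translation of the structure maps -/

theorem realizes_sigmaOne (σ : V ⊗[K] V →ₗ[K] V ⊗[K] V) :
    Realizes ((gen K V ⊠ gen K V) ⊠ gen K V) ((gen K V ⊠ gen K V) ⊠ gen K V)
      (sigmaOne σ) (braidOp σ ⊛ e 1) :=
  (realizes_braidOp σ).tensor (isReal_gen.tensor isReal_gen) (isHom_braidOp σ).dom
    (Realizes.id isReal_gen)

theorem realizes_sigmaTwo (σ : V ⊗[K] V →ₗ[K] V ⊗[K] V) :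
    Realizes ((gen K V ⊠ gen K V) ⊠ gen K V) ((gen K V ⊠ gen K V) ⊠ gen K V)
      (sigmaTwo σ) (e 1 ⊛ braidOp σ) :=
  Realizes.assoc.symm.one_comp (((Realizes.id isReal_gen).tensor isReal_gen
    (proj_mul_self 1) (realizes_braidOp σ)).comp_one Realizes.assoc)

theorem isReal_gen₃ : IsReal 3 ((gen K V ⊠ gen K V) ⊠ gen K V) :=
  (isReal_gen.tensor isReal_gen).tensor isReal_gen

theorem isHom_braidOp_conv (σ : V ⊗[K] V →ₗ[K] V ⊗[K] V) : IsHom 3 3 (braidOp σ ⊛ e 1) :=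
  (isHom_braidOp σ).conv (IsHom.proj 1)

theorem isHom_conv_braidOp (σ : V ⊗[K] V →ₗ[K] V ⊗[K] V) : IsHom 3 3 (e 1 ⊛ braidOp σ) :=
  (IsHom.proj 1).conv (isHom_braidOp σ)

theorem isNatural_braidOp (h : IsBraiding σ) : IsNatural (braidOp σ) 2 2 (braidOp σ) := by
  refine IsNatural.of_yang_baxter (isHom_braidOp σ) ?_
  have h₁ := (realizes_sigmaOne σ).comp ((realizes_sigmaTwo σ).comp (realizes_sigmaOne σ))
  have h₂ := (realizes_sigmaTwo σ).comp ((realizes_sigmaOne σ).comp (realizes_sigmaTwo σ))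
  rw [h.yang_baxter] at h₁
  rw [mul_assoc, mul_assoc]
  exact h₁.op_eq h₂ isReal_gen₃
    ((isHom_braidOp_conv σ).mul ((isHom_conv_braidOp σ).mul (isHom_braidOp_conv σ))).dom
    ((isHom_conv_braidOp σ).mul ((isHom_braidOp_conv σ).mul (isHom_conv_braidOp σ))).dom

theorem realizes_rTensor_mulOp (m : V ⊗[K] V →ₗ[K] V) :
    Realizes ((gen K V ⊠ gen K V) ⊠ gen K V) (gen K V ⊠ gen K V) (LinearMap.rTensor V m)
      (mulOp m ⊛ e 1) :=
  (realizes_mulOp m).tensor (isReal_gen.tensor isReal_gen) (isHom_mulOp m).dom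
    (Realizes.id isReal_gen)

theorem realizes_lTensor_mulOp (m : V ⊗[K] V →ₗ[K] V) :
    Realizes ((gen K V ⊠ gen K V) ⊠ gen K V) (gen K V ⊠ gen K V)
      (LinearMap.lTensor V m ∘ₗ (TensorProduct.assoc K V V V).toLinearMap) (e 1 ⊛ mulOp m) :=
  ((Realizes.id isReal_gen).tensor isReal_gen (proj_mul_self 1) (realizes_mulOp m)).comp_one
    Realizes.assoc

theorem isNatural_mulOp (h : IsYBAlgebra σ m one) : IsNatural (braidOp σ) 2 1 (mulOp m) := by
  have hs := isHom_braidOp σ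
  have hr : IsHom 3 2 (mulOp m ⊛ e 1) := (isHom_mulOp m).conv (IsHom.proj 1)
  have hl : IsHom 3 2 (e 1 ⊛ mulOp m) := (IsHom.proj 1).conv (isHom_mulOp m)
  refine IsNatural.of_one hs (isHom_mulOp m) ?_ ?_
  · rw [braid_add_left hs 1 1 1, braid_one_one hs]
    have h₁ := (realizes_braidOp σ).comp (realizes_rTensor_mulOp m)
    have h₂ := (realizes_lTensor_mulOp m).comp ((realizes_sigmaOne σ).comp (realizes_sigmaTwo σ))
    rw [h.braid_mul_left] at h₁
    exact h₁.op_eq h₂ isReal_gen₃ (hs.mul hr).dom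
      (hl.mul ((isHom_braidOp_conv σ).mul (isHom_conv_braidOp σ))).dom
  · rw [braid_add_right hs 1 1 1, braid_one_one hs]
    have h₁ := (realizes_braidOp σ).comp (realizes_lTensor_mulOp m)
    have h₂ := (realizes_rTensor_mulOp m).comp ((realizes_sigmaTwo σ).comp (realizes_sigmaOne σ))
    rw [h.braid_mul_right] at h₁
    exact h₁.op_eq h₂ isReal_gen₃ (hs.mul hl).dom
      (hr.mul ((isHom_conv_braidOp σ).mul (isHom_braidOp_conv σ))).dom

theorem mulOp_assoc (h : IsYBAlgebra σ m one) :
    mulOp m * (mulOp m ⊛ e 1) = mulOp m * (e 1 ⊛ mulOp m) := by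
  have h₁ := (realizes_mulOp m).comp (realizes_rTensor_mulOp m)
  have h₂ := (realizes_mulOp m).comp (realizes_lTensor_mulOp m)
  have hr : IsHom 3 2 (mulOp m ⊛ e 1) := (isHom_mulOp m).conv (IsHom.proj 1)
  have hl : IsHom 3 2 (e 1 ⊛ mulOp m) := (IsHom.proj 1).conv (isHom_mulOp m)
  have : m ∘ₗ LinearMap.rTensor V m =
      m ∘ₗ LinearMap.lTensor V m ∘ₗ (TensorProduct.assoc K V V V).toLinearMap :=
    TensorProduct.ext_threefold fun a b c => by simpa using h.assoc a b c
  rw [this] at h₁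
  exact h₁.op_eq h₂ isReal_gen₃ ((isHom_mulOp m).mul hr).dom ((isHom_mulOp m).mul hl).dom

theorem mulOp_one_left (h : IsYBAlgebra σ m one) : mulOp m * (unitOp K one ⊛ e 1) = e 1 := by
  refine isReal_gen.op_ext ?_ (proj_mul_self 1) (LinearMap.ext fun v => ?_)
  · exact ((isHom_mulOp m).mul ((isHom_unitOp one).conv (IsHom.proj 1))).dom
  · have h₁ := conv_tMul_left (isHom_unitOp one).dom (e 1)
      (PiTensorProduct.tprod K Fin.elim0) (gen K V v)
    rw [← tOne, tOne_tMul, unitOp_tOne, isReal_gen.proj_apply] at h₁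
    rw [LinearMap.comp_apply, LinearMap.comp_apply, Module.End.mul_apply, h₁,
      isReal_gen.proj_apply, ← tensorReal_tmul, ← (realizes_mulOp m).apply, h.one_mul]

theorem mulOp_one_right (h : IsYBAlgebra σ m one) : mulOp m * (e 1 ⊛ unitOp K one) = e 1 := by
  refine isReal_gen.op_ext ?_ (proj_mul_self 1) (LinearMap.ext fun v => ?_)
  · exact ((isHom_mulOp m).mul ((IsHom.proj 1).conv (isHom_unitOp one))).dom
  · have h₁ := conv_tMul_right (isHom_unitOp one).dom (e 1) (gen K V v)
      (PiTensorProduct.tprod K Fin.elim0)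
    rw [← tOne, tMul_tOne, unitOp_tOne, isReal_gen.proj_apply] at h₁
    rw [LinearMap.comp_apply, LinearMap.comp_apply, Module.End.mul_apply, h₁,
      isReal_gen.proj_apply, ← tensorReal_tmul, ← (realizes_mulOp m).apply, h.mul_one]

theorem realizes_iterMul (h : IsYBAlgebra σ m one) (k : ℕ) :
    Realizes (tIncl K V (k + 1)) (gen K V) (iterMul m k)
      (iterProd (mulOp m) (unitOp K one) (k + 1)) := by
  induction k with
  | zero =>
    rw [iterProd, iterProd, mulOp_one_left h]
    have h₁ := realizes_oneEquiv.mul_proj (isReal_tIncl (K := K) (V := V) 1)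
    rwa [one_mul] at h₁
  | succ k ih =>
    have h₁ := realizes_oneEquiv.mul_proj (isReal_tIncl (K := K) (V := V) 1)
    rw [one_mul] at h₁
    exact (realizes_mulOp m).comp ((ih.tensor (isReal_tIncl _)
      (isHom_iterProd (isHom_mulOp m) (isHom_unitOp one) _).dom h₁).comp_one
        (realizes_mulEquiv _ _).symm)

theorem realizes_sigmaAt (σ : V ⊗[K] V →ₗ[K] V ⊗[K] V) {n k r : ℕ} (h : k + 2 + r = n) :
    Realizes (tIncl K V n) (tIncl K V n) (sigmaAt σ n k) (e k ⊛ braidOp σ ⊛ e r) := by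
  obtain rfl : r = n - (k + 2) := by omega
  rw [sigmaAt, dif_pos (by omega), ← conv_assoc]
  refine (realizes_threeBlocks _).one_comp (Realizes.comp_one ?_ (realizes_threeBlocks _).symm)
  refine Realizes.tensor ((isReal_tIncl k).tensor (isReal_tIncl 2))
    ((IsHom.proj k).conv (isHom_braidOp σ)).dom ?_ (Realizes.id (isReal_tIncl _))
  exact (Realizes.id (isReal_tIncl _)).tensor (isReal_tIncl _) (proj_mul_self k)
    (realizes_pairEquiv.one_comp ((realizes_braidOp σ).comp_one realizes_pairEquiv.symm))

theorem wordLift_append (σ : V ⊗[K] V →ₗ[K] V ⊗[K] V) (n : ℕ) (w w' : List ℕ) :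
    wordLift σ n (w ++ w') = wordLift σ n w ∘ₗ wordLift σ n w' := by
  simp [wordLift, Module.End.mul_eq_comp]

theorem realizes_wordLift_row (σ : V ⊗[K] V →ₗ[K] V ⊗[K] V) {n a j r : ℕ} (h : a + (j + 1) + r = n) :
    Realizes (tIncl K V n) (tIncl K V n) (wordLift σ n ((List.range j).reverse.map fun b => a + b))
      (e a ⊛ rowBraid (braidOp σ) j ⊛ e r) := by
  induction j generalizing r with
  | zero =>
    have := Realizes.id (isReal_tIncl (K := K) (V := V) n)
    simp only [rowBraid, conv_proj_proj]
    rw [show a + (1 + r) = n by omega]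
    exact this
  | succ j ih =>
    have h₁ := realizes_sigmaAt σ (n := n) (k := a + j) (r := r) (by omega)
    have h₂ := ih (r := 1 + r) (by omega)
    have h₃ := h₁.comp h₂
    rw [List.range_succ, List.reverse_append, List.map_append, wordLift_append]
    have h₄ : wordLift σ n (([j].reverse).map fun b => a + b) = sigmaAt σ n (a + j) := by
      simp [wordLift]
    rw [h₄, rowBraid]
    simpa only [mul_conv_proj, proj_conv_mul, conv_assoc, conv_proj_proj, proj_conv_proj_conv]
      using h₃

theorem chiWord_succ (i j : ℕ) :
    chiWord (i + 1) j = chiWord i j ++ (List.range j).reverse.map fun b => i + b := by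
  simp [chiWord, List.range_succ]

theorem realizes_wordLift_chiWord (σ : V ⊗[K] V →ₗ[K] V ⊗[K] V) {n i j r : ℕ} (h : i + j + r = n) :
    Realizes (tIncl K V n) (tIncl K V n) (wordLift σ n (chiWord i j))
      (braid (braidOp σ) i j ⊛ e r) := by
  induction i generalizing r with
  | zero =>
    have := Realizes.id (isReal_tIncl (K := K) (V := V) n)
    simp only [braid_zero_left, conv_proj_proj]
    rw [show j + r = n by omega]
    exact this
  | succ i ih =>
    have h₁ := ih (r := 1 + r) (by omega)
    have h₂ := realizes_wordLift_row σ (n := n) (a := i) (j := j) (r := r) (by omega)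
    have h₃ := h₁.comp h₂
    rw [chiWord_succ, wordLift_append, braid]
    simpa only [mul_conv_proj, proj_conv_mul, conv_assoc, conv_proj_proj, proj_conv_proj_conv]
      using h₃

theorem realizes_betaComp (σ : V ⊗[K] V →ₗ[K] V ⊗[K] V) (i j : ℕ) :
    Realizes (tIncl K V i ⊠ tIncl K V j) (tIncl K V j ⊠ tIncl K V i) (betaComp σ i j)
      (braid (braidOp σ) i j) := by
  have h := realizes_wordLift_chiWord σ (n := i + j) (i := i) (j := j) (r := 0) rfl
  rw [conv_proj_zero] at h
  exact (realizes_mulEquiv j i).symm.one_comp ((realizes_cast _).one_comp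
    (h.comp_one (realizes_mulEquiv i j)))

end Realization

/-! ### Translation of the operations -/

section Operations

variable {K : Type u} [Field K] {V : Type v} [AddCommGroup V] [Module K V]

local notation "e" => proj K V
local notation "ad" => Finset.HasAntidiagonal.antidiagonal

/-- `id ⊗ b ⊗ id` on `(A ⊗ A') ⊗ (B ⊗ B')`. -/
def middle {A A' B B' : Type*} [AddCommGroup A] [Module K A] [AddCommGroup A'] [Module K A']
    [AddCommGroup B] [Module K B] [AddCommGroup B'] [Module K B']
    (b : A' ⊗[K] B →ₗ[K] B ⊗[K] A') :
    (A ⊗[K] A') ⊗[K] (B ⊗[K] B') →ₗ[K] (A ⊗[K] B) ⊗[K] (A' ⊗[K] B') :=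
  (TensorProduct.assoc K A B (A' ⊗[K] B')).symm.toLinearMap ∘ₗ
    TensorProduct.map LinearMap.id ((TensorProduct.assoc K B A' B').toLinearMap ∘ₗ
      TensorProduct.map b LinearMap.id ∘ₗ (TensorProduct.assoc K A' B B').symm.toLinearMap) ∘ₗ
    (TensorProduct.assoc K A A' (B ⊗[K] B')).toLinearMap

theorem realizes_middle (σ : V ⊗[K] V →ₗ[K] V ⊗[K] V) (x y : ℕ × ℕ) :
    Realizes ((tIncl K V x.1 ⊠ tIncl K V x.2) ⊠ (tIncl K V y.1 ⊠ tIncl K V y.2))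
      ((tIncl K V x.1 ⊠ tIncl K V y.1) ⊠ (tIncl K V x.2 ⊠ tIncl K V y.2))
      (middle (betaComp σ x.2 y.1)) (shuffle (braidOp σ) x y) :=
  Realizes.assoc.symm.one_comp (((Realizes.id (isReal_tIncl _)).tensor (isReal_tIncl _)
    (proj_mul_self _) (Realizes.assoc.one_comp (((realizes_betaComp σ _ _).tensor
      ((isReal_tIncl _).tensor (isReal_tIncl _)) (isHom_braid (isHom_braidOp σ) _ _).dom
      (Realizes.id (isReal_tIncl _))).comp_one Realizes.assoc.symm))).comp_one Realizes.assoc)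

theorem midMap_beta_incl (σ : V ⊗[K] V →ₗ[K] V ⊗[K] V) (x y : ℕ × ℕ)
    (z : (⨂[K]^x.1 V) ⊗[K] (⨂[K]^x.2 V)) (w : (⨂[K]^y.1 V) ⊗[K] (⨂[K]^y.2 V)) :
    midMap (beta σ) (incl K V x.1 x.2 z ⊗ₜ incl K V y.1 y.2 w) =
      TensorProduct.map (incl K V x.1 y.1) (incl K V x.2 y.2)
        (middle (betaComp σ x.2 y.1) (z ⊗ₜ w)) := by
  induction z with
  | zero => simp
  | add z z' hz hz' => simp only [map_add, TensorProduct.add_tmul, hz, hz']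
  | tmul a a' =>
  induction w with
  | zero => simp
  | add z z' hz hz' => simp only [map_add, TensorProduct.tmul_add, hz, hz']
  | tmul b b' =>
    have h : beta σ (tIncl K V x.2 a' ⊗ₜ tIncl K V y.1 b) =
        incl K V y.1 x.2 (betaComp σ x.2 y.1 (a' ⊗ₜ b)) :=
      LinearMap.congr_fun (ofComponents_comp_incl
        (fun i j => incl K V j i ∘ₗ betaComp σ i j) x.2 y.1) (a' ⊗ₜ b)
    simp only [midMap, middle, incl_tmul, LinearMap.comp_apply, LinearEquiv.coe_coe,
      TensorProduct.assoc_tmul, LinearMap.lTensor_tmul, TensorProduct.assoc_symm_tmul,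
      LinearMap.rTensor_tmul, h, TensorProduct.map_tmul, LinearMap.id_coe, id_eq]
    generalize betaComp σ x.2 y.1 (a' ⊗ₜ b) = c
    induction c with
    | zero => simp
    | add z z' hz hz' => simp only [map_add, TensorProduct.add_tmul, TensorProduct.tmul_add, hz, hz']
    | tmul c c' => simp [incl_tmul]

/-- The components of the braided coproduct. -/
theorem coprodBeta_comp_incl (σ : V ⊗[K] V →ₗ[K] V ⊗[K] V) (p q : ℕ) :
    coprodBeta σ ∘ₗ incl K V p q = ∑ x ∈ (ad p).attach, ∑ y ∈ (ad q).attach,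
      TensorProduct.map (incl K V x.1.1 y.1.1) (incl K V x.1.2 y.1.2) ∘ₗ
        middle (betaComp σ x.1.2 y.1.1) ∘ₗ TensorProduct.map
          (split K V x.1.1 x.1.2 (Finset.HasAntidiagonal.mem_antidiagonal.mp x.2))
          (split K V y.1.1 y.1.2 (Finset.HasAntidiagonal.mem_antidiagonal.mp y.2)) := by
  refine TensorProduct.ext' fun a b => ?_
  simp only [coprodBeta, LinearMap.comp_apply, incl_tmul, TensorProduct.map_tmul, deconc_tIncl,
    TensorProduct.sum_tmul, TensorProduct.tmul_sum, map_sum, LinearMap.sum_apply]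
  rw [Finset.sum_comm]
  exact Finset.sum_congr rfl fun x _ => Finset.sum_congr rfl fun y _ =>
    midMap_beta_incl σ x.1 y.1 _ _

theorem map_mulEquiv {W : Type*} [AddCommGroup W] [Module K W] {X : Type*} [AddCommGroup X]
    [Module K X] (f : X →ₗ[K] W) (n m : ℕ) :
    PiTensorProduct.map (fun _ => f) ∘ₗ TensorPower.mulEquiv.toLinearMap =
      TensorPower.mulEquiv.toLinearMap ∘ₗ
        TensorProduct.map (PiTensorProduct.map fun _ : Fin n => f)
          (PiTensorProduct.map fun _ : Fin m => f) := by
  ext a b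
  simp only [LinearMap.compMultilinearMap_apply, TensorProduct.AlgebraTensorModule.curry_apply,
    LinearMap.coe_restrictScalars, TensorProduct.curry_apply, LinearMap.comp_apply,
    LinearEquiv.coe_coe, TensorProduct.map_tmul, PiTensorProduct.map_tprod]
  rw [← TensorPower.gMul_def, ← TensorPower.gMul_def, TensorPower.tprod_mul_tprod,
    TensorPower.tprod_mul_tprod, PiTensorProduct.map_tprod]
  congr 1
  ext i
  refine Fin.addCases (fun i => ?_) (fun i => ?_) i <;> simp

theorem map_oneEquiv_symm {W : Type*} [AddCommGroup W] [Module K W] {X : Type*} [AddCommGroup X]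
    [Module K X] (f : X →ₗ[K] W) :
    PiTensorProduct.map (fun _ => f) ∘ₗ (oneEquiv K X).symm.toLinearMap =
      (oneEquiv K W).symm.toLinearMap ∘ₗ f := by
  ext a
  simp [oneEquiv_symm_apply]

theorem opsPow_zero (σ : V ⊗[K] V →ₗ[K] V ⊗[K] V) (M : Ops K V) :
    opsPow σ M 0 = (oneEquiv K V).symm.toLinearMap ∘ₗ ofComponents M :=
  map_oneEquiv_symm _

theorem opsPow_succ (σ : V ⊗[K] V →ₗ[K] V ⊗[K] V) (M : Ops K V) (n : ℕ) :
    opsPow σ M (n + 1) = TensorPower.mulEquiv.toLinearMap ∘ₗ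
      TensorProduct.map (opsPow σ M n) ((oneEquiv K V).symm.toLinearMap ∘ₗ ofComponents M) ∘ₗ
        reducedCoprod σ := by
  rw [opsPow, iter, ← LinearMap.comp_assoc, map_mulEquiv, LinearMap.comp_assoc]
  refine congrArg (TensorPower.mulEquiv.toLinearMap ∘ₗ ·) ?_
  rw [← map_oneEquiv_symm, opsPow, TensorProduct.map_comp, LinearMap.comp_assoc]

theorem comp_sum {ι X Y Z : Type*} [AddCommGroup X] [Module K X] [AddCommGroup Y] [Module K Y]
    [AddCommGroup Z] [Module K Z] (s : Finset ι) (g : Y →ₗ[K] Z) (f : ι → X →ₗ[K] Y) :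
    g ∘ₗ ∑ i ∈ s, f i = ∑ i ∈ s, g ∘ₗ f i := by
  ext x
  simp

theorem opsOp_zero {M : Ops K V} {p q : ℕ} (h : M p q = 0) : opsOp M p q = 0 := by
  simp only [opsOp, h, LinearMap.zero_comp, LinearMap.comp_zero]
  refine TSpace.hom_ext fun k x => ?_
  by_cases hk : k = p + q
  · subst hk; simp [extend_tIncl]
  · simp [extend, tLift_tIncl]

/-- The component `M^{⊗(n+1)} ∘ (reduced Δ_β)^{(n)}` is the `(n+1)`-st convolution power of `M`: the
correction terms of the reduced coproduct do not contribute, as `M_{00} = 0`. -/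
theorem realizes_opsPow (σ : V ⊗[K] V →ₗ[K] V ⊗[K] V) {M : Ops K V} (hM : M 0 0 = 0) (n p q : ℕ) :
    Realizes (tIncl K V p ⊠ tIncl K V q) (tIncl K V (n + 1)) (opsPow σ M n ∘ₗ incl K V p q)
      (convPow (braidOp σ) (opsOp M) (n + 1) p q) := by
  have h₁ : ∀ p q, Realizes (tIncl K V p ⊠ tIncl K V q) (tIncl K V 1)
      (((oneEquiv K V).symm.toLinearMap ∘ₗ ofComponents M) ∘ₗ incl K V p q) (opsOp M p q) := by
    intro p q
    rw [LinearMap.comp_assoc, ofComponents_comp_incl]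
    exact realizes_oneEquiv.symm.one_comp (realizes_opsOp M p q)
  induction n generalizing p q with
  | zero =>
    rw [opsPow_zero, convPow, convPow, conv₂_counit₂_left fun a b => (isHom_opsOp M a b).dom]
    exact h₁ p q
  | succ n ih =>
    have hg : tOne K V ⊗ₜ[K] tOne K V = incl K V 0 0
      (PiTensorProduct.tprod K Fin.elim0 ⊗ₜ PiTensorProduct.tprod K Fin.elim0) := rfl
    have hM' : ((oneEquiv K V).symm.toLinearMap ∘ₗ ofComponents M) (tOne K V ⊗ₜ tOne K V) = 0 := by
      rw [hg, ← LinearMap.comp_apply, LinearMap.comp_assoc, ofComponents_comp_incl, hM]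
      simp
    have hP : opsPow σ M n (tOne K V ⊗ₜ tOne K V) = 0 := by
      refine tIncl_injective (n + 1) ?_
      have h := (ih 0 0).apply
        (PiTensorProduct.tprod K Fin.elim0 ⊗ₜ PiTensorProduct.tprod K Fin.elim0)
      rwa [convPow_eq_zero (opsOp_zero hM) (by omega), LinearMap.zero_apply,
        LinearMap.comp_apply, ← hg, ← map_zero (tIncl K V (n + 1))] at h
    have hsucc : opsPow σ M (n + 1) ∘ₗ incl K V p q = TensorPower.mulEquiv.toLinearMap ∘ₗ
        TensorProduct.map (opsPow σ M n) ((oneEquiv K V).symm.toLinearMap ∘ₗ ofComponents M) ∘ₗ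
          coprodBeta σ ∘ₗ incl K V p q := by
      rw [opsPow_succ]
      refine LinearMap.ext fun z => ?_
      simp only [reducedCoprod, LinearMap.comp_apply (x := z), LinearMap.comp_apply,
        LinearMap.sub_apply, LinearMap.flip_apply, TensorProduct.mk_apply, map_sub,
        TensorProduct.map_tmul, hP]
      rw [← LinearMap.comp_apply (oneEquiv K V).symm.toLinearMap, hM']
      simp
    rw [hsucc, coprodBeta_comp_incl, convPow, conv₂, ← Finset.sum_attach (ad p)]
    simp only [comp_sum, ← Finset.sum_attach (ad q)]
    refine Realizes.sum fun x _ => Realizes.sum fun y _ => ?_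
    rw [← LinearMap.comp_assoc _ _ (TensorProduct.map (opsPow σ M n) _), ← TensorProduct.map_comp]
    exact (realizes_mulEquiv _ _).one_comp (((ih _ _).tensor
      ((isReal_tIncl _).tensor (isReal_tIncl _)) (isHom_convPow (isHom_braidOp σ) (isHom_opsOp M) _ _ _).dom (h₁ _ _)).comp
        ((realizes_middle σ x.1 y.1).comp_one ((realizes_split _).tensor_one (realizes_split _))))

/-! ### The operations of a 2-YB algebra -/

theorem opsOp_congr {M M' : Ops K V} {p q : ℕ} (h : M p q = M' p q) :
    opsOp M p q = opsOp M' p q := by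
  simp only [opsOp, h]

end Operations

section TwoYB

variable {K : Type u} [Field K] {V : Type v} [AddCommGroup V] [Module K V]

local notation "e" => proj K V
local notation "ad" => Finset.HasAntidiagonal.antidiagonal

variable {σ : V ⊗[K] V →ₗ[K] V ⊗[K] V} {star dot : V ⊗[K] V →ₗ[K] V} {one : V}

theorem twoYBOps_zero_zero : twoYBOps σ star dot 0 0 = 0 := by
  rw [twoYBOps]

theorem twoYBOps_one_zero (v : Fin 1 → V) (w : Fin 0 → V) :
    twoYBOps σ star dot 1 0 (PiTensorProduct.tprod K v ⊗ₜ PiTensorProduct.tprod K w) = v 0 := by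
  rw [twoYBOps]
  simp [oneEquiv_tprod, TensorPower.algebraMap₀]

theorem twoYBOps_zero_one (v : Fin 0 → V) (w : Fin 1 → V) :
    twoYBOps σ star dot 0 1 (PiTensorProduct.tprod K v ⊗ₜ PiTensorProduct.tprod K w) = w 0 := by
  rw [twoYBOps]
  simp [oneEquiv_tprod, TensorPower.algebraMap₀]

theorem twoYBOps_right_zero {n : ℕ} (hn : 2 ≤ n) : twoYBOps σ star dot n 0 = 0 := by
  obtain ⟨n, rfl⟩ := Nat.exists_eq_add_of_le' hn
  rw [twoYBOps]

theorem twoYBOps_left_zero {n : ℕ} (hn : 2 ≤ n) : twoYBOps σ star dot 0 n = 0 := by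
  obtain ⟨n, rfl⟩ := Nat.exists_eq_add_of_le' hn
  rw [twoYBOps]

/-- The operations of total degree less than `N`, the others being replaced by zero. -/
def truncOps (M : Ops K V) (N : ℕ) : Ops K V := fun i j => if i + j < N then M i j else 0

theorem twoYBOps_succ_succ (p q : ℕ) : twoYBOps σ star dot (p + 1) (q + 1) =
    star ∘ₗ TensorProduct.map (iterMul dot p) (iterMul dot q) -
      ∑ s ∈ Finset.Ico 1 ((p + 1) + (q + 1)), iterMul dot s ∘ₗ
        opsPow σ (truncOps (twoYBOps σ star dot) ((p + 1) + (q + 1))) s ∘ₗ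
          incl K V (p + 1) (q + 1) := by
  rw [twoYBOps]
  rfl

theorem opsOp_one_zero : opsOp (twoYBOps σ star dot) 1 0 = e 1 := by
  refine IsReal.op_ext ((isReal_tIncl 1).tensor (isReal_tIncl 0)) (isHom_opsOp _ 1 0).dom
    (proj_mul_self 1) ?_
  refine Eq.trans (Eq.symm (realizes_opsOp _ 1 0)) ?_
  ext v w
  simp only [LinearMap.compMultilinearMap_apply, TensorProduct.AlgebraTensorModule.curry_apply,
    LinearMap.coe_restrictScalars, TensorProduct.curry_apply, LinearMap.comp_apply]
  rw [twoYBOps_one_zero, tensorReal_tmul, tIncl_tprod_zero, tMul_tOne, proj_tIncl_self,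
    ← gen_oneEquiv, oneEquiv_tprod]

theorem opsOp_zero_one : opsOp (twoYBOps σ star dot) 0 1 = e 1 := by
  refine IsReal.op_ext ((isReal_tIncl 0).tensor (isReal_tIncl 1)) (isHom_opsOp _ 0 1).dom
    (proj_mul_self 1) ?_
  refine Eq.trans (Eq.symm (realizes_opsOp _ 0 1)) ?_
  ext v w
  simp only [LinearMap.compMultilinearMap_apply, TensorProduct.AlgebraTensorModule.curry_apply,
    LinearMap.coe_restrictScalars, TensorProduct.curry_apply, LinearMap.comp_apply]
  rw [twoYBOps_zero_one, tensorReal_tmul, tIncl_tprod_zero, tOne_tMul, proj_tIncl_self,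
    ← gen_oneEquiv, oneEquiv_tprod]

theorem opsOp_right_zero (n : ℕ) :
    opsOp (twoYBOps σ star dot) n 0 = if n = 1 then e 1 else 0 := by
  split_ifs with h
  · subst h; exact opsOp_one_zero
  · rcases Nat.lt_or_ge n 2 with h' | h'
    · obtain rfl : n = 0 := by omega
      exact opsOp_zero twoYBOps_zero_zero
    · exact opsOp_zero (twoYBOps_right_zero h')

theorem opsOp_left_zero (n : ℕ) :
    opsOp (twoYBOps σ star dot) 0 n = if n = 1 then e 1 else 0 := by
  split_ifs with h
  · subst h; exact opsOp_zero_one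
  · rcases Nat.lt_or_ge n 2 with h' | h'
    · obtain rfl : n = 0 := by omega
      exact opsOp_zero twoYBOps_zero_zero
    · exact opsOp_zero (twoYBOps_left_zero h')

theorem truncOps_zero_zero (N : ℕ) : truncOps (twoYBOps σ star dot) N 0 0 = 0 := by
  simp [truncOps, twoYBOps_zero_zero]

theorem realizes_iterMul_mul_opsPow (hdot : IsYBAlgebra σ dot one) (N s p q : ℕ) :
    Realizes (tIncl K V p ⊠ tIncl K V q) (gen K V)
      (iterMul dot s ∘ₗ opsPow σ (truncOps (twoYBOps σ star dot) N) s ∘ₗ incl K V p q)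
      (iterProd (mulOp dot) (unitOp K one) (s + 1) * convPow (braidOp σ)
        (opsOp (truncOps (twoYBOps σ star dot) N)) (s + 1) p q) :=
  (realizes_iterMul hdot s).comp (realizes_opsPow σ (truncOps_zero_zero N) s p q)

theorem opsOp_succ_succ (hdot : IsYBAlgebra σ dot one) (p q : ℕ) :
    opsOp (twoYBOps σ star dot) (p + 1) (q + 1) =
      iterProd₂ (mulOp dot) (mulOp star) (unitOp K one) (p + 1) (q + 1) -
        ∑ s ∈ Finset.Ico 1 ((p + 1) + (q + 1)),
          iterProd (mulOp dot) (unitOp K one) (s + 1) * convPow (braidOp σ)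
            (opsOp (truncOps (twoYBOps σ star dot) ((p + 1) + (q + 1)))) (s + 1)
            (p + 1) (q + 1) := by
  have hP := isHom_iterProd (isHom_mulOp dot) (isHom_unitOp one)
  refine Realizes.op_eq (realizes_opsOp _ _ _) (f := twoYBOps σ star dot (p + 1) (q + 1)) ?_
    ((isReal_tIncl (p + 1)).tensor (isReal_tIncl (q + 1))) (isHom_opsOp _ _ _).dom ?_
  · rw [twoYBOps_succ_succ]
    exact ((realizes_mulOp star).comp ((realizes_iterMul hdot p).tensor (isReal_tIncl _)
      (hP _).dom (realizes_iterMul hdot q))).sub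
      (Realizes.sum fun s _ => realizes_iterMul_mul_opsPow hdot _ s _ _)
  · exact ((isHom_iterProd₂ (isHom_mulOp dot) (isHom_mulOp star) (isHom_unitOp one) _ _).sub
      (IsHom.sum fun s _ => (hP _).mul (isHom_convPow (isHom_braidOp σ) (isHom_opsOp _) _ _ _))).dom

theorem isNatural_iterProd (hdot : IsYBAlgebra σ dot one) (n : ℕ) :
    IsNatural (braidOp σ) (n + 1) 1 (iterProd (mulOp dot) (unitOp K one) (n + 1)) := by
  have hs := isHom_braidOp σ
  induction n with
  | zero =>
    rw [iterProd, iterProd, mulOp_one_left hdot]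
    exact IsNatural.proj hs 1
  | succ n ih => exact (isNatural_mulOp hdot).mul (ih.conv hs (IsNatural.proj hs 1))

/-- By induction on the total degree: the recursion expresses an operation through the products and
operations of smaller degree, all of which are natural. -/
theorem isNatural_opsOp (h : IsTwoYBAlgebra σ star dot one) (p q : ℕ) :
    IsNatural (braidOp σ) (p + q) 1 (opsOp (twoYBOps σ star dot) p q) := by
  have hs := isNatural_braidOp h.dot_isYB.isBraiding
  induction hN : p + q using Nat.strong_induction_on generalizing p q with
  | _ N ih =>
  subst hN
  match p, q with
  | p, 0 =>
    rw [opsOp_right_zero]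
    split_ifs with hp
    · subst hp; exact IsNatural.proj hs.isHom 1
    · exact IsNatural.zero _ _
  | 0, q =>
    rw [opsOp_left_zero]
    split_ifs with hq
    · subst hq; exact IsNatural.proj hs.isHom 1
    · exact IsNatural.zero _ _
  | p + 1, q + 1 =>
    have hM : ∀ a b, IsNatural (braidOp σ) (a + b) 1
        (opsOp (truncOps (twoYBOps σ star dot) ((p + 1) + (q + 1))) a b) := by
      intro a b
      by_cases hab : a + b < (p + 1) + (q + 1)
      · rw [opsOp_congr (M' := twoYBOps σ star dot) (by simp only [truncOps, if_pos hab])]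
        exact ih _ hab a b rfl
      · rw [opsOp_zero (by simp only [truncOps, if_neg hab])]
        exact IsNatural.zero _ _
    rw [opsOp_succ_succ h.dot_isYB]
    exact ((isNatural_mulOp h.star_isYB).mul ((isNatural_iterProd h.dot_isYB p).conv hs.isHom
      (isNatural_iterProd h.dot_isYB q))).sub (IsNatural.sum fun s _ =>
        (isNatural_iterProd h.dot_isYB s).mul (isNatural_convPow hs hM _ _ _))

theorem convPow_right_zero (n p : ℕ) :
    convPow (braidOp σ) (opsOp (twoYBOps σ star dot)) n p 0 = if n = p then e p else 0 := by
  induction n generalizing p with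
  | zero =>
    by_cases hp : p = 0
    · subst hp; simp [convPow, counit₂]
    · simp [convPow, counit₂, hp, Ne.symm hp]
  | succ n ih =>
    rw [convPow, conv₂]
    simp only [Finset.HasAntidiagonal.antidiagonal_zero, Finset.sum_singleton, ih, opsOp_right_zero]
    cases p with
    | zero => simp
    | succ p =>
      rw [Finset.sum_eq_single (p, 1)]
      · by_cases hp : n = p
        · subst hp; simp [shuffle]
        · simp [hp]
      · rintro ⟨a, b⟩ hab hne
        have hab := Finset.HasAntidiagonal.mem_antidiagonal.mp hab
        have : b ≠ 1 := by rintro rfl; exact hne (by simpa using hab)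
        simp [this]
      · intro h'
        exact (h' (Finset.HasAntidiagonal.mem_antidiagonal.mpr (show p + 1 = p + 1 from rfl))).elim

theorem convPow_left_zero (n p : ℕ) :
    convPow (braidOp σ) (opsOp (twoYBOps σ star dot)) n 0 p = if n = p then e p else 0 := by
  induction n generalizing p with
  | zero =>
    by_cases hp : p = 0
    · subst hp; simp [convPow, counit₂]
    · simp [convPow, counit₂, hp, Ne.symm hp]
  | succ n ih =>
    rw [convPow, conv₂]
    simp only [Finset.HasAntidiagonal.antidiagonal_zero, Finset.sum_singleton, ih, opsOp_left_zero]
    cases p with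
    | zero => simp
    | succ p =>
      rw [Finset.sum_eq_single (p, 1)]
      · by_cases hp : n = p
        · subst hp; simp [shuffle]
        · simp [hp]
      · rintro ⟨a, b⟩ hab hne
        have hab := Finset.HasAntidiagonal.mem_antidiagonal.mp hab
        have : b ≠ 1 := by rintro rfl; exact hne (by simpa using hab)
        simp [this]
      · intro h'
        exact (h' (Finset.HasAntidiagonal.mem_antidiagonal.mpr (show p + 1 = p + 1 from rfl))).elim

/-- The truncated operations of the recursion can be replaced by the operations themselves. -/
theorem convPow_truncOps (n p q : ℕ) :
    convPow (braidOp σ) (opsOp (truncOps (twoYBOps σ star dot) (p + q))) (n + 2) p q =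
      convPow (braidOp σ) (opsOp (twoYBOps σ star dot)) (n + 2) p q := by
  have h : ∀ a b, a + b < p + q → opsOp (truncOps (twoYBOps σ star dot) (p + q)) a b =
      opsOp (twoYBOps σ star dot) a b := by
    intro a b hab
    refine opsOp_congr ?_
    simp only [truncOps, if_pos hab]
  exact convPow_congr_of_lt h (opsOp_zero (truncOps_zero_zero _)) (opsOp_zero twoYBOps_zero_zero) n

theorem isOperationsOf_opsOp (h : IsTwoYBAlgebra σ star dot one) :
    IsOperationsOf (braidOp σ) (opsOp (twoYBOps σ star dot)) (mulOp dot) (mulOp star)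
      (unitOp K one) where
  braid_natural := isNatural_braidOp h.dot_isYB.isBraiding
  ops_natural := isNatural_opsOp h
  ops_zero := opsOp_zero twoYBOps_zero_zero
  isHom_dot := isHom_mulOp dot
  isHom_star := isHom_mulOp star
  isHom_one := isHom_unitOp one
  one_dot := mulOp_one_left h.dot_isYB
  one_star := mulOp_one_left h.star_isYB
  star_assoc := mulOp_assoc h.star_isYB
  iterProd₂_eq p q := by
    have hP := isHom_iterProd (isHom_mulOp dot) (isHom_unitOp one)
    match p, q with
    | p, 0 =>
      simp only [convPow_right_zero, add_zero]
      rw [Finset.sum_eq_single p (fun n _ hn => by simp [hn]) (by simp), if_pos rfl, (hP p).dom,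
        iterProd₂, iterProd]
      have := (IsHom.proj 1).interchange (f' := unitOp K one) (g' := e 0) (hP p)
      rw [(hP p).cod, (isHom_unitOp one).dom, conv_proj_zero] at this
      rw [← this, ← mul_assoc, mulOp_one_right h.star_isYB, (hP p).cod]
    | 0, q =>
      simp only [convPow_left_zero, zero_add]
      rw [Finset.sum_eq_single q (fun n _ hn => by simp [hn]) (by simp), if_pos rfl, (hP q).dom,
        iterProd₂, iterProd]
      have := (isHom_unitOp (K := K) one).interchange (f' := e 1)
        (g' := iterProd (mulOp dot) (unitOp K one) q) (IsHom.proj 0)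
      rw [(hP q).cod, (isHom_unitOp one).dom, proj_zero_conv] at this
      rw [← this, ← mul_assoc, mulOp_one_left h.star_isYB, (hP q).cod]
    | p + 1, q + 1 =>
      have hpow : ∀ s ∈ Finset.Ico 1 ((p + 1) + (q + 1)),
          convPow (braidOp σ) (opsOp (truncOps (twoYBOps σ star dot) ((p + 1) + (q + 1)))) (s + 1)
            (p + 1) (q + 1) =
          convPow (braidOp σ) (opsOp (twoYBOps σ star dot)) (s + 1) (p + 1) (q + 1) := by
        intro s hs
        obtain ⟨s, rfl⟩ := Nat.exists_eq_add_of_le' (Finset.mem_Ico.mp hs).1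
        exact convPow_truncOps s (p + 1) (q + 1)
      have hM := opsOp_succ_succ (star := star) h.dot_isYB p q
      rw [Finset.sum_congr rfl fun s hs => by rw [hpow s hs], eq_sub_iff_add_eq] at hM
      rw [← hM, Finset.sum_range_succ', Finset.range_eq_Ico,
        Finset.sum_eq_sum_Ico_succ_bot (show 0 < (p + 1) + (q + 1) by omega)]
      have h₀ : iterProd (mulOp dot) (unitOp K one) (0 + 1) = e 1 := by
        rw [iterProd, iterProd, mulOp_one_left h.dot_isYB]
      have h₁ : convPow (braidOp σ) (opsOp (twoYBOps σ star dot)) (0 + 1) (p + 1) (q + 1) =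
          opsOp (twoYBOps σ star dot) (p + 1) (q + 1) := by
        rw [convPow, convPow, conv₂_counit₂_left fun a b => (isHom_opsOp _ a b).dom]
      rw [h₀, h₁, (isHom_opsOp _ _ _).cod]
      simp [convPow, counit₂]

end TwoYB

section QuantumBInftyAlgebra

variable {K : Type u} [Field K] {V : Type v} [AddCommGroup V] [Module K V]

local notation "e" => proj K V
local notation "ad" => Finset.HasAntidiagonal.antidiagonal

variable {σ : V ⊗[K] V →ₗ[K] V ⊗[K] V} {star dot : V ⊗[K] V →ₗ[K] V} {one : V}

theorem betaComp_ops_left {M : Ops K V} {i j : ℕ}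
    (hM : IsNatural (braidOp σ) (i + j) 1 (opsOp M i j)) (k : ℕ) :
    betaComp σ 1 k ∘ₗ
        TensorProduct.map ((oneEquiv K V).symm.toLinearMap ∘ₗ M i j) LinearMap.id =
      TensorProduct.map LinearMap.id ((oneEquiv K V).symm.toLinearMap ∘ₗ M i j ∘ₗ
          TensorPower.mulEquiv.symm.toLinearMap) ∘ₗ
        betaComp σ (i + j) k ∘ₗ
        TensorProduct.map TensorPower.mulEquiv.toLinearMap LinearMap.id := by
  have hM₁ := realizes_oneEquiv.symm.one_comp (realizes_opsOp M i j)
  have h₁ := (realizes_betaComp σ 1 k).comp (hM₁.tensor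
    ((isReal_tIncl i).tensor (isReal_tIncl j)) hM.isHom.dom (Realizes.id (isReal_tIncl k)))
  have h₂ := ((Realizes.id (isReal_tIncl k)).tensor (isReal_tIncl k) (proj_mul_self k)
    (hM₁.comp_one (realizes_mulEquiv i j).symm)).comp ((realizes_betaComp σ (i + j) k).comp_one
      ((realizes_mulEquiv i j).tensor_one Realizes.refl))
  rw [hM.left] at h₁
  exact h₁.map_eq h₂ ((isReal_tIncl k).tensor (isReal_tIncl 1))

theorem betaComp_ops_right {M : Ops K V} {j k : ℕ}
    (hM : IsNatural (braidOp σ) (j + k) 1 (opsOp M j k)) (i : ℕ) :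
    betaComp σ i 1 ∘ₗ
        TensorProduct.map LinearMap.id ((oneEquiv K V).symm.toLinearMap ∘ₗ M j k) =
      TensorProduct.map ((oneEquiv K V).symm.toLinearMap ∘ₗ M j k ∘ₗ
          TensorPower.mulEquiv.symm.toLinearMap) LinearMap.id ∘ₗ
        betaComp σ i (j + k) ∘ₗ
        TensorProduct.map LinearMap.id TensorPower.mulEquiv.toLinearMap := by
  have hM₁ := realizes_oneEquiv.symm.one_comp (realizes_opsOp M j k)
  have h₁ := (realizes_betaComp σ i 1).comp ((Realizes.id (isReal_tIncl i)).tensor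
    (isReal_tIncl i) (proj_mul_self i) hM₁)
  have h₂ := ((hM₁.comp_one (realizes_mulEquiv j k).symm).tensor (isReal_tIncl (j + k))
    hM.isHom.dom (Realizes.id (isReal_tIncl i))).comp ((realizes_betaComp σ i (j + k)).comp_one
      (Realizes.refl.tensor_one (realizes_mulEquiv j k)))
  rw [hM.right] at h₁
  exact h₁.map_eq h₂ ((isReal_tIncl 1).tensor (isReal_tIncl i))

theorem sum_range_succ_eq_of_vanishing {N : Type*} [AddCommMonoid N] {f : ℕ → N} {n L : ℕ}
    (hL : n ≤ L) (h₀ : f 0 = 0) (h : ∀ r, n < r → f r = 0) :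
    ∑ r ∈ Finset.range n, f (r + 1) = ∑ r ∈ Finset.range (L + 1), f r := by
  rw [Finset.sum_range_succ', h₀, add_zero]
  exact Finset.sum_subset (Finset.range_mono hL) fun r _ hr => h _ (by simp at hr; omega)

/-- The identity `liftLeft_eq_liftRight` in terms of tensor powers. -/
theorem ops_assoc {M : Ops K V} {d t w : Module.End K (TSpace K V)} (hM : M 0 0 = 0)
    (h : IsOperationsOf (braidOp σ) (opsOp M) d t w) {i j k : ℕ} (hi : 1 ≤ i) (hj : 1 ≤ j) :
    ∑ s ∈ Finset.range (i + j),
        M (s + 1) k ∘ₗ TensorProduct.map (opsPow σ M s ∘ₗ incl K V i j) LinearMap.id =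
      (∑ s ∈ Finset.range (j + k),
        M i (s + 1) ∘ₗ TensorProduct.map LinearMap.id (opsPow σ M s ∘ₗ incl K V j k)) ∘ₗ
        (TensorProduct.assoc K (⨂[K]^i V) (⨂[K]^j V) (⨂[K]^k V)).toLinearMap := by
  have hp := isHom_convPow (isHom_braidOp σ) (isHom_opsOp M)
  have h₁ : Realizes ((tIncl K V i ⊠ tIncl K V j) ⊠ tIncl K V k) (gen K V)
      (∑ s ∈ Finset.range (i + j),
        M (s + 1) k ∘ₗ TensorProduct.map (opsPow σ M s ∘ₗ incl K V i j) LinearMap.id)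
      (liftLeft (braidOp σ) (opsOp M) (i + j + k) (opsOp M) i j k) := by
    rw [liftLeft, ← sum_range_succ_eq_of_vanishing (n := i + j) (by omega)]
    · exact Realizes.sum fun s _ => (realizes_opsOp M (s + 1) k).comp ((realizes_opsPow σ hM s i j).tensor
        ((isReal_tIncl i).tensor (isReal_tIncl j)) (hp _ _ _).dom (Realizes.id (isReal_tIncl k)))
    · rw [convPow, counit₂, if_neg (by omega), zero_conv, mul_zero]
    · intro r hr
      rw [convPow_eq_zero (opsOp_zero hM) hr, zero_conv, mul_zero]
  have h₂ : Realizes (tIncl K V i ⊠ tIncl K V j ⊠ tIncl K V k) (gen K V)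
      (∑ s ∈ Finset.range (j + k),
        M i (s + 1) ∘ₗ TensorProduct.map LinearMap.id (opsPow σ M s ∘ₗ incl K V j k))
      (liftRight (braidOp σ) (opsOp M) (i + j + k) (opsOp M) i j k) := by
    rw [liftRight, ← sum_range_succ_eq_of_vanishing (n := j + k) (by omega)]
    · exact Realizes.sum fun s _ => (realizes_opsOp M i (s + 1)).comp ((Realizes.id (isReal_tIncl i)).tensor
        (isReal_tIncl i) (proj_mul_self i) (realizes_opsPow σ hM s j k))
    · rw [convPow, counit₂, if_neg (by omega), conv_zero, mul_zero]
    · intro r hr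
      rw [convPow_eq_zero (opsOp_zero hM) hr, conv_zero, mul_zero]
  rw [h.liftLeft_eq_liftRight le_rfl] at h₁
  exact h₁.map_eq (h₂.comp_one Realizes.assoc) isReal_gen

/-- The operations of a unital 2-YB algebra form a quantum `B_∞`-algebra. -/
theorem isQuantumBInfty_twoYBOps (h : IsTwoYBAlgebra σ star dot one) :
    IsQuantumBInfty σ (twoYBOps σ star dot) where
  isBraiding := h.star_isYB.isBraiding
  zero_zero := twoYBOps_zero_zero
  one_zero := twoYBOps_one_zero
  zero_one := twoYBOps_zero_one
  right_zero _ := twoYBOps_right_zero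
  left_zero _ := twoYBOps_left_zero
  braid_left i j k _ _ _ := betaComp_ops_left (isNatural_opsOp h i j) k
  braid_right i j k _ _ _ := betaComp_ops_right (isNatural_opsOp h j k) i
  assoc _ _ _ hi hj _ := ops_assoc twoYBOps_zero_zero (isOperationsOf_opsOp h) hi hj

end QuantumBInftyAlgebra

/-! ### Functoriality -/

section Functoriality

variable {K : Type u} [Field K] {V W : Type v} [AddCommGroup V] [Module K V] [AddCommGroup W]
  [Module K W]

local notation "ad" => Finset.HasAntidiagonal.antidiagonal

/-- The map `T(f) : T(V) → T(W)` induced by a linear map `f : V → W`. -/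
def tMap (f : V →ₗ[K] W) : TSpace K V →ₗ[K] TSpace K W :=
  tLift fun n => tIncl K W n ∘ₗ PiTensorProduct.map fun _ => f

variable {f : V →ₗ[K] W}

theorem tMap_tIncl (n : ℕ) (x : ⨂[K]^n V) :
    tMap f (tIncl K V n x) = tIncl K W n (PiTensorProduct.map (fun _ => f) x) := by
  simp [tMap, tLift_tIncl]

theorem tMap_tOne : tMap f (tOne K V) = tOne K W := by
  rw [tOne, tMap_tIncl, PiTensorProduct.map_tprod, tIncl_tprod_zero]

theorem tMap_tMul (x y : TSpace K V) : tMap f (tMul x y) = tMul (tMap f x) (tMap f y) := by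
  induction x using TSpace.induction with
  | hzero => simp
  | hadd x x' hx hy => simp [add_tMul, hx, hy]
  | hincl n x =>
  induction y using TSpace.induction with
  | hzero => simp
  | hadd x x' hx hy => simp [tMul_add, hx, hy]
  | hincl m y =>
    have := LinearMap.congr_fun (map_mulEquiv f n m) (x ⊗ₜ y)
    simp only [LinearMap.comp_apply, LinearEquiv.coe_coe, TensorProduct.map_tmul] at this
    rw [tMul_tIncl, tMap_tIncl, tMap_tIncl, tMap_tIncl, tMul_tIncl, this]

theorem tMap_gen (v : V) : tMap f (gen K V v) = gen K W (f v) := by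
  have := LinearMap.congr_fun (map_oneEquiv_symm f) v
  simp only [LinearMap.comp_apply, LinearEquiv.coe_coe] at this
  rw [gen, gen, LinearMap.comp_apply, LinearMap.comp_apply, LinearEquiv.coe_coe, tMap_tIncl, this]
  rfl

theorem deconc_tMap (x : TSpace K V) :
    deconc K W (tMap f x) = TensorProduct.map (tMap f) (tMap f) (deconc K V x) := by
  induction x using TSpace.cons_induction with
  | hadd x y hx hy => simp [hx, hy]
  | hsmul c x hx => simp [hx]
  | hone => simp [tMap_tOne, deconc_tOne]
  | hcons v x hx =>
    rw [tMap_tMul, tMap_gen, deconc_gen_tMul, hx, deconc_gen_tMul, map_add, TensorProduct.map_tmul,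
      tMap_tOne, tMap_tMul, tMap_gen]
    congr 1
    generalize deconc K V x = z
    induction z with
    | zero => simp
    | add a b ha hb => simp only [map_add, ha, hb]
    | tmul a b => simp [tMap_tMul, tMap_gen]

/-- The operators `F` on `T(V)` and `F'` on `T(W)` are intertwined by `T(f)`. -/
def Intertwines (f : V →ₗ[K] W) (F : Module.End K (TSpace K V)) (F' : Module.End K (TSpace K W)) :
    Prop :=
  tMap f ∘ₗ F = F' ∘ₗ tMap f

namespace Intertwines

variable {F G : Module.End K (TSpace K V)} {F' G' : Module.End K (TSpace K W)}

theorem apply (h : Intertwines f F F') (x : TSpace K V) : tMap f (F x) = F' (tMap f x) :=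
  LinearMap.congr_fun h x

theorem mul (h : Intertwines f F F') (h' : Intertwines f G G') :
    Intertwines f (F * G) (F' * G') := by
  ext x
  simp [h.apply, h'.apply]

theorem zero : Intertwines f 0 0 := by
  simp [Intertwines]

theorem sum {ι : Type*} {s : Finset ι} {F : ι → Module.End K (TSpace K V)}
    {F' : ι → Module.End K (TSpace K W)} (h : ∀ i ∈ s, Intertwines f (F i) (F' i)) :
    Intertwines f (∑ i ∈ s, F i) (∑ i ∈ s, F' i) := by
  ext x
  simp only [LinearMap.comp_apply, LinearMap.sum_apply, map_sum]
  exact Finset.sum_congr rfl fun i hi => (h i hi).apply x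

theorem sub (h : Intertwines f F F') (h' : Intertwines f G G') :
    Intertwines f (F - G) (F' - G') := by
  ext x
  simp [h.apply, h'.apply]

theorem proj (n : ℕ) : Intertwines f (proj K V n) (proj K W n) := by
  refine TSpace.hom_ext fun k x => ?_
  rw [LinearMap.comp_apply, LinearMap.comp_apply, tMap_tIncl]
  by_cases h : k = n
  · subst h; simp [tMap_tIncl]
  · simp [proj_tIncl_ne h]

theorem conv (h : Intertwines f F F') (h' : Intertwines f G G') :
    Intertwines f (F ⊛ G) (F' ⊛ G') := by
  refine LinearMap.ext fun x => ?_
  simp only [QuantumBInfty.conv, LinearMap.comp_apply, deconc_tMap]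
  generalize deconc K V x = z
  induction z with
  | zero => simp
  | add a b ha hb => simp only [map_add, ha, hb]
  | tmul a b => simp [concat_tmul, tMap_tMul, h.apply, h'.apply]

theorem rowBraid {s : Module.End K (TSpace K V)} {s' : Module.End K (TSpace K W)}
    (hs : Intertwines f s s') (j : ℕ) : Intertwines f (rowBraid s j) (rowBraid s' j) := by
  induction j with
  | zero => exact proj 1
  | succ j ih => exact ((proj j).conv hs).mul (ih.conv (proj 1))

theorem braid {s : Module.End K (TSpace K V)} {s' : Module.End K (TSpace K W)}
    (hs : Intertwines f s s') (i j : ℕ) : Intertwines f (braid s i j) (braid s' i j) := by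
  induction i with
  | zero => exact proj j
  | succ i ih => exact (ih.conv (proj 1)).mul ((proj i).conv (hs.rowBraid j))

theorem convPow {s : Module.End K (TSpace K V)} {s' : Module.End K (TSpace K W)}
    (hs : Intertwines f s s') {M : ℕ → ℕ → Module.End K (TSpace K V)}
    {M' : ℕ → ℕ → Module.End K (TSpace K W)} (hM : ∀ a b, Intertwines f (M a b) (M' a b))
    (n p q : ℕ) : Intertwines f (convPow s M n p q) (convPow s' M' n p q) := by
  induction n generalizing p q with
  | zero =>
    simp only [QuantumBInfty.convPow, counit₂]
    split_ifs
    · exact proj 0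
    · exact zero
  | succ n ih =>
    exact sum fun x _ => sum fun y _ => ((ih _ _).conv (hM _ _)).mul
      ((proj _).conv ((hs.braid _ _).conv (proj _)))

end Intertwines

section

variable {X Y X' Y' : Type*} [AddCommGroup X] [Module K X] [AddCommGroup Y] [Module K Y]
  [AddCommGroup X'] [Module K X'] [AddCommGroup Y'] [Module K Y']
  {rX : X →ₗ[K] TSpace K V} {rY : Y →ₗ[K] TSpace K V} {rX' : X' →ₗ[K] TSpace K W}
  {rY' : Y' →ₗ[K] TSpace K W} {φ : X →ₗ[K] X'} {ψ : Y →ₗ[K] Y'} {g : X →ₗ[K] Y} {g' : X' →ₗ[K] Y'}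
  {G : Module.End K (TSpace K V)} {G' : Module.End K (TSpace K W)}

theorem tMap_comp_tensorReal (hX : tMap f ∘ₗ rX = rX' ∘ₗ φ) (hY : tMap f ∘ₗ rY = rY' ∘ₗ ψ) :
    tMap f ∘ₗ (rX ⊠ rY) = (rX' ⊠ rY') ∘ₗ TensorProduct.map φ ψ := by
  refine TensorProduct.ext' fun x y => ?_
  have h₁ := LinearMap.congr_fun hX x
  have h₂ := LinearMap.congr_fun hY y
  simp only [LinearMap.comp_apply] at h₁ h₂
  simp [tMap_tMul, h₁, h₂]

theorem intertwines_of_realizes {n : ℕ} (hr : IsReal n rX) (hG : G * proj K V n = G)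
    (hG' : G' * proj K W n = G') (h : Realizes rX rY g G) (h' : Realizes rX' rY' g' G')
    (hX : tMap f ∘ₗ rX = rX' ∘ₗ φ) (hY : tMap f ∘ₗ rY = rY' ∘ₗ ψ) (hg : ψ ∘ₗ g = g' ∘ₗ φ) :
    Intertwines f G G' := by
  refine TSpace.hom_ext fun k y => ?_
  rw [LinearMap.comp_apply, LinearMap.comp_apply]
  by_cases hk : k = n
  · subst hk
    obtain ⟨x, hx⟩ := hr.exists_apply_eq y
    have h₁ := LinearMap.congr_fun hX x
    have h₂ := LinearMap.congr_fun hY (g x)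
    have h₃ := LinearMap.congr_fun hg x
    simp only [LinearMap.comp_apply] at h₁ h₂ h₃
    rw [← hx, ← h.apply, h₂, h₃, h'.apply, h₁]
  · rw [apply_tIncl_ne hG hk, tMap_tIncl, apply_tIncl_ne hG' hk, map_zero]

theorem comp_eq_of_intertwines {n : ℕ} (hr : IsReal n rY') (hG : Intertwines f G G')
    (h : Realizes rX rY g G) (h' : Realizes rX' rY' g' G')
    (hX : tMap f ∘ₗ rX = rX' ∘ₗ φ) (hY : tMap f ∘ₗ rY = rY' ∘ₗ ψ) : ψ ∘ₗ g = g' ∘ₗ φ := by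
  refine LinearMap.ext fun x => hr.injective ?_
  have h₁ := LinearMap.congr_fun hX x
  have h₂ := LinearMap.congr_fun hY (g x)
  simp only [LinearMap.comp_apply] at h₁ h₂ ⊢
  rw [← h₂, h.apply, hG.apply, h₁, h'.apply]

end

theorem tMap_comp_gen (f : V →ₗ[K] W) : tMap f ∘ₗ gen K V = gen K W ∘ₗ f :=
  LinearMap.ext tMap_gen

theorem tMap_comp_tIncl (f : V →ₗ[K] W) (n : ℕ) :
    tMap f ∘ₗ tIncl K V n = tIncl K W n ∘ₗ PiTensorProduct.map fun _ => f :=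
  LinearMap.ext (tMap_tIncl n)

theorem intertwines_braidOp {σ : V ⊗[K] V →ₗ[K] V ⊗[K] V} {σ' : W ⊗[K] W →ₗ[K] W ⊗[K] W}
    (h : TensorProduct.map f f ∘ₗ σ = σ' ∘ₗ TensorProduct.map f f) :
    Intertwines f (braidOp σ) (braidOp σ') :=
  intertwines_of_realizes (isReal_gen.tensor isReal_gen) (isHom_braidOp σ).dom
    (isHom_braidOp σ').dom (realizes_braidOp σ) (realizes_braidOp σ')
    (tMap_comp_tensorReal (tMap_comp_gen f) (tMap_comp_gen f))
    (tMap_comp_tensorReal (tMap_comp_gen f) (tMap_comp_gen f)) h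

theorem intertwines_mulOp {m : V ⊗[K] V →ₗ[K] V} {m' : W ⊗[K] W →ₗ[K] W}
    (h : ∀ a b, f (m (a ⊗ₜ b)) = m' (f a ⊗ₜ f b)) : Intertwines f (mulOp m) (mulOp m') :=
  intertwines_of_realizes (isReal_gen.tensor isReal_gen) (isHom_mulOp m).dom
    (isHom_mulOp m').dom (realizes_mulOp m) (realizes_mulOp m')
    (tMap_comp_tensorReal (tMap_comp_gen f) (tMap_comp_gen f)) (tMap_comp_gen f)
    (TensorProduct.ext' h)

section

variable {σ : V ⊗[K] V →ₗ[K] V ⊗[K] V} {star dot : V ⊗[K] V →ₗ[K] V} {one : V}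
  {σ' : W ⊗[K] W →ₗ[K] W ⊗[K] W} {star' dot' : W ⊗[K] W →ₗ[K] W} {one' : W}

/-- A morphism of 2-YB algebras need not preserve the unit, so that only the iterated products of at
least one factor are considered. -/
theorem intertwines_iterProd (hV : IsYBAlgebra σ dot one) (hW : IsYBAlgebra σ' dot' one')
    (h : ∀ a b, f (dot (a ⊗ₜ b)) = dot' (f a ⊗ₜ f b)) (n : ℕ) :
    Intertwines f (iterProd (mulOp dot) (unitOp K one) (n + 1))
      (iterProd (mulOp dot') (unitOp K one') (n + 1)) := by
  induction n with
  | zero =>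
    rw [iterProd, iterProd, iterProd, iterProd, mulOp_one_left hV, mulOp_one_left hW]
    exact Intertwines.proj 1
  | succ n ih => exact (intertwines_mulOp h).mul (ih.conv (Intertwines.proj 1))

theorem intertwines_opsOp (hV : IsTwoYBAlgebra σ star dot one)
    (hW : IsTwoYBAlgebra σ' star' dot' one')
    (hσ : TensorProduct.map f f ∘ₗ σ = σ' ∘ₗ TensorProduct.map f f)
    (hstar : ∀ a b, f (star (a ⊗ₜ b)) = star' (f a ⊗ₜ f b))
    (hdot : ∀ a b, f (dot (a ⊗ₜ b)) = dot' (f a ⊗ₜ f b)) (p q : ℕ) :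
    Intertwines f (opsOp (twoYBOps σ star dot) p q) (opsOp (twoYBOps σ' star' dot') p q) := by
  induction hN : p + q using Nat.strong_induction_on generalizing p q with
  | _ N ih =>
  subst hN
  match p, q with
  | p, 0 =>
    rw [opsOp_right_zero, opsOp_right_zero]
    split_ifs
    · exact Intertwines.proj 1
    · exact Intertwines.zero
  | 0, q =>
    rw [opsOp_left_zero, opsOp_left_zero]
    split_ifs
    · exact Intertwines.proj 1
    · exact Intertwines.zero
  | p + 1, q + 1 =>
    have hM : ∀ a b, Intertwines f
        (opsOp (truncOps (twoYBOps σ star dot) ((p + 1) + (q + 1))) a b)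
        (opsOp (truncOps (twoYBOps σ' star' dot') ((p + 1) + (q + 1))) a b) := by
      intro a b
      by_cases hab : a + b < (p + 1) + (q + 1)
      · rw [opsOp_congr (M := truncOps (twoYBOps σ star dot) _) (M' := twoYBOps σ star dot)
            (by simp only [truncOps, if_pos hab]),
          opsOp_congr (M := truncOps (twoYBOps σ' star' dot') _) (M' := twoYBOps σ' star' dot')
            (by simp only [truncOps, if_pos hab])]
        exact ih _ hab a b rfl
      · rw [opsOp_zero (M := truncOps (twoYBOps σ star dot) _) (by simp only [truncOps, if_neg hab]),
          opsOp_zero (M := truncOps (twoYBOps σ' star' dot') _)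
            (by simp only [truncOps, if_neg hab])]
        exact Intertwines.zero
    have hP := intertwines_iterProd hV.dot_isYB hW.dot_isYB hdot
    rw [opsOp_succ_succ hV.dot_isYB, opsOp_succ_succ hW.dot_isYB]
    exact ((intertwines_mulOp hstar).mul ((hP p).conv (hP q))).sub (Intertwines.sum fun s _ =>
      (hP s).mul ((intertwines_braidOp hσ).convPow hM _ _ _))

/-- Morphisms of 2-YB algebras are compatible with the operations. -/
theorem isQBInftyHom_twoYBOps (hV : IsTwoYBAlgebra σ star dot one)
    (hW : IsTwoYBAlgebra σ' star' dot' one')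
    (hσ : TensorProduct.map f f ∘ₗ σ = σ' ∘ₗ TensorProduct.map f f)
    (hstar : ∀ a b, f (star (a ⊗ₜ b)) = star' (f a ⊗ₜ f b))
    (hdot : ∀ a b, f (dot (a ⊗ₜ b)) = dot' (f a ⊗ₜ f b)) :
    IsQBInftyHom σ (twoYBOps σ star dot) σ' (twoYBOps σ' star' dot') f where
  map_braiding := hσ
  map_ops p q := comp_eq_of_intertwines isReal_gen (intertwines_opsOp hV hW hσ hstar hdot p q)
    (realizes_opsOp _ p q) (realizes_opsOp _ p q)
    (tMap_comp_tensorReal (tMap_comp_tIncl f p) (tMap_comp_tIncl f q)) (tMap_comp_gen f)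

end

end Functoriality

end QuantumBInfty

end

theorem proposition5p2 (K : Type u) [Field K] [CharZero K] :
    ∃ (h : ∀ (V : Type v) [AddCommGroup V] [Module K V]
        (σ : V ⊗[K] V →ₗ[K] V ⊗[K] V) (star dot : V ⊗[K] V →ₗ[K] V) (one : V),
        QuantumBInfty.IsTwoYBAlgebra σ star dot one →
          QuantumBInfty.IsQuantumBInfty σ (QuantumBInfty.twoYBOps σ star dot))
      (hf : ∀ {A B : QuantumBInfty.TwoYBAlg.{u, v} K} (f : A ⟶ B),
        QuantumBInfty.IsQBInftyHom A.σ (QuantumBInfty.twoYBOps A.σ A.star A.dot)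
          B.σ (QuantumBInfty.twoYBOps B.σ B.star B.dot) f.lin)
      (F : QuantumBInfty.TwoYBAlg.{u, v} K ⥤ QuantumBInfty.QBInftyAlg.{u, v} K),
      F.toPrefunctor =
        { obj := fun A =>
            { carrier := A.carrier
              σ := A.σ
              M := QuantumBInfty.twoYBOps A.σ A.star A.dot
              isQuantumBInfty := h A.carrier A.σ A.star A.dot A.one A.isTwoYBAlgebra }
          map := fun f => { lin := f.lin, isHom := hf f } } := by
  refine ⟨fun V _ _ σ star dot one h => QuantumBInfty.isQuantumBInfty_twoYBOps h,
    fun {A B} f => QuantumBInfty.isQBInftyHom_twoYBOps A.isTwoYBAlgebra B.isTwoYBAlgebra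
      f.map_braiding f.map_star f.map_dot,
    { obj := _, map := _, map_id := fun _ => rfl, map_comp := fun _ _ => rfl }, rfl⟩
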